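/- **Theorem.** Let $n\ge 7$ be an integer and let $S=\{\pm a,\pm b,\pm c\}\subset\mathbb Z_n$ be such that $|S|=6$ and $\langle S\rangle=\mathbb Z_n$. Let $\Gamma=\mathrm{Circ}(n;S)$ be the graph with vertex set $\mathbb Z_n$ in which distinct $i,j$ are adjacent if and only if $j-i\in S$ (so $\Gamma$ is connected and $6$-regular). Call $\Gamma$ *distance magic* if there are a bijection $\ell:\mathbb Z_n\to\{1,\dots,n\}$ and a positive integer $\kappa$ such that $\sum_{u\in N(v)}\ell(u)=\kappa$ for every vertex $v$, where $N(v)$ is the neighbourhood of $v$. For $q\in\mathbb Z_n^*$ put $qS=\{qs: s\in S\}$. We say that $\Gamma$ is *in the first list* if $n=4n_0$ for some integer $n_0\ge 2$ and there is $q\in\mathbb Z_n^*$ such that one of the following holds: 1. $qS=\{\pm1,\pm n_0,\pm(2n_0-1)\}$; 2. $qS=\{\pm2,\pm n_0,\pm(2n_0-2)\}$; 3. $n_0=dd'$ for odd coprime integers $d,d'$ with $1<d<d'<n_0$, and $qS=\{\pm 2,\pm n_0,\pm c'\}$, where $1<c'<n$ is the unique solution of $c'\equiv 0\pmod 4$,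 $c'\equiv 2\pmod d$, $c'\equiv -2\pmod{d'}$; 4. $n_0=dd'd''$ for odd pairwise coprime integers $d,d',d''$ with $1\le d<d'<d''<n_0$, and $qS=\{\pm d,\pm b',\pm c'\}$, where $b'$ is the smallest integer with $1<b'<n$, $\gcd(b',d)=1$, $b'\equiv 2-d\pmod 4$, $b'\equiv 0\pmod{d'}$, $b'\equiv -d\pmod{d''}$, and $1<c'<n$ is the unique solution of $c'\equiv 2-d\pmod 4$, $c'\equiv -b'\pmod d$, $c'\equiv -d\pmod{d'}$, $c'\equiv 0\pmod{d''}$. We say that $\Gamma$ is *in the second list* if $n=3n_0$ for some integer $n_0\ge 3$ and there is $q\in\mathbb Z_n^*$ such that one of the following holds: 1. $qS=\{\pm1,\pm(n_0-1),\pm(n_0+1)\}$; 2. $n_0=dd'$ for coprime integers $d,d'$, both coprime to $3$, with $1<d<d'$, and $qS=\{\pm1,\pm(n_0+\delta),\pm c'\}$, where $\delta\in\{-1,1\}$ is such that $n_0\equiv\delta\pmod 3$ and $c'\in\{1,\dots,n-1\}$ is the unique solution of $c'\equiv 0\pmod 3$, $c'\equiv 1\pmod d$, $c'\equiv -1\pmod{d'}$.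 Then: - if $3\nmid n$, then $\Gamma$ is distance magic if and only if $\Gamma$ is in the first list; - if $4\nmid n$, then $\Gamma$ is distance magic if and only if $n$ is odd and $\Gamma$ is in the second list. In particular, if $n$ is twice an odd number, then $\Gamma$ is not distance magic. -/

import Mathlib

/-- A finite graph `G = (V, E)` of order `N` is distance magic if there are a bijection
`ℓ : V → {1, …, N}` and a positive integer `κ` such that for every vertex `v` the labels of the
neighbours of `v` sum to `κ`. -/
def IsDistanceMagic {V : Type*} [Fintype V] (G : SimpleGraph V) : Prop :=
  ∃ ℓ : V → ℕ, Set.BijOn ℓ Set.univ (Set.Icc 1 (Fintype.card V)) ∧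
    ∃ κ : ℕ, 0 < κ ∧ ∀ v : V, ∑ᶠ u ∈ G.neighborSet v, ℓ u = κ

/-- The subset `{±a, ±b, ±c}` of `ℤ/n`. -/
def pmSet {n : ℕ} (a b c : ZMod n) : Finset (ZMod n) :=
  {a, -a, b, -b, c, -c}

/-- The subset `qS = {q s : s ∈ S}` of `ℤ/n`, for a unit `q` of `ℤ/n`. -/
def unitMul {n : ℕ} (q : (ZMod n)ˣ) (S : Finset (ZMod n)) : Finset (ZMod n) :=
  S.image fun s => (q : ZMod n) * s

/-- The circulant `Circ(n; S)`: vertices `ℤ/n`, with distinct `i`, `j` adjacent when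
`j - i ∈ S` (the connection sets in use are symmetric). -/
def Circ (n : ℕ) (S : Finset (ZMod n)) : SimpleGraph (ZMod n) :=
  SimpleGraph.circulantGraph (S : Set (ZMod n))

/-- The integer `x` with `1 < x < n` solves the system
`x ≡ 0 (mod 4)`, `x ≡ 2 (mod d)`, `x ≡ -2 (mod d')`. -/
def SolvesEvenSystem (n d d' x : ℕ) : Prop :=
  1 < x ∧ x < n ∧ (x : ℤ) ≡ 0 [ZMOD 4] ∧ (x : ℤ) ≡ 2 [ZMOD d] ∧ (x : ℤ) ≡ -2 [ZMOD d']

/-- The integer `x` with `1 < x < n` solves the system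
`x ≡ 2 - d (mod 4)`, `x ≡ 0 (mod d')`, `x ≡ -d (mod d'')`. -/
def SolvesLeftSystem (n d d' d'' x : ℕ) : Prop :=
  1 < x ∧ x < n ∧ (x : ℤ) ≡ 2 - d [ZMOD 4] ∧ (x : ℤ) ≡ 0 [ZMOD d'] ∧ (x : ℤ) ≡ -d [ZMOD d'']

/-- The integer `y` with `1 < y < n` solves the system
`y ≡ 2 - d (mod 4)`, `y ≡ -x (mod d)`, `y ≡ -d (mod d')`, `y ≡ 0 (mod d'')`. -/
def SolvesRightSystem (n d d' d'' x y : ℕ) : Prop :=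
  1 < y ∧ y < n ∧ (y : ℤ) ≡ 2 - d [ZMOD 4] ∧ (y : ℤ) ≡ -x [ZMOD d] ∧
    (y : ℤ) ≡ -d [ZMOD d'] ∧ (y : ℤ) ≡ 0 [ZMOD d'']

/-- `Circ(n; S)` belongs to the first list of graphs: `n = 4 n₀` with `n₀ ≥ 2` and, up to
multiplication by a unit, `S` is one of the two trivial sets or one of the two kinds of nontrivial
sets. -/
def InFirstList (n : ℕ) (S : Finset (ZMod n)) : Prop :=
  ∃ n₀ : ℕ, 2 ≤ n₀ ∧ n = 4 * n₀ ∧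
    ((∃ q : (ZMod n)ˣ, unitMul q S = pmSet 1 (n₀ : ZMod n) (2 * (n₀ : ZMod n) - 1)) ∨
     (∃ q : (ZMod n)ˣ, unitMul q S = pmSet 2 (n₀ : ZMod n) (2 * (n₀ : ZMod n) - 2)) ∨
     (∃ d d' : ℕ, n₀ = d * d' ∧ Odd d ∧ Odd d' ∧ d.Coprime d' ∧
        1 < d ∧ d < d' ∧ d' < n₀ ∧
        ∃ c' : ℕ, SolvesEvenSystem n d d' c' ∧
          ∃ q : (ZMod n)ˣ, unitMul q S = pmSet 2 (n₀ : ZMod n) (c' : ZMod n)) ∨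
     (∃ d d' d'' : ℕ, n₀ = d * d' * d'' ∧ Odd d ∧ Odd d' ∧ Odd d'' ∧
        d.Coprime d' ∧ d.Coprime d'' ∧ d'.Coprime d'' ∧
        1 ≤ d ∧ d < d' ∧ d' < d'' ∧ d'' < n₀ ∧
        ∃ b' c' : ℕ, IsLeast {x : ℕ | SolvesLeftSystem n d d' d'' x ∧ x.Coprime d} b' ∧
          SolvesRightSystem n d d' d'' b' c' ∧
          ∃ q : (ZMod n)ˣ, unitMul q S = pmSet (d : ZMod n) (b' : ZMod n) (c' : ZMod n)))

/-- `Circ(n; S)` belongs to the second list of graphs: `n = 3 n₀` with `n₀ ≥ 3` and, up to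
multiplication by a unit, `S` is the trivial set or one of the nontrivial sets. -/
def InSecondList (n : ℕ) (S : Finset (ZMod n)) : Prop :=
  ∃ n₀ : ℕ, 3 ≤ n₀ ∧ n = 3 * n₀ ∧
    ((∃ q : (ZMod n)ˣ, unitMul q S = pmSet 1 ((n₀ : ZMod n) - 1) ((n₀ : ZMod n) + 1)) ∨
     (∃ d d' : ℕ, n₀ = d * d' ∧ d.Coprime d' ∧ 1 < d ∧ d < d' ∧ d.Coprime 3 ∧ d'.Coprime 3 ∧
        ∃ δ : ℤ, (δ = 1 ∨ δ = -1) ∧ (n₀ : ℤ) ≡ δ [ZMOD 3] ∧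
        ∃ c' : ℕ, 1 ≤ c' ∧ c' ≤ n - 1 ∧
          (c' : ℤ) ≡ 0 [ZMOD 3] ∧ (c' : ℤ) ≡ 1 [ZMOD d] ∧ (c' : ℤ) ≡ -1 [ZMOD d'] ∧
          ∃ q : (ZMod n)ˣ,
            unitMul q S = pmSet 1 ((n₀ : ZMod n) + (δ : ZMod n)) (c' : ZMod n)))

/-! Centring and doubling a magic labelling gives an injective integer function `g` on ℤ/n, with
values of the parity of n + 1 and between -(n - 1) and n - 1, whose sum over every neighbourhood is
zero. The Fourier transform of such a `g` is supported on the characters χ for which the sum of χ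
over S vanishes. If the orders of these characters all divided M, then `g` would have period M;
injectivity therefore forces their least common multiple to be n (`dvd_of_forall_kernelOrders_dvd`).

For such a χ, six roots of unity X, Y, Z and their inverses add up to zero. Galois conjugation and
averaging over p-th roots of unity restrict the vanishing sums of at most six roots of unity
(`vanishingShape_of_sum_eq_zero`), and three patterns survive (`classification_sum_add_inv`): one of
X, Y, Z is ±i and the other two pairs cancel; after inverting some of them, X, Y, Z form an
equilateral triangle; or the square of one is a primitive cube root of unity and the other two are
tenth roots of unity. In terms of the order m of χ these become the quarter, third and decagon
roles. The first needs 4 ∣ m, the second 3 ∣ m, the last 6 ∣ m.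

If 3 ∤ n, only quarter roles occur. Residues modulo 4 restrict which generator can have order four
and with which sign the others cancel; the remaining choices vary with m and are recorded by
greatest common divisors with n/4. These are pairwise coprime because S generates, their product is
n/4 by the condition on the orders, and a unit brings S to the normal form of the first list.

If 4 ∤ n, there are no quarter roles. For even n every surviving character is nontrivial on the
subgroup of order three, so `g` sums to zero over its cosets, which is absurd for three odd values.
For odd n only third roles remain, and residues modulo 3 lead to the second list in the same way.

Conversely, labellings are built from coordinates given by the Chinese remainder theorem: a sign
that flips under steps congruent to 2 modulo 4 times a mixed-radix number for the first list, and
three-row arrays with zero column sums for the second. -/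

open Finset

/-! ### Galois conjugates of vanishing sums of roots of unity -/

/-- A vanishing sum of roots of unity is preserved by Galois conjugation. -/
theorem sum_pow_eq_zero_of_coprime {ι : Type*} {s : Finset ι} {z : ι → ℂ} {N t : ℕ} (hN : 0 < N)
    (hz : ∀ i ∈ s, z i ^ N = 1) (h0 : ∑ i ∈ s, z i = 0) (ht : t.Coprime N) :
    ∑ i ∈ s, z i ^ t = 0 := by
  have hζ := Complex.isPrimitiveRoot_exp N hN.ne'
  set ζ := Complex.exp (2 * Real.pi * Complex.I / N)
  have : NeZero N := ⟨hN.ne'⟩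
  have hk : ∀ i, ∃ k : ℕ, i ∈ s → z i = ζ ^ k := fun i => by
    by_cases hi : i ∈ s
    · obtain ⟨k, -, hk⟩ := hζ.eq_pow_of_pow_eq_one (hz i hi)
      exact ⟨k, fun _ => hk.symm⟩
    · exact ⟨0, fun h => absurd h hi⟩
  choose k hk using hk
  have hmin := hζ.minpoly_eq_pow_coprime ht
  set P : Polynomial ℤ := ∑ i ∈ s, Polynomial.X ^ k i
  have hP : ∀ w : ℂ, Polynomial.aeval w P = ∑ i ∈ s, w ^ k i := fun w => by simp [P]
  have h1 : Polynomial.aeval ζ P = 0 := by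
    rw [hP, ← h0]; exact sum_congr rfl fun i hi => (hk i hi).symm
  have h2 : minpoly ℤ ζ ∣ P := minpoly.isIntegrallyClosed_dvd (hζ.isIntegral hN) h1
  rw [hmin] at h2
  obtain ⟨R, hR⟩ := h2
  have h3 : Polynomial.aeval (ζ ^ t) P = 0 := by rw [hR, map_mul, minpoly.aeval, zero_mul]
  rw [hP] at h3
  rw [← h3]
  refine sum_congr rfl fun i hi => ?_
  rw [hk i hi, ← pow_mul, ← pow_mul, mul_comm]

theorem geom_sum_eq_zero_of_pow_eq_one {w : ℂ} {p : ℕ} (h : w ^ p = 1) (h1 : w ≠ 1) :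
    ∑ l ∈ range p, w ^ l = 0 := by
  rw [geom_sum_eq h1, h, sub_self, zero_div]

open Classical in
/-- Fourier inversion on the `p`-th roots of unity. -/
theorem sum_filter_eq_average {ι : Type*} (s : Finset ι) (u v : ι → ℂ) {p : ℕ} (hp : 0 < p)
    (hu : ∀ i ∈ s, u i ^ p = 1) {r : ℂ} (hr : r ^ p = 1) :
    (p : ℂ) * ∑ i ∈ s with u i = r, v i =
      ∑ l ∈ range p, r⁻¹ ^ l * ∑ i ∈ s, u i ^ l * v i := by
  have hr0 : r ≠ 0 := by rintro rfl; simp [hp.ne'] at hr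
  simp_rw [mul_sum]
  rw [sum_comm, sum_filter]
  refine sum_congr rfl fun i hi => ?_
  have : ∀ l ∈ range p, r⁻¹ ^ l * (u i ^ l * v i) = (r⁻¹ * u i) ^ l * v i := fun l _ => by
    rw [mul_pow]; ring
  rw [sum_congr rfl this, ← sum_mul]
  split_ifs with h
  · simp [h, hr0]
  · rw [geom_sum_eq_zero_of_pow_eq_one, zero_mul]
    · rw [mul_pow, hu i hi, inv_pow, hr]; simp
    · intro h'
      apply h
      field_simp at h'
      exact h'

open Classical in
-- Since p ∣ m, every exponent ml + 1 is coprime to pm. All the conjugate sums therefore vanish, and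
-- these are exactly the Fourier coefficients needed to isolate one value of z ^ m.
theorem sum_class_eq_zero_of_dvd {ι : Type*} {s : Finset ι} {z : ι → ℂ} {p m : ℕ} (hp : p.Prime)
    (hm : 0 < m) (hpm : p ∣ m) (hz : ∀ i ∈ s, z i ^ (p * m) = 1) (h0 : ∑ i ∈ s, z i = 0)
    {r : ℂ} (hr : r ^ p = 1) : ∑ i ∈ s with z i ^ m = r, z i = 0 := by
  have h := sum_filter_eq_average s (fun i => z i ^ m) z hp.pos
    (fun i hi => by rw [← pow_mul, mul_comm, hz i hi]) hr
  have h' : ∀ l ∈ range p, r⁻¹ ^ l * ∑ i ∈ s, (z i ^ m) ^ l * z i = 0 := fun l _ => by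
    have hc : (m * l + 1).Coprime (p * m) := by
      have h1 : (m * l + 1).Coprime m := by simp
      exact Nat.Coprime.mul_right (h1.coprime_dvd_right hpm) h1
    have := sum_pow_eq_zero_of_coprime (Nat.mul_pos hp.pos hm) hz h0 hc
    simp_rw [pow_succ, pow_mul] at this
    rw [this, mul_zero]
  rw [sum_eq_zero h'] at h
  have : (p : ℂ) ≠ 0 := by exact_mod_cast hp.ne_zero
  simpa [this] using h

open Classical in
-- For l ≠ 0 modulo p, the exponent that is l modulo p and 1 modulo m is a Galois conjugation, so
-- the l-th Fourier coefficient vanishes. Only l = 0 survives, and all p classes have the same sum.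
theorem sum_class_eq_of_coprime {ι : Type*} {s : Finset ι} {u v : ι → ℂ} {p m : ℕ} (hp : p.Prime)
    (hm : 0 < m) (hpm : p.Coprime m) (hu : ∀ i ∈ s, u i ^ p = 1) (hv : ∀ i ∈ s, v i ^ m = 1)
    (h0 : ∑ i ∈ s, u i * v i = 0) {r : ℂ} (hr : r ^ p = 1) :
    (p : ℂ) * ∑ i ∈ s with u i = r, v i = ∑ i ∈ s, v i := by
  rw [sum_filter_eq_average s u v hp.pos hu hr, sum_eq_single_of_mem 0 (mem_range.2 hp.pos)]
  · simp
  intro l hl hl0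
  have hlp : l.Coprime p := (Nat.coprime_of_lt_prime hl0 (mem_range.1 hl) hp).symm
  obtain ⟨t, ht1, ht2⟩ := Nat.chineseRemainder hpm l 1
  have htp : t.Coprime p := by
    have := ht1.gcd_eq
    rw [Nat.Coprime, this]; exact hlp
  have htm : t.Coprime m := by
    have := ht2.gcd_eq
    rw [Nat.Coprime, this]; simp
  have key := sum_pow_eq_zero_of_coprime (Nat.mul_pos hp.pos hm) (z := fun i => u i * v i)
    (fun i hi => by rw [mul_pow, pow_mul, hu i hi, mul_comm p, pow_mul, hv i hi]; simp) h0
    (htp.mul_right htm)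
  have : ∑ i ∈ s, u i ^ l * v i = 0 := by
    rw [← key]
    refine sum_congr rfl fun i hi => ?_
    rw [mul_pow, pow_eq_pow_of_modEq ht1 (hu i hi), pow_eq_pow_of_modEq ht2 (hv i hi), pow_one]
  rw [this, mul_zero]

/-! ### Vanishing sums of at most six roots of unity -/

/-- The possible shapes of a vanishing sum of at most six roots of unity: it contains two opposite
terms or three terms of sum zero, or it has five terms, or it consists of two terms whose ratio is a
primitive cube root of unity and four terms whose ratios are fifth roots of unity. -/
def VanishingShape {ι : Type*} (s : Finset ι) (z : ι → ℂ) : Prop :=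
  (∃ i ∈ s, ∃ j ∈ s, z i = -z j) ∨
  (∃ i ∈ s, ∃ j ∈ s, ∃ k ∈ s, i ≠ j ∧ i ≠ k ∧ j ≠ k ∧ z i + z j + z k = 0) ∨
  s.card = 5 ∨
  (s.card = 6 ∧ ∃ i ∈ s, ∃ j ∈ s, i ≠ j ∧ z i ^ 2 + z i * z j + z j ^ 2 = 0 ∧
    ∀ k ∈ s, ∀ l ∈ s, k ≠ i → k ≠ j → l ≠ i → l ≠ j → z k ^ 5 = z l ^ 5)

/-- Lets the induction pass to a vanishing subsum. Only five terms inside six need care: the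
complement would be a single term equal to zero. -/
theorem VanishingShape.mono {ι : Type*} [DecidableEq ι] {s t : Finset ι} {z : ι → ℂ} (hts : t ⊆ s)
    (hz : ∀ i ∈ s, z i ≠ 0) (hcard : s.card ≤ 6) (hs0 : ∑ i ∈ s, z i = 0)
    (ht0 : ∑ i ∈ t, z i = 0) (h : VanishingShape t z) : VanishingShape s z := by
  rcases h with ⟨i, hi, j, hj, h⟩ | ⟨i, hi, j, hj, k, hk, h⟩ | h | ⟨h, h'⟩
  · exact Or.inl ⟨i, hts hi, j, hts hj, h⟩
  · exact Or.inr (Or.inl ⟨i, hts hi, j, hts hj, k, hts hk, h⟩)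
  · have h1 := card_sdiff_add_card_eq_card hts
    by_cases h2 : (s \ t).card = 1
    · obtain ⟨x, hx⟩ := card_eq_one.1 h2
      have h3 := sum_sdiff (f := z) hts
      rw [hs0, ht0, hx, sum_singleton, add_zero] at h3
      have hxs : x ∈ s \ t := by simp [hx]
      exact absurd h3 (hz x (mem_sdiff.1 hxs).1)
    · exact Or.inr (Or.inr (Or.inl (by omega)))
  · have : t = s := eq_of_subset_of_card_le hts (by omega)
    subst this
    exact Or.inr (Or.inr (Or.inr ⟨h, h'⟩))

theorem VanishingShape.scale {ι : Type*} {s : Finset ι} {z w : ι → ℂ} {r : ℂ}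
    (hw : ∀ i ∈ s, w i = r * z i) (h : VanishingShape s z) : VanishingShape s w := by
  rcases h with ⟨i, hi, j, hj, h⟩ | ⟨i, hi, j, hj, k, hk, h1, h2, h3, h⟩ | h |
    ⟨h, i, hi, j, hj, hij, h1, h2⟩
  · exact Or.inl ⟨i, hi, j, hj, by rw [hw i hi, hw j hj, h]; ring⟩
  · exact Or.inr (Or.inl ⟨i, hi, j, hj, k, hk, h1, h2, h3, by
      rw [hw i hi, hw j hj, hw k hk]; linear_combination r * h⟩)
  · exact Or.inr (Or.inr (Or.inl h))
  · refine Or.inr (Or.inr (Or.inr ⟨h, i, hi, j, hj, hij, ?_, fun k hk l hl a b c d => ?_⟩))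
    · rw [hw i hi, hw j hj]; linear_combination r ^ 2 * h1
    · rw [hw k hk, hw l hl, mul_pow, mul_pow, h2 k hk l hl a b c d]

/-- A vanishing sum of two unit vectors and a third one. -/
theorem sq_add_mul_add_sq_of_add_eq {a b c : ℂ} (ha : ‖a‖ = 1) (hb : ‖b‖ = 1) (hc : ‖c‖ = 1)
    (h : a + b = c) : a ^ 2 + a * b + b ^ 2 = 0 := by
  have ca := Complex.inv_eq_conj ha
  have cb := Complex.inv_eq_conj hb
  have cc := Complex.inv_eq_conj hc
  have ha0 : a ≠ 0 := by rintro rfl; simp at ha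
  have hb0 : b ≠ 0 := by rintro rfl; simp at hb
  have hc0 : c ≠ 0 := by rintro rfl; simp at hc
  have h2 : a⁻¹ + b⁻¹ = c⁻¹ := by rw [ca, cb, cc, ← map_add, h]
  subst h
  field_simp at h2
  linear_combination h2

theorem vanishingShape_of_sq_eq_one {ι : Type*} {s : Finset ι} {z : ι → ℂ} (hs : s.Nonempty)
    (hz : ∀ i ∈ s, z i ^ 2 = 1) (h0 : ∑ i ∈ s, z i = 0) : VanishingShape s z := by
  left
  obtain ⟨i, hi⟩ := hs
  by_contra! hcon
  have : ∀ j ∈ s, z j = z i := fun j hj => by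
    have h1 : z j ^ 2 = z i ^ 2 := by rw [hz i hi, hz j hj]
    exact (sq_eq_sq_iff_eq_or_eq_neg.1 h1).resolve_right (hcon j hj i hi)
  rw [sum_congr rfl this, sum_const, nsmul_eq_mul, mul_eq_zero] at h0
  rcases h0 with h0 | h0
  · rw [Nat.cast_eq_zero, card_eq_zero] at h0; simp [h0] at hi
  · have := hz i hi; rw [h0] at this; norm_num at this

theorem exists_mul_of_pow_mul_eq_one {p m : ℕ} (hpm : p.Coprime m) {z : ℂ}
    (hz : z ^ (p * m) = 1) : ∃ u v : ℂ, u ^ p = 1 ∧ v ^ m = 1 ∧ z = u * v := by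
  obtain ⟨t, ht1, ht2⟩ := Nat.chineseRemainder hpm 1 0
  obtain ⟨t', ht1', ht2'⟩ := Nat.chineseRemainder hpm 0 1
  have hadd : t + t' ≡ 1 [MOD p * m] :=
    (Nat.modEq_and_modEq_iff_modEq_mul hpm).1 ⟨ht1.add ht1', ht2.add ht2'⟩
  refine ⟨z ^ t, z ^ t', ?_, ?_, ?_⟩
  · obtain ⟨k, hk⟩ := Nat.modEq_zero_iff_dvd.1 ht2
    rw [← pow_mul, hk, show m * k * p = p * m * k by ring, pow_mul, hz, one_pow]
  · obtain ⟨k, hk⟩ := Nat.modEq_zero_iff_dvd.1 ht1'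
    rw [← pow_mul, hk, show p * k * m = p * m * k by ring, pow_mul, hz, one_pow]
  · rw [← pow_add, pow_eq_pow_of_modEq hadd hz, pow_one]

/-- The data of a vanishing sum all of whose classes modulo `p`-th roots of unity are nonempty. -/
theorem le_card_of_classes_nonempty {ι : Type*} [DecidableEq ι] {s : Finset ι} {u : ι → ℂ} {p : ℕ}
    (hp : 0 < p) (hne : ∀ r : ℂ, r ^ p = 1 → ∃ i ∈ s, u i = r) :
    ∃ f : Fin p → ι, (∀ a, f a ∈ s) ∧ Function.Injective f ∧
      ∀ a, u (f a) = Complex.exp (2 * Real.pi * Complex.I / p) ^ (a : ℕ) := by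
  have hζ := Complex.isPrimitiveRoot_exp p hp.ne'
  set ζ := Complex.exp (2 * Real.pi * Complex.I / p)
  have : ∀ a : Fin p, ∃ i ∈ s, u i = ζ ^ (a : ℕ) := fun a => hne _ (by
    rw [← pow_mul, mul_comm, pow_mul, hζ.pow_eq_one, one_pow])
  choose f hf1 hf2 using this
  refine ⟨f, hf1, fun a b hab => ?_, hf2⟩
  have : ζ ^ (a : ℕ) = ζ ^ (b : ℕ) := by rw [← hf2, ← hf2, hab]
  exact Fin.ext (hζ.pow_inj a.2 b.2 this)

open Classical in
-- The p nonempty classes need p ≤ 6 terms, so p = 5. With six terms, one class has two members and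
-- the other four are singletons with `v` equal to `g`. The two `v`-values of the double class then
-- add up to a unit number, which makes their ratio a primitive cube root of unity, and the
-- singletons all have fifth power g ^ 5.
theorem vanishingShape_of_coprime_five_le {ι : Type*} {s : Finset ι} {u v : ι → ℂ} {p m : ℕ}
    (hp : p.Prime) (hp5 : 5 ≤ p) (hm : 0 < m) (hu : ∀ i ∈ s, u i ^ p = 1)
    (hv : ∀ i ∈ s, v i ^ m = 1) (hcard : s.card ≤ 6)
    (hne : ∀ r : ℂ, r ^ p = 1 → ∃ i ∈ s, u i = r) (g : ℂ)
    (hg : ∀ r : ℂ, r ^ p = 1 → ∑ i ∈ s with u i = r, v i = g) :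
    VanishingShape s (fun i => u i * v i) := by
  obtain ⟨f, hfs, hfi, hfu⟩ := le_card_of_classes_nonempty hp.pos hne
  have hsub : univ.image f ⊆ s := fun x hx => by
    obtain ⟨a, -, rfl⟩ := mem_image.1 hx; exact hfs a
  have hc1 : (univ.image f).card = p := by rw [card_image_of_injective _ hfi]; simp
  have hple := card_le_card hsub
  rw [hc1] at hple
  have hp6 : p ≠ 6 := by rintro rfl; norm_num at hp
  obtain rfl : p = 5 := by omega
  by_cases h5 : s.card = 5
  · exact Or.inr (Or.inr (Or.inl h5))
  have h6 : s.card = 6 := by omega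
  have hsd := card_sdiff_add_card_eq_card hsub
  obtain ⟨x, hx⟩ := card_eq_one.1 (show (s \ univ.image f).card = 1 by omega)
  have hxs : x ∈ s \ univ.image f := by simp [hx]
  have hcover : ∀ i ∈ s, i = x ∨ ∃ a, i = f a := fun i hi => by
    by_cases h : i ∈ univ.image f
    · obtain ⟨a, -, rfl⟩ := mem_image.1 h; exact Or.inr ⟨a, rfl⟩
    · left
      have : i ∈ s \ univ.image f := mem_sdiff.2 ⟨hi, h⟩
      rwa [hx, mem_singleton] at this
  have hxf : ∀ a, x ≠ f a := fun a h => (mem_sdiff.1 hxs).2 (by rw [h]; simp)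
  have hζ := Complex.isPrimitiveRoot_exp 5 (by norm_num)
  have hfu_inj : ∀ a b, u (f a) = u (f b) → a = b := fun a b h => by
    rw [hfu, hfu] at h
    exact Fin.ext (hζ.pow_inj a.2 b.2 h)
  have hxs' := (mem_sdiff.1 hxs).1
  have hxa : ∃ a, u x = u (f a) := by
    obtain ⟨k, hk, hk'⟩ := hζ.eq_pow_of_pow_eq_one (hu x hxs')
    exact ⟨⟨k, hk⟩, by rw [hfu]; exact hk'.symm⟩
  obtain ⟨a, ha⟩ := hxa
  have hpair : ({i ∈ s | u i = u x} : Finset ι) = {x, f a} := by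
    ext i
    simp only [mem_filter, mem_insert, mem_singleton]
    constructor
    · rintro ⟨hi, hiu⟩
      rcases hcover i hi with rfl | ⟨b, rfl⟩
      · exact Or.inl rfl
      · right; rw [hfu_inj b a (hiu.trans ha)]
    · rintro (rfl | rfl)
      · exact ⟨hxs', rfl⟩
      · exact ⟨hfs a, ha.symm⟩
  have hsingle : ∀ b, b ≠ a → v (f b) = g := fun b hb => by
    rw [← hg _ (hu _ (hfs b))]
    have : ({i ∈ s | u i = u (f b)} : Finset ι) = {f b} := by
      ext i
      simp only [mem_filter, mem_singleton]
      constructor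
      · rintro ⟨hi, hiu⟩
        rcases hcover i hi with rfl | ⟨c, rfl⟩
        · exact absurd (hfu_inj b a (hiu.symm.trans ha)) hb
        · rw [hfu_inj c b hiu]
      · rintro rfl
        exact ⟨hfs b, rfl⟩
    rw [this, sum_singleton]
  have hsum := hg _ (hu _ hxs')
  rw [hpair, sum_pair (hxf a)] at hsum
  have hnorm : ∀ i ∈ s, ‖v i‖ = 1 := fun i hi =>
    Complex.norm_eq_one_of_pow_eq_one (hv i hi) hm.ne'
  obtain ⟨b, hb⟩ : ∃ b : Fin 5, b ≠ a := exists_ne a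
  have hq := sq_add_mul_add_sq_of_add_eq (hnorm x hxs') (hnorm _ (hfs a)) (hnorm _ (hfs b))
    (hsum.trans (hsingle b hb).symm)
  refine Or.inr (Or.inr (Or.inr ⟨h6, x, hxs', f a, hfs a, hxf a, ?_, ?_⟩))
  · simp only [← ha]; linear_combination u x ^ 2 * hq
  · intro k hk l hl k1 k2 l1 l2
    have aux : ∀ k ∈ s, k ≠ x → k ≠ f a → (u k * v k) ^ 5 = g ^ 5 := fun k hk k1 k2 => by
      rcases hcover k hk with rfl | ⟨c, rfl⟩
      · exact absurd rfl k1
      · rw [mul_pow, hu _ hk, one_mul, hsingle c (fun h => k2 (by rw [h]))]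
    rw [aux k hk k1 k2, aux l hl l1 l2]

open Classical in
-- Here `v` is a sign. Without an opposite pair inside a class, each class has constant sign, and
-- `g` is a positive multiple of it. So all the signs agree, and one term from each class gives a
-- multiple of the sum of the three cube roots of unity.
theorem vanishingShape_of_three {ι : Type*} {s : Finset ι} {u v : ι → ℂ}
    (hu : ∀ i ∈ s, u i ^ 3 = 1) (hv : ∀ i ∈ s, v i ^ 2 = 1)
    (hne : ∀ r : ℂ, r ^ 3 = 1 → ∃ i ∈ s, u i = r) (g : ℂ)
    (hg : ∀ r : ℂ, r ^ 3 = 1 → ∑ i ∈ s with u i = r, v i = g) :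
    VanishingShape s (fun i => u i * v i) := by
  by_cases hanti : ∃ i ∈ s, ∃ j ∈ s, u i = u j ∧ v i = -v j
  · obtain ⟨i, hi, j, hj, h1, h2⟩ := hanti
    exact Or.inl ⟨i, hi, j, hj, by simp only [h1, h2]; ring⟩
  push Not at hanti
  obtain ⟨f, hfs, hfi, hfu⟩ := le_card_of_classes_nonempty (by norm_num) hne
  have hζ := Complex.isPrimitiveRoot_exp 3 (by norm_num)
  have hgs : ∀ a, ∃ k : ℕ, 0 < k ∧ g = k * v (f a) := fun a => by
    refine ⟨({i ∈ s | u i = u (f a)} : Finset ι).card, card_pos.2 ⟨f a, by simp [hfs]⟩, ?_⟩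
    rw [← hg _ (hu _ (hfs a)), ← nsmul_eq_mul, ← sum_const]
    refine sum_congr rfl fun i hi => ?_
    obtain ⟨hi, hiu⟩ := mem_filter.1 hi
    have h1 : v i ^ 2 = v (f a) ^ 2 := by rw [hv i hi, hv _ (hfs a)]
    exact (sq_eq_sq_iff_eq_or_eq_neg.1 h1).resolve_right (hanti i hi _ (hfs a) hiu)
  have heq : ∀ a b, v (f a) = v (f b) := fun a b => by
    have h1 : v (f a) ^ 2 = v (f b) ^ 2 := by rw [hv _ (hfs a), hv _ (hfs b)]
    refine (sq_eq_sq_iff_eq_or_eq_neg.1 h1).resolve_right fun h => ?_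
    obtain ⟨k, hk, hk'⟩ := hgs a
    obtain ⟨l, hl, hl'⟩ := hgs b
    have hvb : v (f b) ≠ 0 := by
      intro h0; have := hv _ (hfs b); rw [h0] at this; norm_num at this
    rw [hk', h] at hl'
    have h2 : ((k : ℂ) + l) * v (f b) = 0 := by linear_combination -hl'
    have h3 : ((k + l : ℕ) : ℂ) = 0 := by push_cast; exact (mul_eq_zero.1 h2).resolve_right hvb
    rw [Nat.cast_eq_zero] at h3
    omega
  refine Or.inr (Or.inl ⟨f 0, hfs 0, f 1, hfs 1, f 2, hfs 2, hfi.ne (by decide),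
    hfi.ne (by decide), hfi.ne (by decide), ?_⟩)
  have hgeom := hζ.geom_sum_eq_zero (by norm_num)
  simp only [sum_range_succ, sum_range_zero] at hgeom
  simp only [hfu, heq 1 0, heq 2 0, Fin.val_zero, Fin.val_one, Fin.val_two]
  linear_combination v (f 0) * hgeom

/-- Vanishing sums of at most six roots of unity. -/
theorem vanishingShape_of_sum_eq_zero (N : ℕ) : ∀ {ι : Type*} (s : Finset ι) (z : ι → ℂ), 0 < N →
    s.Nonempty → s.card ≤ 6 → (∀ i ∈ s, z i ^ N = 1) → ∑ i ∈ s, z i = 0 → VanishingShape s z := by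
  classical
  induction N using Nat.strong_induction_on with
  | _ N ih =>
  intro ι s z hN hs hcard hz h0
  have hz0 : ∀ i ∈ s, z i ≠ 0 := fun i hi h => by
    have := hz i hi; rw [h, zero_pow hN.ne'] at this; norm_num at this
  -- A repeated prime p: the class of i0 is a vanishing subsum, and after division by z i0 its terms
  -- are m-th roots of unity, to which the induction hypothesis applies.
  have hsq : ∀ p m, p.Prime → N = p * m → p ∣ m → VanishingShape s z := fun p m hp hNp hpm => by
    subst hNp
    have hm : 0 < m := Nat.pos_of_mul_pos_left hN
    obtain ⟨i0, hi0⟩ := hs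
    have hr : (z i0 ^ m) ^ p = 1 := by rw [← pow_mul, mul_comm, hz i0 hi0]
    have hcl := sum_class_eq_zero_of_dvd hp hm hpm hz h0 hr
    refine VanishingShape.mono (filter_subset _ _) hz0 hcard h0 hcl ?_
    refine VanishingShape.scale (z := fun i => z i / z i0) (r := z i0) (fun i _ => ?_) ?_
    · rw [mul_div_cancel₀ _ (hz0 i0 hi0)]
    · refine ih m (lt_mul_left hm hp.one_lt) _ _ hm ⟨i0, by simp [hi0]⟩
        ((card_le_card (filter_subset _ _)).trans hcard) (fun i hi => ?_) ?_
      · rw [div_pow, (mem_filter.1 hi).2, div_self (pow_ne_zero _ (hz0 i0 hi0))]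
      · rw [← sum_div, hcl, zero_div]
  have hcop : ∀ p m, p.Prime → N = p * m → p.Coprime m → (5 ≤ p ∨ p = 3 ∧ m ∣ 2) →
      VanishingShape s z := fun p m hp hNp hpm hpp => by
    subst hNp
    have hm : 0 < m := Nat.pos_of_mul_pos_left hN
    have : ∀ i, ∃ u v : ℂ, i ∈ s → u ^ p = 1 ∧ v ^ m = 1 ∧ z i = u * v := fun i => by
      by_cases hi : i ∈ s
      · obtain ⟨u, v, h⟩ := exists_mul_of_pow_mul_eq_one hpm (hz i hi)
        exact ⟨u, v, fun _ => h⟩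
      · exact ⟨0, 0, fun h => absurd h hi⟩
    choose u v huv using this
    have hu := fun i hi => (huv i hi).1
    have hv := fun i hi => (huv i hi).2.1
    have hzuv := fun i hi => (huv i hi).2.2
    have h0' : ∑ i ∈ s, u i * v i = 0 := by rw [← h0]; exact (sum_congr rfl hzuv).symm
    have hp0 : (p : ℂ) ≠ 0 := by exact_mod_cast hp.ne_zero
    have hg : ∀ r : ℂ, r ^ p = 1 → ∑ i ∈ s with u i = r, v i = (∑ i ∈ s, v i) / p :=
      fun r hr => by
        rw [eq_div_iff hp0, mul_comm]; exact sum_class_eq_of_coprime hp hm hpm hu hv h0' hr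
    generalize (∑ i ∈ s, v i) / (p : ℂ) = g at hg
    refine VanishingShape.scale (z := fun i => u i * v i) (r := 1)
      (fun i hi => by rw [hzuv i hi, one_mul]) ?_
    -- If the common class sum is zero, any nonempty class is a vanishing subsum of m-th roots of
    -- unity up to the factor u i0. Otherwise no class can be empty.
    by_cases hg0 : g = 0
    · obtain ⟨i0, hi0⟩ := hs
      have hcl := hg _ (hu i0 hi0)
      rw [hg0] at hcl
      have hcongr : ∀ i ∈ s.filter (fun i => u i = u i0), u i * v i = u i0 * v i := fun i hi => by
        rw [(mem_filter.1 hi).2]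
      refine VanishingShape.mono (filter_subset (fun i => u i = u i0) s)
        (fun i hi => by rw [← hzuv i hi]; exact hz0 i hi) hcard h0' ?_ ?_
      · rw [sum_congr rfl hcongr, ← mul_sum, hcl, mul_zero]
      · refine VanishingShape.scale (z := v) (r := u i0) hcongr ?_
        exact ih m (lt_mul_left hm hp.one_lt) _ _ hm ⟨i0, by simp [hi0]⟩
          ((card_le_card (filter_subset _ _)).trans hcard)
          (fun i hi => hv i (mem_filter.1 hi).1) hcl
    · have hne : ∀ r : ℂ, r ^ p = 1 → ∃ i ∈ s, u i = r := fun r hr => by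
        by_contra! hcon
        apply hg0
        rw [← hg r hr, filter_false_of_mem hcon, sum_empty]
      rcases hpp with h5 | ⟨rfl, hm2⟩
      · exact vanishingShape_of_coprime_five_le hp h5 hm hu hv hcard hne g hg
      · refine vanishingShape_of_three hu (fun i hi => ?_) hne g hg
        obtain ⟨k, hk⟩ := hm2
        rw [hk, pow_mul, hv i hi, one_pow]
  have hall : ∀ p, p.Prime → 5 ≤ p → p ∣ N → VanishingShape s z := fun p hp h5 ⟨m, hm⟩ => by
    by_cases h : p ∣ m
    · exact hsq p m hp hm h
    · exact hcop p m hp hm ((Nat.Prime.coprime_iff_not_dvd hp).2 h) (Or.inl h5)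
  -- What remains is N without prime factors above 3 and squarefree, that is N ∣ 6, treated by the
  -- prime 3 or, if 3 ∤ N, as a sum of signs.
  by_contra hcon
  have h4 : ¬ 4 ∣ N := fun ⟨m, hm⟩ => hcon (hsq 2 (2 * m) Nat.prime_two (by omega) ⟨m, rfl⟩)
  have h9 : ¬ 9 ∣ N := fun ⟨m, hm⟩ => hcon (hsq 3 (3 * m) Nat.prime_three (by omega) ⟨m, rfl⟩)
  have hN6 : N ∣ 6 := by
    have hsub : N.primeFactors ⊆ {2, 3} := fun p hp => by
      have hpp := Nat.prime_of_mem_primeFactors hp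
      have hpd := Nat.dvd_of_mem_primeFactors hp
      by_contra hp23
      simp only [mem_insert, mem_singleton, not_or] at hp23
      refine hcon (hall p hpp ?_ hpd)
      have := hpp.two_le
      have : p ≠ 4 := by rintro rfl; norm_num at hpp
      omega
    have hsf : Squarefree N := by
      rw [Nat.squarefree_iff_prime_squarefree]
      intro p hpp hpd
      have : p ∈ N.primeFactors := Nat.mem_primeFactors.2
        ⟨hpp, (dvd_mul_right p p).trans hpd, hN.ne'⟩
      have := hsub this
      simp only [mem_insert, mem_singleton] at this
      rcases this with rfl | rfl
      · exact h4 hpd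
      · exact h9 hpd
    rw [← Nat.prod_primeFactors_of_squarefree hsf]
    exact (prod_dvd_prod_of_subset _ _ _ hsub).trans (by simp)
  by_cases h3 : 3 ∣ N
  · obtain ⟨m, rfl⟩ := h3
    have hm2 : m ∣ 2 := Nat.dvd_of_mul_dvd_mul_left (k := 3) (by norm_num) hN6
    refine hcon (hcop 3 m Nat.prime_three rfl ?_ (Or.inr ⟨rfl, hm2⟩))
    rw [Nat.Prime.coprime_iff_not_dvd Nat.prime_three]
    rintro ⟨k, rfl⟩
    exact h9 ⟨k, by ring⟩
  · have hN2 : N ∣ 2 := by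
      have : N.Coprime 3 := ((Nat.Prime.coprime_iff_not_dvd Nat.prime_three).2 h3).symm
      exact this.dvd_of_dvd_mul_left (show N ∣ 3 * 2 from hN6)
    obtain ⟨k, hk⟩ := hN2
    exact hcon (vanishingShape_of_sq_eq_one hs
      (fun i hi => by rw [hk, pow_mul, hz i hi, one_pow]) h0)

/-! ### Three roots of unity whose real parts sum to zero -/

theorem inv_add_eq_neg {Y Z : ℂ} (hY : Y ≠ 0) (hZ : Z ≠ 0) (h : Y + Y⁻¹ + (Z + Z⁻¹) = 0) :
    Y = -Z ∨ Y = -Z⁻¹ := by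
  field_simp at h
  have : (Y + Z) * (Y * Z + 1) = 0 := by linear_combination h
  rcases mul_eq_zero.1 this with h | h
  · exact Or.inl (eq_neg_of_add_eq_zero_left h)
  · right; field_simp; linear_combination h

theorem eq_or_eq_inv_of_add_inv {Y Z : ℂ} (hY : Y ≠ 0) (hZ : Z ≠ 0) (h : Y + Y⁻¹ = Z + Z⁻¹) :
    Y = Z ∨ Y = Z⁻¹ := by
  field_simp at h
  have : (Y - Z) * (Y * Z - 1) = 0 := by linear_combination h
  rcases mul_eq_zero.1 this with h | h
  · exact Or.inl (sub_eq_zero.1 h)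
  · right; field_simp; linear_combination h

theorem sq_eq_neg_one_of_add_inv {Z : ℂ} (hZ : Z ≠ 0) (h : Z + Z⁻¹ = 0) : Z ^ 2 = -1 := by
  field_simp at h; linear_combination h

/-- Three unit numbers, two of which are inverse to each other, in a vanishing sum. -/
theorem exists_sign_of_inv_pair {X Y Z : ℂ} (hX : ‖X‖ = 1) (hY : ‖Y‖ = 1) (hZ : ‖Z‖ = 1)
    (h0 : X + X⁻¹ + Y + Y⁻¹ + Z + Z⁻¹ = 0) (h : X + X⁻¹ + Y = 0) :
    X + Y + Z = 0 ∨ X + Y + Z⁻¹ = 0 := by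
  have hX0 : X ≠ 0 := by rintro rfl; simp at hX
  have hZ0 : Z ≠ 0 := by rintro rfl; simp at hZ
  have h2 : X⁻¹ + X + Y⁻¹ = 0 := by
    have := congrArg (starRingEnd ℂ) h
    simp only [map_add, map_inv₀, map_zero] at this
    rw [← Complex.inv_eq_conj hX, ← Complex.inv_eq_conj hY, inv_inv] at this
    exact this
  -- Adding `h` to its conjugate and subtracting `h0` leaves X + X⁻¹ = Z + Z⁻¹, so Z can replace X
  -- or X⁻¹ in `h`.
  rcases eq_or_eq_inv_of_add_inv hX0 hZ0 (by linear_combination h + h2 - h0) with rfl | rfl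
  · exact Or.inr (by linear_combination h)
  · exact Or.inl (by rw [inv_inv] at h; linear_combination h)

/-- There are three unit numbers `X`, `Y^{±1}`, `Z^{±1}` with vanishing sum. -/
def SignedTriangle (X Y Z : ℂ) : Prop :=
  ∃ Y' Z' : ℂ, (Y' = Y ∨ Y' = Y⁻¹) ∧ (Z' = Z ∨ Z' = Z⁻¹) ∧ X + Y' + Z' = 0

/-- `X ^ 2` is a primitive cube root of unity, `Y` and `Z` are tenth roots of unity. -/
def DecagonShape (X Y Z : ℂ) : Prop :=
  X ^ 4 + X ^ 2 + 1 = 0 ∧ Y ^ 10 = 1 ∧ Z ^ 10 = 1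

/-- Conjugation inverts all three unit numbers at once, so the exponent of X can be normalised to 1.
-/
theorem signedTriangle_of_sum {X Y Z : ℂ} (hX : ‖X‖ = 1) (hY : ‖Y‖ = 1) (hZ : ‖Z‖ = 1)
    {x y z : ℂ} (hx : x = X ∨ x = X⁻¹) (hy : y = Y ∨ y = Y⁻¹) (hz : z = Z ∨ z = Z⁻¹)
    (h : x + y + z = 0) : SignedTriangle X Y Z := by
  rcases hx with rfl | rfl
  · exact ⟨y, z, hy, hz, h⟩
  · refine ⟨y⁻¹, z⁻¹, ?_, ?_, ?_⟩
    · rcases hy with rfl | rfl <;> simp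
    · rcases hz with rfl | rfl <;> simp
    · have hy1 : ‖y‖ = 1 := by rcases hy with rfl | rfl <;> simp [hY]
      have hz1 : ‖z‖ = 1 := by rcases hz with rfl | rfl <;> simp [hZ]
      have := congrArg (starRingEnd ℂ) h
      simp only [map_add, map_inv₀, map_zero] at this
      rwa [← Complex.inv_eq_conj hX, ← Complex.inv_eq_conj hy1, ← Complex.inv_eq_conj hz1,
        inv_inv] at this

theorem signedTriangle_perm {X Y Z : ℂ} (hX : ‖X‖ = 1) (hY : ‖Y‖ = 1) (hZ : ‖Z‖ = 1) :
    (SignedTriangle Y X Z → SignedTriangle X Y Z) ∧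
    (SignedTriangle Z X Y → SignedTriangle X Y Z) := by
  constructor
  · rintro ⟨x, z, hx, hz, h⟩
    exact signedTriangle_of_sum hX hY hZ hx (Or.inl rfl) hz (by linear_combination h)
  · rintro ⟨x, y, hx, hy, h⟩
    exact signedTriangle_of_sum hX hY hZ hx hy (Or.inl rfl) (by linear_combination h)

theorem signedTriangle_of_inv_pair {X Y Z y : ℂ} (hX : ‖X‖ = 1) (hY : ‖Y‖ = 1) (hZ : ‖Z‖ = 1)
    (h0 : X + X⁻¹ + Y + Y⁻¹ + Z + Z⁻¹ = 0) (hy : y = Y ∨ y = Y⁻¹) (h : X + X⁻¹ + y = 0) :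
    SignedTriangle X Y Z := by
  have hy1 : ‖y‖ = 1 := by rcases hy with rfl | rfl <;> simp [hY]
  have h0' : X + X⁻¹ + y + y⁻¹ + Z + Z⁻¹ = 0 := by
    rcases hy with rfl | rfl
    · exact h0
    · rw [inv_inv]; linear_combination h0
  rcases exists_sign_of_inv_pair hX hy1 hZ h0' h with h | h
  · exact ⟨y, Z, hy, Or.inl rfl, h⟩
  · exact ⟨y, Z⁻¹, hy, Or.inr rfl, h⟩

/-- Three roots of unity whose real parts sum to zero. -/
theorem classification_sum_add_inv {N : ℕ} (hN : 0 < N) {X Y Z : ℂ} (hX : X ^ N = 1)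
    (hY : Y ^ N = 1) (hZ : Z ^ N = 1) (h0 : X + X⁻¹ + Y + Y⁻¹ + Z + Z⁻¹ = 0) :
    (X ^ 2 = -1 ∨ Y ^ 2 = -1 ∨ Z ^ 2 = -1) ∨ SignedTriangle X Y Z ∨
    (DecagonShape X Y Z ∨ DecagonShape Y X Z ∨ DecagonShape Z X Y) := by
  have nX := Complex.norm_eq_one_of_pow_eq_one hX hN.ne'
  have nY := Complex.norm_eq_one_of_pow_eq_one hY hN.ne'
  have nZ := Complex.norm_eq_one_of_pow_eq_one hZ hN.ne'
  have X0 : X ≠ 0 := by rintro rfl; simp at nX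
  have Y0 : Y ≠ 0 := by rintro rfl; simp at nY
  have Z0 : Z ≠ 0 := by rintro rfl; simp at nZ
  have key := vanishingShape_of_sum_eq_zero N univ ![X, X⁻¹, Y, Y⁻¹, Z, Z⁻¹] hN univ_nonempty
    (by simp) (by intro i _; fin_cases i <;> simp [hX, hY, hZ])
    (by simp only [Fin.sum_univ_six]; exact h0)
  have qX : X + X⁻¹ = 0 → X ^ 2 = -1 := sq_eq_neg_one_of_add_inv X0
  have qY : Y + Y⁻¹ = 0 → Y ^ 2 = -1 := sq_eq_neg_one_of_add_inv Y0
  have qZ : Z + Z⁻¹ = 0 → Z ^ 2 = -1 := sq_eq_neg_one_of_add_inv Z0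
  have neg_inv' : ∀ {u v : ℂ}, u = -v → u⁻¹ = -v⁻¹ := fun h => by rw [h, inv_neg]
  rcases key with ⟨i, -, j, -, h⟩ | ⟨i, -, j, -, k, -, hij, hik, hjk, h⟩ | h |
    ⟨-, i, -, j, -, hij, h1, h2⟩
  -- Two opposite terms: either they are inverse to each other, or together with their inverses they
  -- exhaust two of the three pairs and the third pair sums to zero. A term is never its own
  -- opposite.
  · left
    have cX : X ≠ -X := fun h => X0 (by linear_combination h / 2)
    have cY : Y ≠ -Y := fun h => Y0 (by linear_combination h / 2)
    have cZ : Z ≠ -Z := fun h => Z0 (by linear_combination h / 2)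
    have cX' : X⁻¹ ≠ -X⁻¹ := fun h => inv_ne_zero X0 (by linear_combination h / 2)
    have cY' : Y⁻¹ ≠ -Y⁻¹ := fun h => inv_ne_zero Y0 (by linear_combination h / 2)
    have cZ' : Z⁻¹ ≠ -Z⁻¹ := fun h => inv_ne_zero Z0 (by linear_combination h / 2)
    have h' := neg_inv' h
    fin_cases i <;> fin_cases j <;> simp at h h' <;>
    first
    | exact absurd h cX
    | exact absurd h cY
    | exact absurd h cZ
    | exact absurd h cX'
    | exact absurd h cY'
    | exact absurd h cZ'
    | exact Or.inl (qX (by linear_combination h))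
    | exact Or.inr (Or.inl (qY (by linear_combination h)))
    | exact Or.inr (Or.inr (qZ (by linear_combination h)))
    | exact Or.inl (qX (by linear_combination h0 - h - h'))
    | exact Or.inr (Or.inl (qY (by linear_combination h0 - h - h')))
    | exact Or.inr (Or.inr (qZ (by linear_combination h0 - h - h')))
  -- Three terms of sum zero: either they come from three different pairs, or two of them are
  -- inverse to each other and `exists_sign_of_inv_pair` trades one for a term of the missing pair.
  · right; left
    obtain ⟨p1, p2⟩ := signedTriangle_perm nX nY nZ
    have t : ∀ {x y z : ℂ}, (x = X ∨ x = X⁻¹) → (y = Y ∨ y = Y⁻¹) → (z = Z ∨ z = Z⁻¹) →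
      x + y + z = 0 → SignedTriangle X Y Z := signedTriangle_of_sum nX nY nZ
    have sw : ∀ {u v w : ℂ}, SignedTriangle u v w → SignedTriangle u w v :=
      fun ⟨y, z, hy, hz, h⟩ => ⟨z, y, hz, hy, by linear_combination h⟩
    have s1 : ∀ {y : ℂ}, (y = Y ∨ y = Y⁻¹) → X + X⁻¹ + y = 0 → SignedTriangle X Y Z :=
      signedTriangle_of_inv_pair nX nY nZ h0
    have s2 : ∀ {y : ℂ}, (y = Z ∨ y = Z⁻¹) → X + X⁻¹ + y = 0 → SignedTriangle X Y Z :=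
      fun hy h => sw (signedTriangle_of_inv_pair nX nZ nY (by linear_combination h0) hy h)
    have s3 : ∀ {y : ℂ}, (y = X ∨ y = X⁻¹) → Y + Y⁻¹ + y = 0 → SignedTriangle X Y Z :=
      fun hy h => p1 (signedTriangle_of_inv_pair nY nX nZ (by linear_combination h0) hy h)
    have s4 : ∀ {y : ℂ}, (y = Z ∨ y = Z⁻¹) → Y + Y⁻¹ + y = 0 → SignedTriangle X Y Z :=
      fun hy h => p1 (sw (signedTriangle_of_inv_pair nY nZ nX (by linear_combination h0) hy h))
    have s5 : ∀ {y : ℂ}, (y = X ∨ y = X⁻¹) → Z + Z⁻¹ + y = 0 → SignedTriangle X Y Z :=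
      fun hy h => p2 (signedTriangle_of_inv_pair nZ nX nY (by linear_combination h0) hy h)
    have s6 : ∀ {y : ℂ}, (y = Y ∨ y = Y⁻¹) → Z + Z⁻¹ + y = 0 → SignedTriangle X Y Z :=
      fun hy h => p2 (sw (signedTriangle_of_inv_pair nZ nY nX (by linear_combination h0) hy h))
    have l := fun u v : ℂ => (Or.inl rfl : u = u ∨ u = v)
    have r := fun u v : ℂ => (Or.inr rfl : u = v ∨ u = u)
    set W : Fin 6 → ℂ := ![X, X⁻¹, Y, Y⁻¹, Z, Z⁻¹] with hW
    have sorted : ∀ i j k : Fin 6, i < j → j < k → W i + W j + W k = 0 → SignedTriangle X Y Z := by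
      intro i j k hij hjk h
      fin_cases i <;> fin_cases j <;> (try exact absurd hij (by decide)) <;> fin_cases k <;>
        (try exact absurd hjk (by decide)) <;> simp [hW] at h <;>
      first
      | exact s1 (l _ _) h
      | exact s1 (r _ _) h
      | exact s2 (l _ _) h
      | exact s2 (r _ _) h
      | exact t (l _ _) (l _ _) (l _ _) h
      | exact t (l _ _) (l _ _) (r _ _) h
      | exact t (l _ _) (r _ _) (l _ _) h
      | exact t (l _ _) (r _ _) (r _ _) h
      | exact t (r _ _) (l _ _) (l _ _) h
      | exact t (r _ _) (l _ _) (r _ _) h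
      | exact t (r _ _) (r _ _) (l _ _) h
      | exact t (r _ _) (r _ _) (r _ _) h
      | exact s3 (l _ _) (by linear_combination h)
      | exact s3 (r _ _) (by linear_combination h)
      | exact s4 (l _ _) (by linear_combination h)
      | exact s4 (r _ _) (by linear_combination h)
      | exact s5 (l _ _) (by linear_combination h)
      | exact s5 (r _ _) (by linear_combination h)
      | exact s6 (l _ _) (by linear_combination h)
      | exact s6 (r _ _) (by linear_combination h)
    rcases lt_or_gt_of_ne hij with a | a <;> rcases lt_or_gt_of_ne hik with b | b <;>
      rcases lt_or_gt_of_ne hjk with c | c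
    · exact sorted i j k a c h
    · exact sorted i k j b c (by linear_combination h)
    · exact absurd (a.trans c) b.asymm
    · exact sorted k i j b a (by linear_combination h)
    · exact sorted j i k a b (by linear_combination h)
    · exact absurd (c.trans a) b.asymm
    · exact sorted j k i c b (by linear_combination h)
    · exact sorted k j i c a (by linear_combination h)
  · simp at h
  · right; right
    set W : Fin 6 → ℂ := ![X, X⁻¹, Y, Y⁻¹, Z, Z⁻¹] with hW
    -- The involution of the indices that corresponds to inversion.
    set bar : Fin 6 → Fin 6 := ![1, 0, 3, 2, 5, 4] with hbar
    have hbar1 : ∀ i, bar i ≠ i := by decide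
    have hbar2 : ∀ i j, bar i ≠ j → bar j ≠ i := by decide
    have hbar3 : ∀ i k : Fin 6, i ≠ bar k → k ≠ bar i := by decide
    have hWbar : ∀ i, W (bar i) = (W i)⁻¹ := by
      intro i; fin_cases i <;> simp [hW, hbar]
    have hW0 : ∀ i, W i ≠ 0 := by intro i; fin_cases i <;> simp [hW, X0, Y0, Z0]
    by_cases hb : bar i = j
    · subst hb
      have ten : ∀ {u : ℂ}, u ≠ 0 → u ^ 5 = u⁻¹ ^ 5 → u ^ 10 = 1 := fun hu h => by
        field_simp at h; linear_combination h
      have six : ∀ {u : ℂ}, u ≠ 0 → u ^ 2 + u * u⁻¹ + u⁻¹ ^ 2 = 0 → u ^ 4 + u ^ 2 + 1 = 0 :=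
        fun hu h => by field_simp at h; linear_combination h
      have six' : ∀ {u : ℂ}, u ≠ 0 → u⁻¹ ^ 2 + u⁻¹ * u + u ^ 2 = 0 → u ^ 4 + u ^ 2 + 1 = 0 :=
        fun hu h => by field_simp at h; linear_combination h
      have eX : i ≠ 0 → i ≠ 1 → X ^ 10 = 1 := fun h h' =>
        ten X0 (h2 0 (mem_univ _) 1 (mem_univ _) h.symm (hbar3 i _ h')
          h'.symm (hbar3 i _ h))
      have eY : i ≠ 2 → i ≠ 3 → Y ^ 10 = 1 := fun h h' =>
        ten Y0 (h2 2 (mem_univ _) 3 (mem_univ _) h.symm (hbar3 i _ h')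
          h'.symm (hbar3 i _ h))
      have eZ : i ≠ 4 → i ≠ 5 → Z ^ 10 = 1 := fun h h' =>
        ten Z0 (h2 4 (mem_univ _) 5 (mem_univ _) h.symm (hbar3 i _ h')
          h'.symm (hbar3 i _ h))
      fin_cases i
      · exact Or.inl ⟨six X0 h1, eY (by decide) (by decide), eZ (by decide) (by decide)⟩
      · exact Or.inl ⟨six' X0 h1, eY (by decide) (by decide), eZ (by decide) (by decide)⟩
      · exact Or.inr (Or.inl ⟨six Y0 h1, eX (by decide) (by decide), eZ (by decide) (by decide)⟩)
      · exact Or.inr (Or.inl ⟨six' Y0 h1, eX (by decide) (by decide), eZ (by decide) (by decide)⟩)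
      · exact Or.inr (Or.inr ⟨six Z0 h1, eX (by decide) (by decide), eY (by decide) (by decide)⟩)
      · exact Or.inr (Or.inr ⟨six' Z0 h1, eX (by decide) (by decide), eY (by decide) (by decide)⟩)
    -- Otherwise the inverses of W i and W j both lie among the four terms with equal fifth powers,
    -- so W i and W j have equal fifth powers. Their cubes are equal by `h1`, hence so are they,
    -- contrary to their ratio being a primitive cube root of unity.
    · exfalso
      have h5 := h2 (bar i) (mem_univ _) (bar j) (mem_univ _) (hbar1 i) hb (hbar2 i j hb) (hbar1 j)
      rw [hWbar, hWbar, inv_pow, inv_pow, inv_inj] at h5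
      have h3 : W i ^ 3 = W j ^ 3 := by linear_combination (W i - W j) * h1
      have hij' : W i = W j := by
        have : W j ^ 5 * (W i - W j) = 0 := by
          linear_combination (W i ^ 3 + W j ^ 3) * h3 - W i * h5
        exact sub_eq_zero.1 ((mul_eq_zero.1 this).resolve_left (pow_ne_zero _ (hW0 j)))
      rw [hij'] at h1
      have : 3 * W j ^ 2 = 0 := by linear_combination h1
      simp [hW0 j] at this

/-! ### Centred labellings -/

/-- A centred distance magic labelling: twice a labelling by `1, …, n`, minus `n + 1`. -/
structure IsCentredLabelling (n : ℕ) (S : Finset (ZMod n)) (g : ZMod n → ℤ) : Prop where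
  injective : Function.Injective g
  lower : ∀ x, -((n : ℤ) - 1) ≤ g x
  upper : ∀ x, g x ≤ (n : ℤ) - 1
  parity : ∀ x, (2 : ℤ) ∣ g x + n + 1
  sum_eq_zero : ∀ v, ∑ s ∈ S, g (v + s) = 0

theorem finsum_circ_neighborSet {n : ℕ} {S : Finset (ZMod n)} (hneg : ∀ s ∈ S, -s ∈ S)
    (h0 : (0 : ZMod n) ∉ S) (l : ZMod n → ℕ) (v : ZMod n) :
    ∑ᶠ u ∈ (Circ n S).neighborSet v, l u = ∑ s ∈ S, l (v + s) := by
  have : (Circ n S).neighborSet v = ↑(S.image fun s => v + s) := by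
    ext u
    simp only [Circ, SimpleGraph.mem_neighborSet, SimpleGraph.circulantGraph_adj, coe_image,
      Set.mem_image, mem_coe]
    constructor
    · rintro ⟨-, h | h⟩
      · exact ⟨u - v, by simpa using hneg _ h, by ring⟩
      · exact ⟨u - v, h, by ring⟩
    · rintro ⟨s, hs, rfl⟩
      refine ⟨fun h => h0 ?_, Or.inr (by simpa using hs)⟩
      have : s = 0 := by simpa using h
      rwa [← this]
  rw [this, finsum_mem_coe_finset, sum_image (fun a _ b _ h => add_left_cancel h)]

theorem two_mul_sum_labelling {n : ℕ} [NeZero n] {l : ZMod n → ℕ}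
    (hl : Set.BijOn l Set.univ (Set.Icc 1 n)) : 2 * ∑ v, l v = n * (n + 1) := by
  have himg : univ.image l = Icc 1 n := by
    apply coe_injective
    rw [coe_image, coe_univ, hl.image_eq, coe_Icc]
  have h1 : ∑ v, l v = ∑ i ∈ Icc 1 n, i := by
    rw [← himg, sum_image (fun a _ b _ h => hl.injOn (Set.mem_univ _) (Set.mem_univ _) h)]
  have h2 : ∀ m : ℕ, 2 * ∑ i ∈ Icc 1 m, i = m * (m + 1) := fun m => by
    induction m with
    | zero => simp
    | succ k ih => rw [sum_Icc_succ_top (by omega), mul_add, ih]; ring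
  rw [h1, h2]

/-- Summing the magic condition over all vertices counts every label six times, which forces κ = 3(n
+ 1), six times the mean label. Centring then makes the neighbour sums zero. -/
theorem isDistanceMagic_circ_iff {n : ℕ} [NeZero n] {S : Finset (ZMod n)}
    (hneg : ∀ s ∈ S, -s ∈ S) (h0 : (0 : ZMod n) ∉ S) (hcard : S.card = 6) :
    IsDistanceMagic (Circ n S) ↔ ∃ g, IsCentredLabelling n S g := by
  have hn : 0 < n := Nat.pos_of_ne_zero (NeZero.ne n)
  unfold IsDistanceMagic
  simp_rw [finsum_circ_neighborSet hneg h0, ZMod.card]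
  constructor
  · rintro ⟨l, hl, κ, -, hκ⟩
    have hmem : ∀ x, 1 ≤ l x ∧ l x ≤ n := fun x => hl.mapsTo (Set.mem_univ x)
    have hκ' : κ = 3 * (n + 1) := by
      have h1 : ∑ v : ZMod n, ∑ s ∈ S, l (v + s) = n * κ := by
        simp [hκ]
      rw [sum_comm] at h1
      have h2 : ∀ s ∈ S, ∑ v : ZMod n, l (v + s) = ∑ v, l v := fun s _ =>
        Equiv.sum_comp (Equiv.addRight s) l
      rw [sum_congr rfl h2, sum_const, hcard, smul_eq_mul] at h1
      have h3 := two_mul_sum_labelling hl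
      apply Nat.eq_of_mul_eq_mul_left hn
      rw [← h1]
      linarith
    refine ⟨fun x => 2 * (l x : ℤ) - (n + 1), ?_, ?_, ?_, ?_, ?_⟩
    · intro x y hxy
      refine hl.injOn (Set.mem_univ _) (Set.mem_univ _) ?_
      simp only at hxy
      omega
    · intro x; have := hmem x; lia
    · intro x; have := hmem x; lia
    · intro x; exact ⟨l x, by ring⟩
    · intro v
      have := hκ v
      rw [sum_sub_distrib, ← mul_sum, sum_const, hcard, ← Nat.cast_sum, this, hκ']
      push_cast
      ring
  · rintro ⟨g, hg⟩
    have hex : ∀ x, ∃ k : ℕ, g x + n + 1 = 2 * k ∧ 1 ≤ k ∧ k ≤ n := fun x => by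
      obtain ⟨k, hk⟩ := hg.parity x
      have h1 := hg.lower x
      have h2 := hg.upper x
      exact ⟨k.toNat, by omega, by omega, by omega⟩
    choose l hl hl1 hln using hex
    have hinj : Function.Injective l := fun x y h => hg.injective (by
      have h1 := hl x; have h2 := hl y; rw [h] at h1; omega)
    refine ⟨l, ⟨fun x _ => ⟨hl1 x, hln x⟩, hinj.injOn, ?_⟩, 3 * (n + 1), by omega, fun v => ?_⟩
    · have himg : univ.image l = Icc 1 n := by
        apply eq_of_subset_of_card_le
        · intro k hk
          obtain ⟨x, -, rfl⟩ := mem_image.1 hk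
          exact mem_Icc.2 ⟨hl1 x, hln x⟩
        · rw [card_image_of_injective _ hinj, card_univ, ZMod.card]; simp
      intro k hk
      have : k ∈ univ.image l := by rw [himg]; exact mem_Icc.2 hk
      obtain ⟨x, -, rfl⟩ := mem_image.1 this
      exact ⟨x, Set.mem_univ _, rfl⟩
    · have h1 := hg.sum_eq_zero v
      have h2 : ∑ s ∈ S, (g (v + s) + n + 1) = ∑ s ∈ S, 2 * (l (v + s) : ℤ) :=
        sum_congr rfl fun s _ => hl _
      rw [sum_add_distrib, sum_add_distrib, h1, ← mul_sum, sum_const, sum_const, hcard] at h2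
      have h3 : ((∑ s ∈ S, l (v + s) : ℕ) : ℤ) = 3 * (n + 1) := by
        push_cast
        simp only [nsmul_eq_mul] at h2
        push_cast at h2
        linarith
      exact_mod_cast h3

/-! ### Fourier analysis on ℤ/n -/

/-- If every character annihilated by the connection set is annihilated by `c`, then so is every
function with vanishing neighbour sums. -/
theorem sum_mul_eq_zero_of_characters {n : ℕ} [NeZero n] {S : Finset (ZMod n)} {g : ZMod n → ℂ}
    (hg : ∀ v, ∑ s ∈ S, g (v + s) = 0) {c : ZMod n → ℂ} {R : Finset (ZMod n)}
    (hc : ∀ j : ZMod n, ∑ s ∈ S, ZMod.stdAddChar (j * s) = (0 : ℂ) →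
      ∑ t ∈ R, c t * ZMod.stdAddChar (j * t) = 0) (v : ZMod n) :
    ∑ t ∈ R, c t * g (v + t) = 0 := by
  -- Convolution becomes multiplication. At each frequency either the factor of S vanishes, and then
  -- that of `c` does too, or the transform of `g` vanishes.
  have key : ∀ (R : Finset (ZMod n)) (c : ZMod n → ℂ) (k : ZMod n),
      ZMod.dft (fun v => ∑ t ∈ R, c t * g (v + t)) k =
        (∑ t ∈ R, c t * ZMod.stdAddChar (k * t)) * ZMod.dft g k := fun R c k => by
    simp only [ZMod.dft_apply, smul_eq_mul, mul_sum, sum_mul]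
    rw [sum_comm]
    conv_rhs => rw [sum_comm]
    refine sum_congr rfl fun t _ => ?_
    rw [← Equiv.sum_comp (Equiv.addRight (-t))]
    refine sum_congr rfl fun j _ => ?_
    simp only [Equiv.coe_addRight, neg_add_cancel_right]
    have : -((j + -t) * k) = k * t + -(j * k) := by ring
    rw [this, AddChar.map_add_eq_mul]
    ring
  have h0 : ZMod.dft (fun v => ∑ t ∈ R, c t * g (v + t)) = 0 := by
    funext k
    rw [key]
    by_cases hk : ∑ s ∈ S, ZMod.stdAddChar (k * s) = (0 : ℂ)
    · rw [hc k hk, zero_mul]; rfl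
    · have h1 := key S (fun _ => 1) k
      simp only [one_mul, hg] at h1
      have h2 : ZMod.dft (fun _ : ZMod n => (0 : ℂ)) k = 0 := by simp [ZMod.dft_apply]
      rw [h2] at h1
      rw [(mul_eq_zero.1 h1.symm).resolve_left hk, mul_zero]; rfl
  exact congrFun ((LinearEquiv.map_eq_zero_iff _).1 h0) v

/-- The orders of the characters of `ℤ/n` that vanish on `{±a, ±b, ±c}`. -/
def kernelOrders (n : ℕ) (a b c : ℤ) : Set ℕ :=
  {m | m ∣ n ∧ ∃ E : ℂ, IsPrimitiveRoot E m ∧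
    E ^ a + (E ^ a)⁻¹ + E ^ b + (E ^ b)⁻¹ + E ^ c + (E ^ c)⁻¹ = 0}

theorem nodup_of_card_pmSet {n : ℕ} {a b c : ZMod n} (h : (pmSet a b c).card = 6) :
    [a, -a, b, -b, c, -c].Nodup := by
  have h1 : pmSet a b c = [a, -a, b, -b, c, -c].toFinset := by
    ext x; simp [pmSet]
  rw [h1, List.card_toFinset] at h
  have h2 : [a, -a, b, -b, c, -c].dedup = [a, -a, b, -b, c, -c] :=
    (List.dedup_sublist _).eq_of_length (by rw [h]; rfl)
  exact List.dedup_eq_self.1 h2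

theorem sum_pmSet {n : ℕ} {M : Type*} [AddCommMonoid M] {a b c : ZMod n}
    (h : (pmSet a b c).card = 6) (f : ZMod n → M) :
    ∑ s ∈ pmSet a b c, f s = f a + f (-a) + f b + f (-b) + f c + f (-c) := by
  have h1 : pmSet a b c = [a, -a, b, -b, c, -c].toFinset := by
    ext x; simp [pmSet]
  rw [h1, List.sum_toFinset _ (nodup_of_card_pmSet h)]
  simp [add_assoc]

theorem mem_kernelOrders_of_character {n : ℕ} [NeZero n] {a b c : ℤ}
    (h : (pmSet (a : ZMod n) b c).card = 6) {j : ZMod n}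
    (hj : ∑ s ∈ pmSet (a : ZMod n) b c, ZMod.stdAddChar (j * s) = (0 : ℂ)) :
    ∃ m ∈ kernelOrders n a b c, IsPrimitiveRoot (ZMod.stdAddChar j : ℂ) m := by
  have hz : ∀ x : ℤ, (ZMod.stdAddChar (j * (x : ZMod n)) : ℂ) = (ZMod.stdAddChar j : ℂ) ^ x :=
    fun x => by rw [← AddChar.map_zsmul_eq_zpow, zsmul_eq_mul, mul_comm]
  have hz' : ∀ x : ℤ, (ZMod.stdAddChar (j * -(x : ZMod n)) : ℂ) =
      ((ZMod.stdAddChar j : ℂ) ^ x)⁻¹ := fun x => by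
    rw [← zpow_neg, ← hz, Int.cast_neg]
  rw [sum_pmSet h, hz, hz, hz, hz', hz', hz'] at hj
  refine ⟨orderOf (ZMod.stdAddChar j : ℂ), ⟨?_, _, IsPrimitiveRoot.orderOf _, hj⟩,
    IsPrimitiveRoot.orderOf _⟩
  apply orderOf_dvd_of_pow_eq_one
  rw [← AddChar.map_nsmul_eq_pow]
  simp

/-- Every surviving character is trivial at M, so the relation with coefficients -1 at 0 and 1 at M
gives g(M) = g(0), and injectivity makes M zero in ℤ/n. -/
theorem dvd_of_forall_kernelOrders_dvd {n : ℕ} [NeZero n] {a b c : ℤ}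
    (h : (pmSet (a : ZMod n) b c).card = 6) {g : ZMod n → ℤ}
    (hg : IsCentredLabelling n (pmSet (a : ZMod n) b c) g) {M : ℕ}
    (hM : ∀ m ∈ kernelOrders n a b c, m ∣ M) : n ∣ M := by
  rw [← ZMod.natCast_eq_zero_iff]
  by_contra hne
  have key := sum_mul_eq_zero_of_characters (S := pmSet (a : ZMod n) b c)
    (g := fun v => (g v : ℂ)) (fun v => by exact_mod_cast hg.sum_eq_zero v)
    (R := {0, (M : ZMod n)}) (c := fun t => if t = 0 then -1 else 1) (fun j hj => by
      obtain ⟨m, hm, hE⟩ := mem_kernelOrders_of_character h hj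
      rw [sum_pair (Ne.symm hne)]
      have h1 : (ZMod.stdAddChar (j * (M : ZMod n)) : ℂ) = 1 := by
        rw [mul_comm, ← nsmul_eq_mul, AddChar.map_nsmul_eq_pow, hE.pow_eq_one_iff_dvd]
        exact hM m hm
      simp [hne, h1]) 0
  rw [sum_pair (Ne.symm hne)] at key
  simp only [hne, if_true, if_false, zero_add, one_mul, add_zero] at key
  have : g (M : ZMod n) = g 0 := by
    have : (g (M : ZMod n) : ℂ) = g 0 := by linear_combination key
    exact_mod_cast this
  exact hne (hg.injective this)

/-- If no order divides k, each surviving character takes a primitive cube root of unity as its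
value at k, and `g` sums to zero over 0, k, 2k. But n = 3k is even, so all values of `g` are odd. -/
theorem exists_kernelOrders_dvd_of_even {k : ℕ} [NeZero (3 * k)] {a b c : ℤ}
    (h : (pmSet (a : ZMod (3 * k)) b c).card = 6) {g : ZMod (3 * k) → ℤ}
    (hg : IsCentredLabelling (3 * k) (pmSet (a : ZMod (3 * k)) b c) g) (hk : Even k) :
    ∃ m ∈ kernelOrders (3 * k) a b c, m ∣ k := by
  by_contra! hcon
  have hpos : 0 < 3 * k := Nat.pos_of_ne_zero (NeZero.ne _)
  have hd1 : (0 : ZMod (3 * k)) ≠ (k : ZMod (3 * k)) := fun h => by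
    have := (ZMod.natCast_eq_zero_iff _ _).1 h.symm
    have := Nat.le_of_dvd (by omega) this
    omega
  have hd2 : (0 : ZMod (3 * k)) ≠ ((2 * k : ℕ) : ZMod (3 * k)) := fun h => by
    have := (ZMod.natCast_eq_zero_iff _ _).1 h.symm
    have := Nat.le_of_dvd (by omega) this
    omega
  have hd3 : (k : ZMod (3 * k)) ≠ ((2 * k : ℕ) : ZMod (3 * k)) := fun h => by
    apply hd1
    have h2 : (k : ZMod (3 * k)) = k + k := by
      rw [two_mul, Nat.cast_add] at h; exact h
    exact (left_eq_add.1 h2).symm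
  have hsum : ∀ f : ZMod (3 * k) → ℂ,
      ∑ t ∈ {0, (k : ZMod (3 * k)), ((2 * k : ℕ) : ZMod (3 * k))}, f t =
        f 0 + (f k + f ((2 * k : ℕ) : ZMod (3 * k))) := fun f => by
    rw [sum_insert (by simp [hd1, hd2, -Nat.cast_mul]), sum_pair hd3]
  have key := sum_mul_eq_zero_of_characters (S := pmSet (a : ZMod (3 * k)) b c)
    (g := fun v => (g v : ℂ)) (fun v => by exact_mod_cast hg.sum_eq_zero v)
    (R := {0, (k : ZMod (3 * k)), ((2 * k : ℕ) : ZMod (3 * k))}) (c := fun _ => 1) (fun j hj => by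
      obtain ⟨m, hm, hE⟩ := mem_kernelOrders_of_character h hj
      have hz : ∀ x : ℕ, (ZMod.stdAddChar (j * (x : ZMod (3 * k))) : ℂ) =
          (ZMod.stdAddChar j : ℂ) ^ x := fun x => by
        rw [mul_comm j, ← nsmul_eq_mul, AddChar.map_nsmul_eq_pow]
      rw [hsum, mul_zero, hz, hz, AddChar.map_zero_eq_one]
      set E := (ZMod.stdAddChar j : ℂ)
      have hE1 : E ^ k ≠ 1 := fun h1 => hcon m hm ((hE.pow_eq_one_iff_dvd k).1 h1)
      have hE3 : (E ^ k) ^ 3 = 1 := by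
        rw [← pow_mul, hE.pow_eq_one_iff_dvd, mul_comm]; exact hm.1
      have hmul : (E ^ k - 1) * (1 + E ^ k + (E ^ k) ^ 2) = 0 := by linear_combination hE3
      have := (mul_eq_zero.1 hmul).resolve_left (sub_ne_zero.2 hE1)
      linear_combination this) 0
  rw [hsum] at key
  have key' : g (0 + 0) + (g (0 + k) + g (0 + ((2 * k : ℕ) : ZMod (3 * k)))) = 0 := by
    simp only [one_mul] at key
    exact_mod_cast key
  have p1 := hg.parity (0 + 0)
  have p2 := hg.parity (0 + k)
  have p3 := hg.parity (0 + ((2 * k : ℕ) : ZMod (3 * k)))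
  obtain ⟨l, hl⟩ := hk
  omega

/-! ### The three roles as divisibility conditions -/

/-- `a` has order four modulo `m` and `±b`, `±c` cancel. -/
def QuarterRole (m : ℕ) (a b c : ℤ) : Prop :=
  (m : ℤ) ∣ 4 * a ∧ ¬ (m : ℤ) ∣ 2 * a ∧
    ∃ σ : ℤ, (σ = 1 ∨ σ = -1) ∧ (m : ℤ) ∣ 2 * (b - σ * c) ∧ ¬ (m : ℤ) ∣ b - σ * c

/-- Up to signs, `a`, `b`, `c` form a coset of the subgroup of order three modulo `m`. -/
def ThirdRole (m : ℕ) (a b c : ℤ) : Prop :=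
  ∃ σ τ : ℤ, (σ = 1 ∨ σ = -1) ∧ (τ = 1 ∨ τ = -1) ∧ (m : ℤ) ∣ 3 * (a - σ * b) ∧
    (m : ℤ) ∣ 3 * (a - τ * c) ∧ ¬ (m : ℤ) ∣ a - σ * b ∧ ¬ (m : ℤ) ∣ a - τ * c ∧
    ¬ (m : ℤ) ∣ σ * b - τ * c

/-- `a` has order three or six modulo `m`, and `b` and `c` have order dividing ten. -/
def DecagonRole (m : ℕ) (a b c : ℤ) : Prop :=
  (m : ℤ) ∣ 6 * a ∧ ¬ (m : ℤ) ∣ 2 * a ∧ (m : ℤ) ∣ 10 * b ∧ (m : ℤ) ∣ 10 * c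

/-- The pair of E ^ a cancels by itself, so the other two pairs are opposite and E ^ b is minus E ^
c or minus its inverse. -/
theorem quarterRole_of_sq {m : ℕ} {a b c : ℤ} {E : ℂ} (hE : IsPrimitiveRoot E m) (hm : 0 < m)
    (h0 : E ^ a + (E ^ a)⁻¹ + E ^ b + (E ^ b)⁻¹ + E ^ c + (E ^ c)⁻¹ = 0)
    (h : (E ^ a) ^ 2 = -1) : QuarterRole m a b c := by
  have hE0 : E ≠ 0 := hE.ne_zero hm.ne'
  have hne : (-1 : ℂ) ≠ 1 := by norm_num
  refine ⟨?_, ?_, ?_⟩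
  · rw [← hE.zpow_eq_one_iff_dvd, mul_comm, zpow_mul]
    show (E ^ a) ^ (4 : ℕ) = 1
    linear_combination ((E ^ a) ^ 2 - 1) * h
  · rw [← hE.zpow_eq_one_iff_dvd, mul_comm, zpow_mul]
    change ¬ (E ^ a) ^ (2 : ℕ) = 1
    rw [h]; exact hne
  · have hX : E ^ a + (E ^ a)⁻¹ = 0 := by
      have := zpow_ne_zero a hE0
      field_simp
      linear_combination h
    have hY : E ^ b + (E ^ b)⁻¹ + (E ^ c + (E ^ c)⁻¹) = 0 := by linear_combination h0 - hX
    have aux : ∀ x y : ℤ, E ^ x = - E ^ y → (m : ℤ) ∣ 2 * (x - y) ∧ ¬ (m : ℤ) ∣ x - y := by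
      intro x y hxy
      have h1 : E ^ (x - y) = -1 := by
        rw [zpow_sub₀ hE0, hxy, neg_div, div_self (zpow_ne_zero _ hE0)]
      constructor
      · rw [← hE.zpow_eq_one_iff_dvd, mul_comm, zpow_mul, h1]; norm_num
      · rw [← hE.zpow_eq_one_iff_dvd, h1]; exact hne
    rcases inv_add_eq_neg (zpow_ne_zero _ hE0) (zpow_ne_zero _ hE0) hY with h | h
    · exact ⟨1, Or.inl rfl, by simpa using aux b c h⟩
    · rw [← zpow_neg] at h
      exact ⟨-1, Or.inr rfl, by simpa using aux b (-c) h⟩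

/-- Three unit numbers of sum zero differ pairwise by primitive cube roots of unity. -/
theorem thirdRole_of_signedTriangle {m : ℕ} {a b c : ℤ} {E : ℂ} (hE : IsPrimitiveRoot E m)
    (hm : 0 < m) (h : SignedTriangle (E ^ a) (E ^ b) (E ^ c)) : ThirdRole m a b c := by
  have hE0 : E ≠ 0 := hE.ne_zero hm.ne'
  have hn : ∀ x : ℤ, ‖E ^ x‖ = 1 := fun x => by
    rw [norm_zpow, Complex.norm_eq_one_of_pow_eq_one hE.pow_eq_one hm.ne', one_zpow]
  have hsign : ∀ {x : ℤ} {w : ℂ}, (w = E ^ x ∨ w = (E ^ x)⁻¹) →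
      ∃ σ : ℤ, (σ = 1 ∨ σ = -1) ∧ w = E ^ (σ * x) := by
    rintro x w (rfl | rfl)
    · exact ⟨1, Or.inl rfl, by rw [one_mul]⟩
    · exact ⟨-1, Or.inr rfl, by rw [neg_one_mul, zpow_neg]⟩
  obtain ⟨y, z, hy, hz, h⟩ := h
  obtain ⟨σ, hσ, rfl⟩ := hsign hy
  obtain ⟨τ, hτ, rfl⟩ := hsign hz
  have aux : ∀ x y z : ℤ, E ^ x + E ^ y + E ^ z = 0 →
      (m : ℤ) ∣ 3 * (x - y) ∧ ¬ (m : ℤ) ∣ x - y := by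
    intro x y z hxyz
    have hx0 := zpow_ne_zero x hE0
    have hy0 := zpow_ne_zero y hE0
    have h1 := sq_add_mul_add_sq_of_add_eq (hn x) (hn y) (c := -E ^ z) (by rw [norm_neg, hn])
      (by linear_combination hxyz)
    constructor
    · rw [← hE.zpow_eq_one_iff_dvd, mul_comm, zpow_mul, zpow_sub₀ hE0]
      show (E ^ x / E ^ y) ^ (3 : ℕ) = 1
      rw [div_pow, div_eq_one_iff_eq (pow_ne_zero _ hy0)]
      linear_combination (E ^ x - E ^ y) * h1
    · rw [← hE.zpow_eq_one_iff_dvd, zpow_sub₀ hE0, div_eq_one_iff_eq hy0]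
      intro h2
      rw [h2] at h1
      have : 3 * (E ^ y) ^ 2 = 0 := by linear_combination h1
      simp [hy0] at this
  obtain ⟨a1, a2⟩ := aux _ _ _ h
  obtain ⟨b1, b2⟩ := aux a (τ * c) (σ * b) (by linear_combination h)
  obtain ⟨-, c2⟩ := aux (σ * b) (τ * c) a (by linear_combination h)
  exact ⟨σ, τ, hσ, hτ, a1, b1, a2, b2, c2⟩

theorem decagonRole_of_decagonShape {m : ℕ} {a b c : ℤ} {E : ℂ} (hE : IsPrimitiveRoot E m)
    (h : DecagonShape (E ^ a) (E ^ b) (E ^ c)) : DecagonRole m a b c := by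
  obtain ⟨h1, h2, h3⟩ := h
  refine ⟨?_, ?_, ?_, ?_⟩
  · rw [← hE.zpow_eq_one_iff_dvd, mul_comm, zpow_mul]
    show (E ^ a) ^ (6 : ℕ) = 1
    linear_combination ((E ^ a) ^ 2 - 1) * h1
  · rw [← hE.zpow_eq_one_iff_dvd, mul_comm, zpow_mul]
    change ¬ (E ^ a) ^ (2 : ℕ) = 1
    intro h
    have : (3 : ℂ) = 0 := by linear_combination h1 - ((E ^ a) ^ 2 + 2) * h
    norm_num at this
  · rw [← hE.zpow_eq_one_iff_dvd, mul_comm, zpow_mul]; exact h2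
  · rw [← hE.zpow_eq_one_iff_dvd, mul_comm, zpow_mul]; exact h3

/-- For odd m, X would be a primitive cube root of unity, with X + X⁻¹ = -1, and Y, Z fifth roots of
unity. Then Y + Y⁻¹ and Z + Z⁻¹, each equal to 2 or a root of u² + u - 1, would have to sum to 1,
which no choice achieves. -/
theorem even_of_decagonShape {X Y Z : ℂ} {m : ℕ} (hX : X ^ m = 1) (hY : Y ^ m = 1) (hZ : Z ^ m = 1)
    (hX0 : X ≠ 0) (hY0 : Y ≠ 0) (hZ0 : Z ≠ 0)
    (h0 : X + X⁻¹ + Y + Y⁻¹ + Z + Z⁻¹ = 0) (h : DecagonShape X Y Z) : Even m := by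
  by_contra hm
  rw [Nat.not_even_iff_odd] at hm
  obtain ⟨h1, h2, h3⟩ := h
  have aux : ∀ {W : ℂ} (k : ℕ), W ^ m = 1 → W ^ (2 * k) = 1 → W ^ k = 1 := fun {W} k hW h => by
    have h4 : (W ^ k) ^ m = 1 := by rw [← pow_mul, mul_comm, pow_mul, hW, one_pow]
    have h5 : (W ^ k) ^ 2 = 1 := by rw [← pow_mul, mul_comm, h]
    have h6 := pow_gcd_eq_one.2 ⟨h4, h5⟩
    rwa [(Nat.coprime_two_right.2 hm : m.gcd 2 = 1), pow_one] at h6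
  have hX3 := aux 3 hX (by linear_combination (X ^ 2 - 1) * h1)
  have hX1 : X + X⁻¹ = -1 := by
    field_simp
    linear_combination h1 - X * hX3
  have quad : ∀ {W : ℂ}, W ≠ 0 → W ^ 5 = 1 →
      (W + W⁻¹ - 2) * ((W + W⁻¹) ^ 2 + (W + W⁻¹) - 1) = 0 := fun {W} hW h => by
    field_simp
    linear_combination (W - 1) * h
  have hY5 := quad hY0 (aux 5 hY h2)
  have hZ5 := quad hZ0 (aux 5 hZ h3)
  have hsum : Z + Z⁻¹ = 1 - (Y + Y⁻¹) := by linear_combination h0 - hX1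
  rw [hsum] at hZ5
  generalize Y + Y⁻¹ = u at *
  rcases mul_eq_zero.1 hY5 with hu | hu
  · have : u = 2 := by linear_combination hu
    rw [this] at hZ5
    norm_num at hZ5
  · rcases mul_eq_zero.1 hZ5 with hz | hz
    · have : u = -1 := by linear_combination -hz
      rw [this] at hu
      norm_num at hu
    · have : u = 1 / 2 := by linear_combination (hu - hz) / 4
      rw [this] at hu
      norm_num at hu

theorem roles_of_mem_kernelOrders {n : ℕ} (hn : 0 < n) {a b c : ℤ} {m : ℕ}
    (hm : m ∈ kernelOrders n a b c) :
    (QuarterRole m a b c ∨ QuarterRole m b a c ∨ QuarterRole m c a b) ∨ ThirdRole m a b c ∨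
    Even m ∧ (DecagonRole m a b c ∨ DecagonRole m b a c ∨ DecagonRole m c a b) := by
  obtain ⟨hmn, E, hE, h0⟩ := hm
  have hm0 : 0 < m := Nat.pos_of_dvd_of_pos hmn hn
  have hpow : ∀ x : ℤ, (E ^ x) ^ m = 1 := fun x => by
    rw [← zpow_natCast, ← zpow_mul, mul_comm, zpow_mul, zpow_natCast, hE.pow_eq_one, one_zpow]
  have hne : ∀ x : ℤ, E ^ x ≠ 0 := fun x => zpow_ne_zero x (hE.ne_zero hm0.ne')
  rcases classification_sum_add_inv hm0 (hpow a) (hpow b) (hpow c) h0 with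
    (h | h | h) | h | (h | h | h)
  · exact Or.inl (Or.inl (quarterRole_of_sq hE hm0 h0 h))
  · exact Or.inl (Or.inr (Or.inl (quarterRole_of_sq hE hm0 (by linear_combination h0) h)))
  · exact Or.inl (Or.inr (Or.inr (quarterRole_of_sq hE hm0 (by linear_combination h0) h)))
  · exact Or.inr (Or.inl (thirdRole_of_signedTriangle hE hm0 h))
  · exact Or.inr (Or.inr ⟨even_of_decagonShape (hpow a) (hpow b) (hpow c) (hne a) (hne b) (hne c)
      h0 h, Or.inl (decagonRole_of_decagonShape hE h)⟩)
  · exact Or.inr (Or.inr ⟨even_of_decagonShape (hpow b) (hpow a) (hpow c) (hne b) (hne a) (hne c)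
      (by linear_combination h0) h, Or.inr (Or.inl (decagonRole_of_decagonShape hE h))⟩)
  · exact Or.inr (Or.inr ⟨even_of_decagonShape (hpow c) (hpow a) (hpow b) (hne c) (hne a) (hne b)
      (by linear_combination h0) h, Or.inr (Or.inr (decagonRole_of_decagonShape hE h))⟩)

/-! ### Connection sets up to units, order and signs -/

theorem unitMul_pmSet {n : ℕ} (q : (ZMod n)ˣ) (a b c : ZMod n) :
    unitMul q (pmSet a b c) = pmSet ((q : ZMod n) * a) (q * b) (q * c) := by
  simp [unitMul, pmSet, image_insert]

theorem pmSet_swap_left {n : ℕ} (a b c : ZMod n) : pmSet a b c = pmSet b a c := by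
  ext x; simp only [pmSet, mem_insert, mem_singleton]; tauto

theorem pmSet_swap_right {n : ℕ} (a b c : ZMod n) : pmSet a b c = pmSet a c b := by
  ext x; simp only [pmSet, mem_insert, mem_singleton]; tauto

theorem pmSet_neg_right {n : ℕ} (a b c : ZMod n) : pmSet a b (-c) = pmSet a b c := by
  ext x; simp only [pmSet, mem_insert, mem_singleton, neg_neg]; tauto

theorem pmSet_neg_middle {n : ℕ} (a b c : ZMod n) : pmSet a (-b) c = pmSet a b c := by
  rw [pmSet_swap_right, pmSet_neg_right, pmSet_swap_right]

theorem pmSet_neg_left {n : ℕ} (a b c : ZMod n) : pmSet (-a) b c = pmSet a b c := by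
  rw [pmSet_swap_left, pmSet_neg_middle, pmSet_swap_left]

theorem pmSet_congr_sign {n : ℕ} {a b c x y z : ZMod n} (hx : a = x ∨ a = -x)
    (hy : b = y ∨ b = -y) (hz : c = z ∨ c = -z) : pmSet a b c = pmSet x y z := by
  rcases hx with rfl | rfl <;> rcases hy with rfl | rfl <;> rcases hz with rfl | rfl <;>
    simp only [pmSet_neg_left, pmSet_neg_middle, pmSet_neg_right]

theorem intCast_eq_or_eq_neg {n : ℕ} {x y : ℤ} (h : (n : ℤ) ∣ x - y ∨ (n : ℤ) ∣ x + y) :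
    (x : ZMod n) = y ∨ (x : ZMod n) = -y := by
  rcases h with h | h
  · left; rw [eq_comm, ZMod.intCast_eq_intCast_iff_dvd_sub]; exact h
  · right
    rw [eq_comm, ← Int.cast_neg, ZMod.intCast_eq_intCast_iff_dvd_sub, sub_neg_eq_add]; exact h

/-- Reduces an equality of connection sets to integer divisibilities: each generator has to match
its target only up to sign. -/
theorem exists_unitMul_pmSet_eq {n : ℕ} {a b c x y z Q : ℤ} (hQ : IsCoprime (n : ℤ) Q)
    (hx : (n : ℤ) ∣ Q * a - x ∨ (n : ℤ) ∣ Q * a + x)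
    (hy : (n : ℤ) ∣ Q * b - y ∨ (n : ℤ) ∣ Q * b + y)
    (hz : (n : ℤ) ∣ Q * c - z ∨ (n : ℤ) ∣ Q * c + z) :
    ∃ q : (ZMod n)ˣ, unitMul q (pmSet (a : ZMod n) b c) = pmSet (x : ZMod n) y z := by
  obtain ⟨q, hq⟩ := (ZMod.coe_int_isUnit_iff_isCoprime Q n).2 hQ
  refine ⟨q, ?_⟩
  rw [unitMul_pmSet, hq]
  apply pmSet_congr_sign
  · simpa using intCast_eq_or_eq_neg hx
  · simpa using intCast_eq_or_eq_neg hy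
  · simpa using intCast_eq_or_eq_neg hz

theorem isCoprime_of_forall_prime {x y : ℤ}
    (h : ∀ p : ℕ, p.Prime → (p : ℤ) ∣ x → (p : ℤ) ∣ y → False) : IsCoprime x y := by
  rw [Int.isCoprime_iff_gcd_eq_one]
  by_contra hne
  obtain ⟨p, hp, hpd⟩ := Nat.exists_prime_and_dvd hne
  have hpd' : (p : ℤ) ∣ (Int.gcd x y : ℤ) := Int.natCast_dvd_natCast.2 hpd
  exact h p hp (hpd'.trans (Int.gcd_dvd_left _ _)) (hpd'.trans (Int.gcd_dvd_right _ _))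

theorem exists_inverse_of_isCoprime {n x : ℤ} (h : IsCoprime n x) :
    ∃ Q, IsCoprime n Q ∧ n ∣ Q * x - 1 := by
  obtain ⟨u, v, huv⟩ := h
  exact ⟨v, ⟨u, x, by linear_combination huv⟩, ⟨-u, by linear_combination huv⟩⟩

/-- The integers `a`, `b`, `c` generate `ℤ/n`, and `±a`, `±b`, `±c` are distinct modulo `n`. -/
structure IsGenericTriple (n : ℕ) (a b c : ℤ) : Prop where
  gen : ∀ p : ℕ, p.Prime → p ∣ n → (p : ℤ) ∣ a → (p : ℤ) ∣ b → (p : ℤ) ∣ c → False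
  aa : ¬ (n : ℤ) ∣ 2 * a
  bb : ¬ (n : ℤ) ∣ 2 * b
  cc : ¬ (n : ℤ) ∣ 2 * c
  sub_ab : ¬ (n : ℤ) ∣ a - b
  add_ab : ¬ (n : ℤ) ∣ a + b
  sub_ac : ¬ (n : ℤ) ∣ a - c
  add_ac : ¬ (n : ℤ) ∣ a + c
  sub_bc : ¬ (n : ℤ) ∣ b - c
  add_bc : ¬ (n : ℤ) ∣ b + c

namespace IsGenericTriple
variable {n : ℕ} {a b c : ℤ}

theorem swap_left (h : IsGenericTriple n a b c) : IsGenericTriple n b a c where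
  gen p hp hn hb ha hc := h.gen p hp hn ha hb hc
  aa := h.bb
  bb := h.aa
  cc := h.cc
  sub_ab := by rw [dvd_sub_comm]; exact h.sub_ab
  add_ab := by rw [add_comm]; exact h.add_ab
  sub_ac := h.sub_bc
  add_ac := h.add_bc
  sub_bc := h.sub_ac
  add_bc := h.add_ac

theorem swap_right (h : IsGenericTriple n a b c) : IsGenericTriple n a c b where
  gen p hp hn ha hc hb := h.gen p hp hn ha hb hc
  aa := h.aa
  bb := h.cc
  cc := h.bb
  sub_ab := h.sub_ac
  add_ab := h.add_ac
  sub_ac := h.sub_ab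
  add_ac := h.add_ab
  sub_bc := by rw [dvd_sub_comm]; exact h.sub_bc
  add_bc := by rw [add_comm]; exact h.add_bc

theorem neg_right (h : IsGenericTriple n a b c) : IsGenericTriple n a b (-c) where
  gen p hp hn ha hb hc := h.gen p hp hn ha hb (by rwa [dvd_neg] at hc)
  aa := h.aa
  bb := h.bb
  cc := by rw [mul_neg, dvd_neg]; exact h.cc
  sub_ab := h.sub_ab
  add_ab := h.add_ab
  sub_ac := by rw [sub_neg_eq_add]; exact h.add_ac
  add_ac := by rw [← sub_eq_add_neg]; exact h.sub_ac
  sub_bc := by rw [sub_neg_eq_add]; exact h.add_bc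
  add_bc := by rw [← sub_eq_add_neg]; exact h.sub_bc

theorem neg_middle (h : IsGenericTriple n a b c) : IsGenericTriple n a (-b) c :=
  h.swap_right.neg_right.swap_right

end IsGenericTriple

/-! ### Normal forms: from congruences to the lists -/

theorem odd_mul_modEq {n₀ w : ℤ} (hw : ¬ 2 ∣ w) :
    4 * n₀ ∣ w * n₀ - n₀ ∨ 4 * n₀ ∣ w * n₀ + n₀ := by
  rcases (by omega : w % 4 = 1 ∨ w % 4 = 3) with h | h
  · obtain ⟨k, hk⟩ : ∃ k, w = 4 * k + 1 := ⟨w / 4, by omega⟩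
    exact Or.inl ⟨k, by rw [hk]; ring⟩
  · obtain ⟨k, hk⟩ : ∃ k, w = 4 * k - 1 := ⟨w / 4 + 1, by omega⟩
    exact Or.inr ⟨k, by rw [hk]; ring⟩

theorem exists_odd_mul_of_dvd {n₀ : ℕ} {a : ℤ} (h4 : ((4 * n₀ : ℕ) : ℤ) ∣ 4 * a)
    (h2 : ¬ ((4 * n₀ : ℕ) : ℤ) ∣ 2 * a) : ∃ t, a = t * n₀ ∧ ¬ 2 ∣ t := by
  push_cast at h4 h2
  obtain ⟨t, ht⟩ : (n₀ : ℤ) ∣ a := Int.dvd_of_mul_dvd_mul_left (by norm_num) h4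
  refine ⟨t, by rw [ht]; ring, fun ⟨s, hs⟩ => h2 ⟨s, by rw [ht, hs]; ring⟩⟩

/-- Distinctness makes `a` an odd multiple of n₀ and b - c an odd multiple of 2n₀, and then
generation makes `b` coprime to n₀. If `b` is odd it is a unit, and dividing by it gives the first
set. If `b` is even then n₀ is odd, and dividing by half of whichever of `b`, `c` is 2 modulo 4
gives the second. -/
theorem inFirstList_of_odd_double {n₀ : ℕ} (hn₀ : 2 ≤ n₀) {a b c : ℤ}
    (hG : IsGenericTriple (4 * n₀) a b c) (ha : ((4 * n₀ : ℕ) : ℤ) ∣ 4 * a)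
    (hbc : ((4 * n₀ : ℕ) : ℤ) ∣ 2 * (b - c)) :
    InFirstList (4 * n₀) (pmSet (a : ZMod (4 * n₀)) b c) := by
  obtain ⟨t, rfl, ht⟩ := exists_odd_mul_of_dvd ha hG.aa
  have hs : ∃ s, b - c = 2 * n₀ * s ∧ ¬ 2 ∣ s := by
    obtain ⟨s, hs⟩ := hbc
    push_cast at hs
    refine ⟨s, by linarith, fun ⟨k, hk⟩ => hG.sub_bc ⟨k, ?_⟩⟩
    push_cast
    rw [hk] at hs
    linarith
  obtain ⟨s, hs, hs2⟩ := hs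
  have hprime : ∀ p : ℕ, p.Prime → (p : ℤ) ∣ n₀ → (p : ℤ) ∣ b → False := fun p hp hpn hpb =>
    hG.gen p hp ((Int.natCast_dvd_natCast.1 hpn).mul_left 4) (hpn.mul_left t) hpb (by
      have : c = b - 2 * n₀ * s := by linarith
      rw [this]
      exact dvd_sub hpb ((hpn.mul_left 2).mul_right s))
  refine ⟨n₀, hn₀, rfl, ?_⟩
  have hcast : ((4 * n₀ : ℕ) : ℤ) = 4 * n₀ := by push_cast; ring
  by_cases hb : (2 : ℤ) ∣ b
  · right; left
    have hn₀odd : ¬ (2 : ℤ) ∣ n₀ := fun h => hprime 2 Nat.prime_two h hb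
    have main : ∀ b c s : ℤ, b - c = 2 * n₀ * s → ¬ 2 ∣ s → b % 4 = 2 →
        (∀ p : ℕ, p.Prime → (p : ℤ) ∣ n₀ → (p : ℤ) ∣ b → False) →
        ∃ q, unitMul q (pmSet ((t * n₀ : ℤ) : ZMod (4 * n₀)) b c) =
          pmSet 2 (n₀ : ZMod (4 * n₀)) (2 * n₀ - 2) := by
      intro b c s hs hs2 hb4 hprime
      obtain ⟨u, rfl⟩ : (2 : ℤ) ∣ b := by omega
      have hcop : IsCoprime (4 * n₀ : ℤ) u := isCoprime_of_forall_prime fun p hp h1 h2 => by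
        rcases (Nat.prime_iff_prime_int.1 hp).dvd_mul.1 h1 with h | h
        · have : p = 2 := by
            have : p ∣ 2 ^ 2 := by exact_mod_cast h
            exact (Nat.prime_dvd_prime_iff_eq hp Nat.prime_two).1 (hp.dvd_of_dvd_pow this)
          subst this
          push_cast at h2
          omega
        · exact hprime p hp h (h2.mul_left 2)
      obtain ⟨Q, hQ, k, hk⟩ := exists_inverse_of_isCoprime hcop
      have hQodd : ¬ 2 ∣ Q := by
        rintro ⟨l, rfl⟩
        have : 2 * (l * u) - 4 * (n₀ * k) = 1 := by linarith
        omega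
      have := exists_unitMul_pmSet_eq (n := 4 * n₀) (a := t * n₀) (b := 2 * u) (c := c)
        (x := n₀) (y := 2) (z := 2 * n₀ - 2) (by rw [hcast]; exact hQ) (Q := Q)
        (by rw [hcast, ← mul_assoc]
            exact odd_mul_modEq (fun h => (Int.prime_two.dvd_mul.1 h).elim hQodd ht))
        (by left; rw [hcast]; exact ⟨2 * k, by linarith⟩)
        (by
          right; rw [hcast]
          obtain ⟨e, he⟩ : ∃ e, Q * s = 2 * e + 1 := by
            have : ¬ 2 ∣ Q * s := fun h => (Int.prime_two.dvd_mul.1 h).elim hQodd hs2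
            exact ⟨Q * s / 2, by omega⟩
          have hc : c = 2 * u - 2 * n₀ * s := by linarith
          refine ⟨2 * k - e, ?_⟩
          rw [hc]
          linear_combination 2 * hk - 2 * n₀ * he)
      simpa [pmSet_swap_left (2 : ZMod (4 * n₀))] using this
    by_cases hb4 : b % 4 = 2
    · exact main b c s hs hs2 hb4 hprime
    -- As n₀ * s is odd, b - c is 2 modulo 4, so `c` is 2 modulo 4 when `b` is not.
    · rw [pmSet_swap_right]
      refine main c b (-s) (by linarith) (by omega) ?_ fun p hp hpn hpc => hprime p hp hpn ?_
      · have : ¬ 2 ∣ n₀ * s := fun h => (Int.prime_two.dvd_mul.1 h).elim hn₀odd hs2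
        have h2 : b - c = 2 * (n₀ * s) := by linarith
        omega
      · have : b = c + 2 * n₀ * s := by linarith
        rw [this]
        exact dvd_add hpc ((hpn.mul_left 2).mul_right s)
  · left
    have hcop : IsCoprime (4 * n₀ : ℤ) b := isCoprime_of_forall_prime fun p hp h1 h2 => by
      rcases (Nat.prime_iff_prime_int.1 hp).dvd_mul.1 h1 with h | h
      · have : p = 2 := by
          have : p ∣ 2 ^ 2 := by exact_mod_cast h
          exact (Nat.prime_dvd_prime_iff_eq hp Nat.prime_two).1 (hp.dvd_of_dvd_pow this)
        subst this
        exact hb h2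
      · exact hprime p hp h h2
    obtain ⟨Q, hQ, k, hk⟩ := exists_inverse_of_isCoprime hcop
    have hQodd : ¬ 2 ∣ Q := by
      rintro ⟨l, rfl⟩
      have : 2 * (l * b) - 4 * (n₀ * k) = 1 := by linarith
      omega
    have := exists_unitMul_pmSet_eq (n := 4 * n₀) (a := t * n₀) (b := b) (c := c)
      (x := n₀) (y := 1) (z := 2 * n₀ - 1) (by rw [hcast]; exact hQ) (Q := Q)
      (by rw [hcast, ← mul_assoc]
          exact odd_mul_modEq (fun h => (Int.prime_two.dvd_mul.1 h).elim hQodd ht))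
      (by left; rw [hcast]; exact ⟨k, by linarith⟩)
      (by
        right; rw [hcast]
        obtain ⟨e, he⟩ : ∃ e, Q * s = 2 * e + 1 := by
          have : ¬ 2 ∣ Q * s := fun h => (Int.prime_two.dvd_mul.1 h).elim hQodd hs2
          exact ⟨Q * s / 2, by omega⟩
        have hc : c = b - 2 * n₀ * s := by linarith
        refine ⟨k - e, ?_⟩
        rw [hc]
        linear_combination hk - 2 * n₀ * he)
    simpa [pmSet_swap_left (1 : ZMod (4 * n₀))] using this

theorem prime_dvd_four {p : ℕ} (hp : p.Prime) (h : (p : ℤ) ∣ 4) : p = 2 := by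
  have : p ∣ 2 ^ 2 := by exact_mod_cast h
  exact (Nat.prime_dvd_prime_iff_eq hp Nat.prime_two).1 (hp.dvd_of_dvd_pow this)

/-- Half of `b` is a unit modulo n. Multiplying by its inverse Q sends `b` to 2 and `a` to ±n₀,
while the conditions on `c` become the system defining c', solved by the residue of Qc. -/
theorem inFirstList_of_even {d d' : ℕ} (hd : 1 < d) (hdd : d < d') (hod : Odd d) (hod' : Odd d')
    (hcop : d.Coprime d') {a b c : ℤ} (hG : IsGenericTriple (4 * (d * d')) a b c)
    (ha : ((4 * (d * d') : ℕ) : ℤ) ∣ 4 * a) (hb : b % 4 = 2) (hc : c % 4 = 0)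
    (h1 : (d : ℤ) ∣ b - c) (h2 : (d' : ℤ) ∣ b + c) :
    InFirstList (4 * (d * d')) (pmSet (a : ZMod (4 * (d * d'))) b c) := by
  obtain ⟨t, rfl, ht⟩ := exists_odd_mul_of_dvd ha hG.aa
  obtain ⟨u, rfl⟩ : (2 : ℤ) ∣ b := by omega
  have hcast : ((4 * (d * d') : ℕ) : ℤ) = 4 * (d * d') := by push_cast; ring
  have hu : IsCoprime (4 * (d * d') : ℤ) u := isCoprime_of_forall_prime fun p hp k1 k2 => by
    rcases (Nat.prime_iff_prime_int.1 hp).dvd_mul.1 k1 with h | h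
    · have := prime_dvd_four hp h
      subst this
      push_cast at k2
      omega
    · refine hG.gen p hp (by zify; exact h.mul_left 4) (by push_cast; exact h.mul_left t)
        (k2.mul_left 2) ?_
      rcases (Nat.prime_iff_prime_int.1 hp).dvd_mul.1 h with h | h
      · have := dvd_sub (k2.mul_left 2) (h.trans h1); rwa [sub_sub_cancel] at this
      · have := dvd_sub (h.trans h2) (k2.mul_left 2); rwa [add_sub_cancel_left] at this
  obtain ⟨Q, hQ, k, hk⟩ := exists_inverse_of_isCoprime hu
  have hQodd : ¬ 2 ∣ Q := by
    rintro ⟨l, rfl⟩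
    have : 2 * (l * u) - 4 * (d * d' * k) = 1 := by linarith
    omega
  have hd' : 0 < d' := by omega
  have hpos : (0 : ℤ) < 4 * (d * d') := by positivity
  obtain ⟨c', hc', hc'n⟩ : ∃ c' : ℕ, (4 * (d * d') : ℤ) ∣ Q * c - c' ∧ (c' : ℤ) < 4 * (d * d') := by
    refine ⟨(Q * c % (4 * (d * d'))).toNat, ?_, ?_⟩
    · rw [Int.toNat_of_nonneg (Int.emod_nonneg _ hpos.ne')]
      exact Int.dvd_self_sub_emod
    · rw [Int.toNat_of_nonneg (Int.emod_nonneg _ hpos.ne')]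
      exact Int.emod_lt_of_pos _ hpos
  have e4 : (4 : ℤ) ∣ c' := by
    have := dvd_sub ((by omega : (4 : ℤ) ∣ c).mul_left Q) ((dvd_mul_right 4 _).trans hc')
    rwa [sub_sub_cancel] at this
  have ed : (d : ℤ) ∣ 2 - c' := by
    have hd1 : (d : ℤ) ∣ Q * c - c' := (Dvd.intro (4 * d' : ℤ) (by ring)).trans hc'
    have : (2 : ℤ) - c' = (Q * c - c') + Q * (2 * u - c) - d * (8 * d' * k) := by
      linear_combination -2 * hk
    rw [this]
    exact dvd_sub (dvd_add hd1 (h1.mul_left Q)) (dvd_mul_right _ _)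
  have ed' : (d' : ℤ) ∣ -2 - c' := by
    have hd1 : (d' : ℤ) ∣ Q * c - c' := (Dvd.intro (4 * d : ℤ) (by ring)).trans hc'
    have : (-2 : ℤ) - c' = (Q * c - c') - Q * (2 * u + c) + d' * (8 * d * k) := by
      linear_combination 2 * hk
    rw [this]
    exact dvd_add (dvd_sub hd1 (h2.mul_left Q)) (dvd_mul_right _ _)
  refine ⟨d * d', by nlinarith, rfl, Or.inr (Or.inr (Or.inl ⟨d, d', rfl, hod, hod', hcop, hd, hdd,
    by nlinarith, c', ⟨?_, by zify; exact hc'n, ?_, ?_, ?_⟩, ?_⟩))⟩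
  -- The residue is nonzero because the odd number d > 1 does not divide 2.
  · rcases Nat.eq_zero_or_pos c' with h0 | h0
    · exfalso
      subst h0
      have : (d : ℤ) ∣ 2 := by simpa using ed
      have h' : d ∣ 2 := by exact_mod_cast this
      have := Nat.le_of_dvd (by norm_num) h'
      obtain ⟨l, hl⟩ := hod
      omega
    · omega
  · exact (Int.modEq_zero_iff_dvd).2 e4
  · exact Int.modEq_iff_dvd.2 ed
  · exact Int.modEq_iff_dvd.2 ed'
  · have := exists_unitMul_pmSet_eq (n := 4 * (d * d')) (a := t * (d * d' : ℕ)) (b := 2 * u)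
      (c := c) (x := (d * d' : ℕ)) (y := 2) (z := c') (Q := Q) (by rw [hcast]; exact hQ)
      (by
        have := odd_mul_modEq (n₀ := (d * d' : ℕ)) (w := Q * t)
          (fun h => (Int.prime_two.dvd_mul.1 h).elim hQodd ht)
        rw [mul_assoc] at this
        push_cast at this ⊢
        exact this)
      (by left; rw [hcast]; exact ⟨2 * k, by linear_combination 2 * hk⟩)
      (by left; rw [hcast]; exact hc')
    rw [pmSet_swap_left (2 : ZMod (4 * (d * d')))]
    simpa using this

theorem exists_nat_residue {n : ℕ} (hn : 0 < n) (x : ℤ) :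
    ∃ r : ℕ, (n : ℤ) ∣ x - r ∧ r < n := by
  have hpos : (0 : ℤ) < n := by exact_mod_cast hn
  refine ⟨(x % n).toNat, ?_, ?_⟩
  · rw [Int.toNat_of_nonneg (Int.emod_nonneg _ hpos.ne')]
    exact Int.dvd_self_sub_emod
  · zify
    rw [Int.toNat_of_nonneg (Int.emod_nonneg _ hpos.ne')]
    exact Int.emod_lt_of_pos _ hpos

theorem exists_congruent_to_both {M d R t : ℤ} (h : IsCoprime M d) :
    ∃ Q, M ∣ Q - R ∧ d ∣ Q - t := by
  obtain ⟨u, v, huv⟩ := h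
  exact ⟨R * (v * d) + t * (u * M), ⟨u * (t - R), by linear_combination R * huv⟩,
    ⟨v * (R - t), by linear_combination t * huv⟩⟩

theorem one_lt_of_odd_of_dvd {x d : ℕ} (hx : ¬ (2 : ℤ) ∣ x) (hd : 1 < d) (h : (d : ℤ) ∣ x) :
    1 < x := by
  have h' : d ∣ x := by exact_mod_cast h
  have : x ≠ 0 := by rintro rfl; exact hx (by simp)
  exact lt_of_lt_of_le hd (Nat.le_of_dvd (by omega) h')

/-- Write a = d a'. Sending `a` to d only prescribes the multiplier Q modulo M = n / d, as the
inverse of a'. Its residue modulo d stays free, and since `b` is a unit modulo d, this freedom moves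
`b` to any admissible residue coprime to d, in particular to the least one. This is why b' is
defined by a minimality condition. -/
theorem inFirstList_of_odd {d d' d'' : ℕ} (hd : 0 < d) (hd' : 1 < d') (hdd : d < d')
    (hdd' : d' < d'') (hod : Odd d) (hod' : Odd d') (hod'' : Odd d'') (hc1 : d.Coprime d')
    (hc2 : d.Coprime d'') (hc3 : d'.Coprime d'') {a b c : ℤ}
    (hG : IsGenericTriple (4 * (d * d' * d'')) a b c) (ha2 : ¬ 2 ∣ a) (hab : 4 ∣ b - a)
    (hac : 4 ∣ c - a) (h1 : (d : ℤ) ∣ a) (h1' : (d : ℤ) ∣ b + c) (h2 : (d' : ℤ) ∣ b)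
    (h2' : (d' : ℤ) ∣ a + c) (h3 : (d'' : ℤ) ∣ c) (h3' : (d'' : ℤ) ∣ a + b) :
    InFirstList (4 * (d * d' * d'')) (pmSet (a : ZMod (4 * (d * d' * d''))) b c) := by
  obtain ⟨a', rfl⟩ := h1
  have hd'' : 0 < d'' := by omega
  have hnpos : 0 < 4 * (d * d' * d'') := by positivity
  have hodd : ∀ {x : ℕ}, Odd x → ¬ (2 : ℤ) ∣ x := fun h => by
    have h := h.not_two_dvd_nat; exact_mod_cast h
  have a'2 : ¬ 2 ∣ a' := fun h => ha2 (h.mul_left _)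
  set M : ℤ := 4 * (d' * d'') with hM
  have hcast : ((4 * (d * d' * d'') : ℕ) : ℤ) = M * d := by push_cast; ring
  have hpM : ∀ p : ℕ, p.Prime → (p : ℤ) ∣ M → p = 2 ∨ (p : ℤ) ∣ d' ∨ (p : ℤ) ∣ d'' :=
    fun p hp h => by
      rcases (Nat.prime_iff_prime_int.1 hp).dvd_mul.1 h with h | h
      · exact Or.inl (prime_dvd_four hp h)
      · exact Or.inr ((Nat.prime_iff_prime_int.1 hp).dvd_mul.1 h)
  have hpn : ∀ p : ℕ, ((p : ℤ) ∣ d ∨ (p : ℤ) ∣ d' ∨ (p : ℤ) ∣ d'') → p ∣ 4 * (d * d' * d'') :=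
    fun p h => by
      zify
      rcases h with h | h | h
      · exact h.trans ⟨4 * d' * d'', by ring⟩
      · exact h.trans ⟨4 * d * d'', by ring⟩
      · exact h.trans ⟨4 * d * d', by ring⟩
  have hMa : IsCoprime M a' := isCoprime_of_forall_prime fun p hp k1 k2 => by
    rcases hpM p hp k1 with rfl | h | h
    · exact a'2 (by exact_mod_cast k2)
    · exact hG.gen p hp (hpn p (Or.inr (Or.inl h))) (k2.mul_left _) (h.trans h2)
        ((dvd_add_right (k2.mul_left _)).1 (h.trans h2'))
    · exact hG.gen p hp (hpn p (Or.inr (Or.inr h))) (k2.mul_left _)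
        ((dvd_add_right (k2.mul_left _)).1 (h.trans h3')) (h.trans h3)
  have hbd : IsCoprime (d : ℤ) b := isCoprime_of_forall_prime fun p hp k1 k2 =>
    hG.gen p hp (hpn p (Or.inl k1)) (k1.mul_right _) k2 ((dvd_add_right k2).1 (k1.trans h1'))
  have hMd : IsCoprime M d := isCoprime_of_forall_prime fun p hp k1 k2 => by
    have k2' : p ∣ d := by exact_mod_cast k2
    rcases hpM p hp k1 with rfl | h | h
    · exact hodd hod k2
    · exact hp.one_lt.ne' (Nat.eq_one_of_dvd_coprimes hc1 k2' (by exact_mod_cast h))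
    · exact hp.one_lt.ne' (Nat.eq_one_of_dvd_coprimes hc2 k2' (by exact_mod_cast h))
  obtain ⟨R, hMR, hR⟩ := exists_inverse_of_isCoprime hMa
  have M4 : (4 : ℤ) ∣ M := ⟨_, rfl⟩
  have Md' : (d' : ℤ) ∣ M := ⟨4 * d'', by rw [hM]; ring⟩
  have Md'' : (d'' : ℤ) ∣ M := ⟨4 * d', by rw [hM]; ring⟩
  have hQa : ∀ Q, M ∣ Q - R → M ∣ Q * a' - 1 := fun Q hQ => by
    have : Q * a' - 1 = (Q - R) * a' + (R * a' - 1) := by ring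
    rw [this]; exact dvd_add (hQ.mul_right _) hR
  have hQa' : ∀ Q, M ∣ Q - R → M * d ∣ Q * (d * a') - d := fun Q hQ => by
    obtain ⟨k, hk⟩ := hQa Q hQ
    exact ⟨k, by linear_combination (d : ℤ) * hk⟩
  have hQ4 : ∀ Q x, M ∣ Q - R → 4 ∣ x - d * a' → 4 ∣ Q * x - d := fun Q x hQ hx => by
    have : Q * x - d = Q * (x - d * a') + (Q * (d * a') - d) := by ring
    rw [this]
    exact dvd_add (hx.mul_left _) ((M4.mul_right _).trans (hQa' Q hQ))
  have hQneg : ∀ Q x (e : ℤ), M ∣ Q - R → e ∣ M → e ∣ d * a' + x → e ∣ Q * x + d :=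
    fun Q x e hQ he hx => by
      have : Q * x + d = Q * (d * a' + x) - (Q * (d * a') - d) := by ring
      rw [this]
      exact dvd_sub (hx.mul_left _) ((he.mul_right _).trans (hQa' Q hQ))
  -- For odd d one has 2d ≡ 2 modulo 4, so d and 2 - d agree there.
  have d4 : ∀ x : ℤ, 4 ∣ x - d ↔ x ≡ 2 - d [ZMOD 4] := fun x => by
    have := hodd hod
    rw [Int.modEq_iff_dvd]
    constructor <;> intro h <;> omega
  have hleft : ∀ x : ℕ, x < 4 * (d * d' * d'') → (4 : ℤ) ∣ x - d → (d' : ℤ) ∣ x →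
      (d'' : ℤ) ∣ x + d → SolvesLeftSystem (4 * (d * d' * d'')) d d' d'' x :=
    fun x hx x4 xd' xd'' => by
      have := hodd hod
      refine ⟨one_lt_of_odd_of_dvd (by omega) hd' xd', hx, (d4 x).1 x4,
        Int.modEq_zero_iff_dvd.2 xd', Int.modEq_iff_dvd.2 ?_⟩
      rw [← neg_add', dvd_neg, add_comm]; exact xd''
  -- With Q ≡ 1 modulo d, the residue of Qb is admissible: it agrees with `b` modulo d, hence is
  -- coprime to d.
  have hne : {x : ℕ | SolvesLeftSystem (4 * (d * d' * d'')) d d' d'' x ∧ x.Coprime d}.Nonempty := by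
    obtain ⟨Q, hQ, hQd⟩ := exists_congruent_to_both (R := R) (t := 1) hMd
    obtain ⟨x, hx, hxn⟩ := exists_nat_residue hnpos (Q * b)
    rw [hcast] at hx
    have aux : ∀ e y : ℤ, e ∣ M → e ∣ Q * b - y → e ∣ (x : ℤ) - y := fun e y he hy => by
      have : (x : ℤ) - y = (Q * b - y) - (Q * b - x) := by ring
      rw [this]; exact dvd_sub hy ((he.mul_right _).trans hx)
    refine ⟨x, hleft x hxn (aux 4 d M4 (hQ4 Q b hQ hab)) ?_ ?_, ?_⟩
    · simpa using aux d' 0 Md' (by simpa using h2.mul_left Q)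
    · simpa using aux d'' (-d) Md'' (by simpa using hQneg Q b d'' hQ Md'' h3')
    · have : IsCoprime (x : ℤ) d := isCoprime_of_forall_prime fun p hp k1 k2 => by
        have e1 : (p : ℤ) ∣ Q * b := by
          have := dvd_add (k2.trans ((dvd_mul_left _ M).trans hx)) k1
          rwa [sub_add_cancel] at this
        have e2 : (p : ℤ) ∣ b := by
          have : b = Q * b - (Q - 1) * b := by ring
          rw [this]; exact dvd_sub e1 ((k2.trans hQd).mul_right _)
        exact hG.gen p hp (hpn p (Or.inl k2)) (k2.mul_right _) e2
          ((dvd_add_right e2).1 (k2.trans h1'))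
      exact Nat.isCoprime_iff_coprime.1 this
  obtain ⟨b', hb'⟩ : ∃ b', IsLeast
      {x : ℕ | SolvesLeftSystem (4 * (d * d' * d'')) d d' d'' x ∧ x.Coprime d} b' :=
    ⟨_, Nat.sInf_mem hne, fun _ h => Nat.sInf_le h⟩
  obtain ⟨⟨⟨hb'1, hb'n, hb'4, hb'd', hb'd''⟩, hb'd⟩, -⟩ := id hb'
  -- The final multiplier: Q is b' times the inverse of `b` modulo d, so that Qb hits the least
  -- solution b'.
  obtain ⟨v, hv, hvb⟩ := exists_inverse_of_isCoprime hbd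
  obtain ⟨Q, hQ, hQd⟩ := exists_congruent_to_both (R := R) (t := b' * v) hMd
  have hQb : (d : ℤ) ∣ Q * b - b' := by
    have : Q * b - b' = (Q - b' * v) * b + b' * (v * b - 1) := by ring
    rw [this]; exact dvd_add (hQd.mul_right _) (hvb.mul_left _)
  have hQn : IsCoprime (M * d) Q := isCoprime_of_forall_prime fun p hp k1 k2 => by
    rcases (Nat.prime_iff_prime_int.1 hp).dvd_mul.1 k1 with h | h
    · have e : (p : ℤ) ∣ R := by
        have := dvd_sub k2 (h.trans hQ); rwa [sub_sub_cancel] at this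
      exact (Nat.prime_iff_prime_int.1 hp).not_isUnit (hMR.isUnit_of_dvd' h e)
    · have e : (p : ℤ) ∣ b' := by
        have := dvd_sub (k2.mul_right b) (h.trans hQb); rwa [sub_sub_cancel] at this
      exact (Nat.prime_iff_prime_int.1 hp).not_isUnit
        ((Nat.isCoprime_iff_coprime.2 hb'd).isUnit_of_dvd' e h)
  have hQbn : M * d ∣ Q * b - b' := by
    refine hMd.mul_dvd ?_ hQb
    have c1 : IsCoprime (4 : ℤ) (d' * d'') := isCoprime_of_forall_prime fun p hp k1 k2 => by
      have := prime_dvd_four hp k1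
      subst this
      rcases (Nat.prime_iff_prime_int.1 hp).dvd_mul.1 k2 with h | h
      · exact hodd hod' h
      · exact hodd hod'' h
    refine c1.mul_dvd ?_ ((Nat.isCoprime_iff_coprime.2 hc3).mul_dvd ?_ ?_)
    · have := dvd_sub (hQ4 Q b hQ hab) ((d4 b').2 hb'4); rwa [sub_sub_sub_cancel_right] at this
    · exact dvd_sub (h2.mul_left _) (Int.modEq_zero_iff_dvd.1 hb'd')
    · have := dvd_add (hQneg Q b d'' hQ Md'' h3') (Int.modEq_iff_dvd.1 hb'd'')
      have e : Q * b + d + (-d - b') = Q * b - b' := by ring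
      rwa [e] at this
  obtain ⟨c', hc', hc'n⟩ := exists_nat_residue hnpos (Q * c)
  rw [hcast] at hc'
  have aux : ∀ e y : ℤ, e ∣ M * d → e ∣ Q * c - y → e ∣ (c' : ℤ) - y := fun e y he hy => by
    have : (c' : ℤ) - y = (Q * c - y) - (Q * c - c') := by ring
    rw [this]; exact dvd_sub hy (he.trans hc')
  have e4 := aux 4 d (M4.mul_right _) (hQ4 Q c hQ hac)
  have ed'' : (d'' : ℤ) ∣ c' := by
    simpa using aux d'' 0 (Md''.mul_right _) (by simpa using h3.mul_left Q)
  have ed' : (d' : ℤ) ∣ -d - c' := by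
    rw [dvd_sub_comm]
    exact aux d' (-d) (Md'.mul_right _) (by simpa using hQneg Q c d' hQ Md' h2')
  have ed : (d : ℤ) ∣ -b' - c' := by
    rw [dvd_sub_comm]
    refine aux d (-b') (dvd_mul_left _ _) ?_
    have : Q * c - -b' = Q * (b + c) - (Q * b - b') := by ring
    rw [this]; exact dvd_sub (h1'.mul_left _) hQb
  have hn0 : d'' < d * d' * d'' := by
    have : 1 < d * d' := by nlinarith
    nlinarith
  refine ⟨d * d' * d'', by omega, rfl, Or.inr (Or.inr (Or.inr ⟨d, d', d'', rfl, hod, hod', hod'',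
    hc1, hc2, hc3, hd, hdd, hdd', hn0, b', c', hb', ⟨?_, hc'n, (d4 c').1 e4,
      Int.modEq_iff_dvd.2 ed, Int.modEq_iff_dvd.2 ed', Int.modEq_zero_iff_dvd.2 ed''⟩, ?_⟩))⟩
  · have := hodd hod
    exact one_lt_of_odd_of_dvd (by omega) (by omega) ed''
  · have := exists_unitMul_pmSet_eq (n := 4 * (d * d' * d'')) (a := d * a') (b := b)
      (c := c) (x := d) (y := b') (z := c') (Q := Q) (by rw [hcast]; exact hQn)
      (by left; rw [hcast]; exact hQa' Q hQ) (by left; rw [hcast]; exact hQbn)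
      (by left; rw [hcast]; exact hc')
    simpa using this

/-- The three generators lie in one coset of the subgroup of order three. If 3 ∤ a, generation makes
`a` a unit; normalising it to 1 leaves 1 + n₀ and 1 - n₀ for the others, in some order. -/
theorem inSecondList_of_cosets {n₀ : ℕ} (hn₀ : 3 ≤ n₀) {a b c : ℤ}
    (hG : IsGenericTriple (3 * n₀) a b c) (hab : ((3 * n₀ : ℕ) : ℤ) ∣ 3 * (a - b))
    (hac : ((3 * n₀ : ℕ) : ℤ) ∣ 3 * (a - c)) :
    InSecondList (3 * n₀) (pmSet (a : ZMod (3 * n₀)) b c) := by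
  have hcast : ((3 * n₀ : ℕ) : ℤ) = 3 * n₀ := by push_cast; ring
  have main : ∀ a b c : ℤ, IsGenericTriple (3 * n₀) a b c → (n₀ : ℤ) ∣ a - b → (n₀ : ℤ) ∣ a - c →
      ¬ (3 : ℤ) ∣ a → InSecondList (3 * n₀) (pmSet (a : ZMod (3 * n₀)) b c) := by
    intro a b c hG hab hac ha
    obtain ⟨s, hs⟩ := hab
    obtain ⟨t, ht⟩ := hac
    have hs3 : ¬ 3 ∣ s := fun ⟨k, hk⟩ => hG.sub_ab ⟨k, by rw [hs, hcast, hk]; ring⟩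
    have ht3 : ¬ 3 ∣ t := fun ⟨k, hk⟩ => hG.sub_ac ⟨k, by rw [ht, hcast, hk]; ring⟩
    have hst3 : ¬ 3 ∣ t - s := fun ⟨k, hk⟩ => hG.sub_bc ⟨k, by
      have : b - c = (a - c) - (a - b) := by ring
      rw [this, hs, ht, hcast]; linear_combination n₀ * hk⟩
    have hcop : IsCoprime (3 * n₀ : ℤ) a := isCoprime_of_forall_prime fun p hp k1 k2 => by
      rcases (Nat.prime_iff_prime_int.1 hp).dvd_mul.1 k1 with h | h
      · have : p = 3 := (Nat.prime_dvd_prime_iff_eq hp Nat.prime_three).1 (by exact_mod_cast h)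
        subst this
        exact ha k2
      · refine hG.gen p hp ((Int.natCast_dvd_natCast.1 h).mul_left 3) k2 ?_ ?_
        · have : b = a - n₀ * s := by linarith
          rw [this]; exact dvd_sub k2 (h.mul_right _)
        · have : c = a - n₀ * t := by linarith
          rw [this]; exact dvd_sub k2 (h.mul_right _)
    obtain ⟨Q, hQ, k, hk⟩ := exists_inverse_of_isCoprime hcop
    have hQ3 : ¬ 3 ∣ Q := by
      rintro ⟨l, rfl⟩
      have : 3 * (l * a) - 3 * (n₀ * k) = 1 := by linarith
      omega
    have hb : Q * b = 1 + 3 * n₀ * k - n₀ * (Q * s) := by linear_combination hk - Q * hs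
    have hc : Q * c = 1 + 3 * n₀ * k - n₀ * (Q * t) := by linear_combination hk - Q * ht
    have hp3 : ∀ x y : ℤ, ¬ 3 ∣ x → ¬ 3 ∣ y → ¬ 3 ∣ x * y := fun x y hx hy h =>
      (Int.prime_three.dvd_mul.1 h).elim hx hy
    have e1 := hp3 Q s hQ3 hs3
    have e2 := hp3 Q t hQ3 ht3
    have e3 : ¬ 3 ∣ Q * t - Q * s := by rw [← mul_sub]; exact hp3 _ _ hQ3 hst3
    refine ⟨n₀, hn₀, rfl, Or.inl ?_⟩
    rcases (by omega : Q * s % 3 = 1 ∧ Q * t % 3 = 2 ∨ Q * s % 3 = 2 ∧ Q * t % 3 = 1) with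
      ⟨f1, f2⟩ | ⟨f1, f2⟩
    · obtain ⟨u, hu⟩ : ∃ u, Q * s = 3 * u + 1 := ⟨Q * s / 3, by omega⟩
      obtain ⟨w, hw⟩ : ∃ w, Q * t = 3 * w - 1 := ⟨Q * t / 3 + 1, by omega⟩
      have := exists_unitMul_pmSet_eq (n := 3 * n₀) (a := a) (b := b) (c := c)
        (x := 1) (y := n₀ - 1) (z := n₀ + 1) (Q := Q) (by rw [hcast]; exact hQ)
        (by left; rw [hcast]; exact ⟨k, hk⟩)
        (by right; rw [hcast, hb, hu]; exact ⟨k - u, by ring⟩)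
        (by left; rw [hcast, hc, hw]; exact ⟨k - w, by ring⟩)
      simpa using this
    · obtain ⟨u, hu⟩ : ∃ u, Q * t = 3 * u + 1 := ⟨Q * t / 3, by omega⟩
      obtain ⟨w, hw⟩ : ∃ w, Q * s = 3 * w - 1 := ⟨Q * s / 3 + 1, by omega⟩
      have := exists_unitMul_pmSet_eq (n := 3 * n₀) (a := a) (b := c) (c := b)
        (x := 1) (y := n₀ - 1) (z := n₀ + 1) (Q := Q) (by rw [hcast]; exact hQ)
        (by left; rw [hcast]; exact ⟨k, hk⟩)
        (by right; rw [hcast, hc, hu]; exact ⟨k - u, by ring⟩)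
        (by left; rw [hcast, hb, hw]; exact ⟨k - w, by ring⟩)
      rw [pmSet_swap_right]
      simpa using this
  rw [hcast] at hab hac
  have hab' : (n₀ : ℤ) ∣ a - b := Int.dvd_of_mul_dvd_mul_left (by norm_num) hab
  have hac' : (n₀ : ℤ) ∣ a - c := Int.dvd_of_mul_dvd_mul_left (by norm_num) hac
  -- If 3 divides `a`, it cannot divide `b`: it would divide n₀ because 3 does not divide (a - b) /
  -- n₀, then also `c`, against generation. So `b` takes the place of `a`.
  by_cases ha : (3 : ℤ) ∣ a
  · rw [pmSet_swap_left]
    refine main b a c hG.swap_left (by rwa [dvd_sub_comm]) ?_ fun hb => ?_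
    · have := dvd_sub hac' hab'
      rwa [sub_sub_sub_cancel_left] at this
    · obtain ⟨s, hs⟩ := hab'
      obtain ⟨t, ht⟩ := hac'
      have h3 : (3 : ℤ) ∣ n₀ * s := by rw [← hs]; exact dvd_sub ha hb
      have hn3 : (3 : ℤ) ∣ n₀ := by
        refine (Int.prime_three.dvd_mul.1 h3).resolve_right fun ⟨k, hk⟩ => hG.sub_ab ⟨k, ?_⟩
        rw [hs, hcast, hk]; ring
      refine hG.gen 3 Nat.prime_three (dvd_mul_right 3 n₀) ha hb ?_
      have : c = a - n₀ * t := by linarith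
      rw [this]; exact dvd_sub ha (hn3.mul_right _)
  · exact main a b c hG hab' hac' ha

/-- A prime of n₀ dividing `a` would divide `b` and `c`, so `a` is a unit and can be normalised to
1. The congruences for `c` then become the defining system of c'. -/
theorem inSecondList_of_coprime {d d' : ℕ} (hd : 1 < d) (hdd : d < d') (hcop : d.Coprime d')
    (hd3 : d.Coprime 3) (hd3' : d'.Coprime 3) {a b c : ℤ}
    (hG : IsGenericTriple (3 * (d * d')) a b c) (ha3 : ¬ (3 : ℤ) ∣ a) (hb3 : (3 : ℤ) ∣ b + a)
    (hc3 : (3 : ℤ) ∣ c) (hab : ((3 * (d * d') : ℕ) : ℤ) ∣ 3 * (a - b)) (hac : (d : ℤ) ∣ a - c)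
    (hac' : (d' : ℤ) ∣ a + c) :
    InSecondList (3 * (d * d')) (pmSet (a : ZMod (3 * (d * d'))) b c) := by
  have hcast : ((3 * (d * d') : ℕ) : ℤ) = 3 * (d * d') := by push_cast; ring
  rw [hcast] at hab
  obtain ⟨s, hs⟩ : (d * d' : ℤ) ∣ a - b := Int.dvd_of_mul_dvd_mul_left (by norm_num) hab
  have hb : b = a - d * d' * s := by linarith
  have hnot : ∀ {x : ℕ}, x.Coprime 3 → ¬ (3 : ℤ) ∣ x := fun {x} h h' => by
    have h' : 3 ∣ x := by exact_mod_cast h'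
    exact absurd (Nat.eq_one_of_dvd_coprimes h h' dvd_rfl) (by norm_num)
  have hn3 : ¬ (3 : ℤ) ∣ d * d' := fun h =>
    (Int.prime_three.dvd_mul.1 h).elim (hnot hd3) (hnot hd3')
  have hcopa : IsCoprime (3 * (d * d') : ℤ) a := isCoprime_of_forall_prime fun p hp k1 k2 => by
    rcases (Nat.prime_iff_prime_int.1 hp).dvd_mul.1 k1 with h | h
    · have : p = 3 := (Nat.prime_dvd_prime_iff_eq hp Nat.prime_three).1 (by exact_mod_cast h)
      subst this
      exact ha3 k2
    · refine hG.gen p hp (by zify; exact h.mul_left 3) k2 ?_ ?_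
      · rw [hb]; exact dvd_sub k2 (h.mul_right _)
      · rcases (Nat.prime_iff_prime_int.1 hp).dvd_mul.1 h with h | h
        · exact (dvd_sub_right k2).1 (h.trans hac)
        · exact (dvd_add_right k2).1 (h.trans hac')
  obtain ⟨Q, hQ, k, hk⟩ := exists_inverse_of_isCoprime hcopa
  obtain ⟨δ, hδ, hδ3⟩ : ∃ δ : ℤ, (δ = 1 ∨ δ = -1) ∧ (3 : ℤ) ∣ δ - d * d' := by
    rcases (by omega : (d * d' : ℤ) % 3 = 1 ∨ (d * d' : ℤ) % 3 = 2) with h | h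
    · exact ⟨1, Or.inl rfl, by omega⟩
    · exact ⟨-1, Or.inr rfl, by omega⟩
  have hnpos : 0 < 3 * (d * d') := by
    have : 0 < d' := by omega
    positivity
  obtain ⟨c', hc', hc'n⟩ := exists_nat_residue hnpos (Q * c)
  rw [hcast] at hc'
  have aux : ∀ e y : ℤ, e ∣ 3 * (d * d') → e ∣ Q * c - y → e ∣ y - (c' : ℤ) := fun e y he hy => by
    have : y - (c' : ℤ) = (Q * c - c') - (Q * c - y) := by ring
    rw [this]; exact dvd_sub (he.trans hc') hy
  have dvd1 : (d : ℤ) ∣ 3 * (d * d') := ⟨3 * d', by ring⟩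
  have dvd2 : (d' : ℤ) ∣ 3 * (d * d') := ⟨3 * d, by ring⟩
  have e3 := aux 3 0 (dvd_mul_right _ _) (by simpa using hc3.mul_left Q)
  have ed := aux d 1 dvd1 (by
    have : Q * c - 1 = (Q * a - 1) - Q * (a - c) := by ring
    rw [this, hk]; exact dvd_sub (dvd1.mul_right _) (hac.mul_left _))
  have ed' := aux d' (-1) dvd2 (by
    have : Q * c - -1 = Q * (a + c) - (Q * a - 1) := by ring
    rw [this, hk]; exact dvd_sub (hac'.mul_left _) (dvd2.mul_right _))
  have hn₀ : 3 ≤ d * d' := by nlinarith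
  refine ⟨d * d', hn₀, rfl, Or.inr ⟨d, d', rfl, hcop, hd, hdd, hd3, hd3', δ, hδ, ?_, c', ?_,
    by omega, Int.modEq_iff_dvd.2 e3, Int.modEq_iff_dvd.2 ed, Int.modEq_iff_dvd.2 ed', ?_⟩⟩
  · rw [Int.modEq_iff_dvd]; push_cast; exact hδ3
  · rcases Nat.eq_zero_or_pos c' with h0 | h0
    · exfalso
      subst h0
      have : (d : ℤ) ∣ 1 := by simpa using ed
      have h' : d ∣ 1 := by exact_mod_cast this
      have := Nat.le_of_dvd (by norm_num) h'
      omega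
    · exact h0
  -- With n₀ = dd', a - b = n₀ s, n₀ ≡ δ and b ≡ -a modulo 3, one gets Qs ≡ -δ modulo 3. Hence Qb ≡
  -- 1 + δ n₀ = δ(n₀ + δ) modulo 3n₀.
  · have hQs : (3 : ℤ) ∣ δ + Q * s := by
      have t1 : (3 : ℤ) ∣ a + δ * s := by
        have : a + δ * s = (δ - d * d') * s + (3 * a - (b + a)) := by linear_combination -hs
        rw [this]
        exact dvd_add (hδ3.mul_right _) (dvd_sub (dvd_mul_right _ _) hb3)
      have hδ2 : δ * δ = 1 := by rcases hδ with rfl | rfl <;> norm_num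
      have : δ + Q * s = δ * (Q * (a + δ * s)) - δ * (3 * (d * d') * k) := by
        linear_combination -δ * hk - Q * s * hδ2
      rw [this]
      exact dvd_sub ((t1.mul_left _).mul_left _) (Dvd.intro (δ * (d * d' * k)) (by ring))
    obtain ⟨e, he⟩ := hQs
    have hb' : (3 * (d * d') : ℤ) ∣ Q * b - δ * (d * d' + δ) := by
      have hδ2 : δ * δ = 1 := by rcases hδ with rfl | rfl <;> norm_num
      refine ⟨k - e, ?_⟩
      rw [hb]
      linear_combination hk - d * d' * he - hδ2
    have := exists_unitMul_pmSet_eq (n := 3 * (d * d')) (a := a) (b := b)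
      (c := c) (x := 1) (y := d * d' + δ) (z := c') (Q := Q) (by rw [hcast]; exact hQ)
      (by left; rw [hcast]; exact ⟨k, hk⟩)
      (by
        rw [hcast]
        rcases hδ with rfl | rfl
        · left; simpa using hb'
        · right
          have e : Q * b - -1 * (d * d' + -1) = Q * b + (d * d' + -1) := by ring
          rwa [e] at hb')
      (by left; rw [hcast]; exact hc')
    simpa using this

/-! ### Quarter roles lead to the first list -/

theorem QuarterRole.swap {m : ℕ} {a b c : ℤ} (h : QuarterRole m a b c) : QuarterRole m a c b := by
  obtain ⟨h1, h2, σ, hσ, h3, h4⟩ := h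
  refine ⟨h1, h2, σ, hσ, ?_⟩
  rcases hσ with rfl | rfl
  · rw [one_mul] at *
    exact ⟨by rw [← dvd_neg, ← mul_neg, neg_sub]; exact h3, by rwa [dvd_sub_comm]⟩
  · rw [neg_one_mul, sub_neg_eq_add] at *
    rw [add_comm]; exact ⟨h3, h4⟩

theorem QuarterRole.neg_right {m : ℕ} {a b c : ℤ} (h : QuarterRole m a b c) :
    QuarterRole m a b (-c) := by
  obtain ⟨h1, h2, σ, hσ, h3, h4⟩ := h
  refine ⟨h1, h2, -σ, by rcases hσ with rfl | rfl <;> simp, ?_⟩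
  rw [neg_mul_neg]; exact ⟨h3, h4⟩

theorem QuarterRole.neg_left {m : ℕ} {a b c : ℤ} (h : QuarterRole m a b c) :
    QuarterRole m (-a) b c := by
  obtain ⟨h1, h2, h3⟩ := h
  exact ⟨by rwa [mul_neg, dvd_neg], by rwa [mul_neg, dvd_neg], h3⟩

/-- One of `a`, `b`, `c` has order four modulo `m` and the other two cancel. -/
def AnyQuarterRole (m : ℕ) (a b c : ℤ) : Prop :=
  QuarterRole m a b c ∨ QuarterRole m b a c ∨ QuarterRole m c a b

namespace AnyQuarterRole
variable {m : ℕ} {a b c : ℤ}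

theorem swap_left (h : AnyQuarterRole m a b c) : AnyQuarterRole m b a c := by
  rcases h with h | h | h
  · exact Or.inr (Or.inl h)
  · exact Or.inl h
  · exact Or.inr (Or.inr h.swap)

theorem swap_right (h : AnyQuarterRole m a b c) : AnyQuarterRole m a c b := by
  rcases h with h | h | h
  · exact Or.inl h.swap
  · exact Or.inr (Or.inr h)
  · exact Or.inr (Or.inl h)

theorem neg_right (h : AnyQuarterRole m a b c) : AnyQuarterRole m a b (-c) := by
  rcases h with h | h | h
  · exact Or.inl h.neg_right
  · exact Or.inr (Or.inl h.neg_right)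
  · exact Or.inr (Or.inr h.neg_left)

theorem neg_middle (h : AnyQuarterRole m a b c) : AnyQuarterRole m a (-b) c :=
  h.swap_right.neg_right.swap_right

end AnyQuarterRole

/-- A set of divisors of `n` with least common multiple `n`. -/
structure GeneratesOrder (n : ℕ) (D : Set ℕ) : Prop where
  dvd : ∀ m ∈ D, m ∣ n
  lcm : ∀ M : ℕ, (∀ m ∈ D, m ∣ M) → n ∣ M

theorem GeneratesOrder.dvd_int {n : ℕ} {D : Set ℕ} (h : GeneratesOrder n D) {x : ℤ}
    (hx : ∀ m ∈ D, (m : ℤ) ∣ x) : (n : ℤ) ∣ x := by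
  rw [Int.natCast_dvd]
  exact h.lcm _ fun m hm => Int.natCast_dvd.1 (hx m hm)

theorem GeneratesOrder.nonempty {n : ℕ} {D : Set ℕ} (h : GeneratesOrder n D) (hn : 1 < n) :
    D.Nonempty := by
  by_contra hne
  rw [Set.not_nonempty_iff_eq_empty] at hne
  have := h.lcm 1 (by simp [hne])
  rw [Nat.dvd_one] at this
  omega

/-- Some member of D carries the full p-part of n; otherwise every member would divide n / p. -/
theorem GeneratesOrder.exists_full {n : ℕ} {D : Set ℕ} (h : GeneratesOrder n D) (hn : 0 < n)
    {p : ℕ} (hp : p.Prime) (hpn : p ∣ n) : ∃ m ∈ D, ∃ t, n = m * t ∧ ¬ p ∣ t := by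
  obtain ⟨k, rfl⟩ := hpn
  by_contra! hcon
  have : p * k ∣ k := h.lcm k fun m hm => by
    obtain ⟨t, ht⟩ := h.dvd m hm
    obtain ⟨s, rfl⟩ := hcon m hm t ht
    exact ⟨s, Nat.eq_of_mul_eq_mul_left hp.pos (by rw [ht]; ring)⟩
  have hk : 0 < k := Nat.pos_of_mul_pos_left hn
  have := Nat.le_of_dvd hk this
  have := hp.two_le
  nlinarith

/-- The quotient of 4a by m is odd because m ∤ 2a, so m absorbs the factor 4. -/
theorem QuarterRole.four_dvd {m : ℕ} {a b c : ℤ} (h : QuarterRole m a b c) :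
    ∃ m₁ : ℕ, m = 4 * m₁ ∧ ∃ k, a = m₁ * k ∧ ¬ 2 ∣ k := by
  obtain ⟨⟨k, hk⟩, h2, -⟩ := h
  have hk2 : ¬ 2 ∣ k := by
    rintro ⟨l, rfl⟩
    exact h2 ⟨l, by linarith⟩
  obtain ⟨l, rfl⟩ : ∃ l, k = 2 * l + 1 := ⟨k / 2, by omega⟩
  have e1 : (m : ℤ) = 4 * a - 2 * (m * l) := by linarith
  obtain ⟨m', rfl⟩ : 2 ∣ m := by omega
  push_cast at e1
  have e2 : (m' : ℤ) = 2 * a - 2 * (m' * l) := by linarith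
  obtain ⟨m₁, rfl⟩ : 2 ∣ m' := by omega
  refine ⟨m₁, by ring, 2 * l + 1, ?_, hk2⟩
  push_cast at hk
  linarith

/-- Generation makes `b` and `c` odd, so parity prevents them from having order four modulo m. When
`a` has it, 8 ∣ m, and the sign -1 would give 4 ∣ b + c, which is incompatible with 4 ∣ b - c. All
orders thus impose the same two divisibilities, which lift to n. -/
theorem inFirstList_of_eight_dvd {n n₀ : ℕ} (hn : n = 4 * n₀) (hn₀ : 2 ≤ n₀) (h8 : 8 ∣ n)
    {a b c : ℤ} (hG : IsGenericTriple n a b c) {D : Set ℕ} (hD : GeneratesOrder n D)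
    (hrole : ∀ m ∈ D, AnyQuarterRole m a b c) (ha : 2 ∣ a) (hbc : 4 ∣ b - c) :
    InFirstList n (pmSet (a : ZMod n) b c) := by
  have hb : ¬ 2 ∣ b := fun hb => hG.gen 2 Nat.prime_two (by omega) ha hb (by push_cast; omega)
  have key : ∀ m ∈ D, (m : ℤ) ∣ 4 * a ∧ (m : ℤ) ∣ 2 * (b - c) := by
    intro m hm
    rcases hrole m hm with h | h | h
    · obtain ⟨m₁, rfl, k, hk, hk2⟩ := h.four_dvd
      obtain ⟨h1, -, σ, rfl | rfl, h3, -⟩ := h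
      · exact ⟨h1, by simpa using h3⟩
      · exfalso
        have hm₁ : (2 : ℤ) ∣ m₁ := by
          rw [hk] at ha
          exact (Int.prime_two.dvd_mul.1 ha).resolve_right hk2
        obtain ⟨l, hl⟩ := hm₁
        obtain ⟨w, hw⟩ := h3
        push_cast at hw
        rw [hl] at hw
        have : 2 * (b - -1 * c) = 8 * (l * w) := by linarith
        omega
    · obtain ⟨m₁, rfl, -⟩ := h.four_dvd
      obtain ⟨-, -, σ, hσ, ⟨w, hw⟩, -⟩ := h
      push_cast at hw
      have : 2 * (a - σ * c) = 4 * (m₁ * w) := by linarith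
      rcases hσ with rfl | rfl <;> omega
    · obtain ⟨m₁, rfl, -⟩ := h.four_dvd
      obtain ⟨-, -, σ, hσ, ⟨w, hw⟩, -⟩ := h
      push_cast at hw
      have : 2 * (a - σ * b) = 4 * (m₁ * w) := by linarith
      rcases hσ with rfl | rfl <;> omega
  have k1 := hD.dvd_int fun m hm => (key m hm).1
  have k2 := hD.dvd_int fun m hm => (key m hm).2
  subst hn
  exact inFirstList_of_odd_double hn₀ hG k1 k2

theorem QuarterRole.of_odd {m : ℕ} {a b c : ℤ} (h : QuarterRole (4 * m) a b c)
    (hm : ¬ (2 : ℤ) ∣ m) : ¬ 2 ∣ a ∧ (m : ℤ) ∣ a ∧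
      ∃ σ : ℤ, (σ = 1 ∨ σ = -1) ∧ (m : ℤ) ∣ b - σ * c ∧ (b - σ * c) % 4 = 2 := by
  obtain ⟨m₁, hm₁, k, hk, hk2⟩ := h.four_dvd
  obtain rfl : m₁ = m := by omega
  obtain ⟨-, -, σ, hσ, ⟨w, hw⟩, h4⟩ := h
  push_cast at hw h4
  have hw' : b - σ * c = 2 * (m₁ * w) := by linarith
  refine ⟨fun h => ?_, ⟨k, hk⟩, σ, hσ, ⟨2 * w, by linarith⟩, ?_⟩
  · rw [hk] at h
    exact (Int.prime_two.dvd_mul.1 h).elim hm hk2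
  · have hw2 : ¬ 2 ∣ w := fun ⟨l, hl⟩ => h4 ⟨l, by rw [hw', hl]; ring⟩
    have : ¬ 2 ∣ m₁ * w := fun h => (Int.prime_two.dvd_mul.1 h).elim hm hw2
    omega

theorem natCast_dvd_gcd {m n : ℕ} {x : ℤ} (h1 : m ∣ n) (h2 : (m : ℤ) ∣ x) :
    m ∣ Int.gcd n x :=
  Int.dvd_gcd (by exact_mod_cast h1) h2

theorem gcd_dvd_left_nat (n : ℕ) (x : ℤ) : Int.gcd n x ∣ n := by
  have := Int.gcd_dvd_left (n : ℤ) x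
  exact_mod_cast this

theorem not_two_dvd_of_dvd {m n : ℕ} (h : m ∣ n) (hn : Odd n) : ¬ (2 : ℤ) ∣ m := by
  have := (hn.of_dvd_nat h).not_two_dvd_nat
  exact_mod_cast this

/-- An odd prime dividing both `b - c` and `b + c` divides `b` and `c`. -/
theorem dvd_of_dvd_sub_of_dvd_add {p : ℕ} (hp : p.Prime) (hp2 : p ≠ 2) {b c : ℤ}
    (h1 : (p : ℤ) ∣ b - c) (h2 : (p : ℤ) ∣ b + c) : (p : ℤ) ∣ b ∧ (p : ℤ) ∣ c := by
  have hpp := Nat.prime_iff_prime_int.1 hp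
  have h : (p : ℤ) ∣ 2 * b := by
    have := dvd_add h1 h2
    rwa [show b - c + (b + c) = 2 * b by ring] at this
  have hb : (p : ℤ) ∣ b := (hpp.dvd_mul.1 h).resolve_left fun h => hp2 <|
    (Nat.prime_dvd_prime_iff_eq hp Nat.prime_two).1 (by exact_mod_cast h)
  exact ⟨hb, (dvd_add_right hb).1 h2⟩

/-- Only `a` can have order four, since for odd n₀ that element is odd. The sign may vary with m =
4m₁, and m₁ divides d or d' accordingly. So n₀ = dd', with d and d' coprime by generation; if one of
them is 1, the sign is constant and the set is trivial. -/
theorem inFirstList_of_even_pair {n₀ : ℕ} (hn₀ : 2 ≤ n₀) (hodd : Odd n₀)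
    {a b c : ℤ} (hG : IsGenericTriple (4 * n₀) a b c) {D : Set ℕ}
    (hD : GeneratesOrder (4 * n₀) D) (hrole : ∀ m ∈ D, AnyQuarterRole m a b c)
    (hb : b % 4 = 2) (hc : c % 4 = 0) :
    InFirstList (4 * n₀) (pmSet (a : ZMod (4 * n₀)) b c) := by
  set d := Int.gcd n₀ (b - c) with hd
  set d' := Int.gcd n₀ (b + c) with hd'
  have key : ∀ m ∈ D, (m : ℤ) ∣ 4 * a ∧ m ∣ 4 * (d * d') := by
    intro m hm
    rcases hrole m hm with h | h | h <;> obtain ⟨m₁, rfl, -⟩ := id h.four_dvd <;>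
      have hm₁ : m₁ ∣ n₀ := Nat.dvd_of_mul_dvd_mul_left (by norm_num) (hD.dvd _ hm)
    · refine ⟨h.1, mul_dvd_mul_left 4 ?_⟩
      obtain ⟨-, -, σ, rfl | rfl, h3, -⟩ := h.of_odd (not_two_dvd_of_dvd hm₁ hodd)
      · exact (natCast_dvd_gcd hm₁ (by simpa using h3)).mul_right _
      · exact (natCast_dvd_gcd hm₁ (by simpa using h3)).mul_left _
    · have := (h.of_odd (not_two_dvd_of_dvd hm₁ hodd)).1
      omega
    · have := (h.of_odd (not_two_dvd_of_dvd hm₁ hodd)).1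
      omega
  have k1 := hD.dvd_int fun m hm => (key m hm).1
  have k2 : n₀ ∣ d * d' :=
    Nat.dvd_of_mul_dvd_mul_left (by norm_num) (hD.lcm _ fun m hm => (key m hm).2)
  have hna : (n₀ : ℤ) ∣ a := by
    push_cast at k1
    exact Int.dvd_of_mul_dvd_mul_left (by norm_num) k1
  have hdn : d ∣ n₀ := gcd_dvd_left_nat _ _
  have hdn' : d' ∣ n₀ := gcd_dvd_left_nat _ _
  have hdb : (d : ℤ) ∣ b - c := Int.gcd_dvd_right _ _
  have hdb' : (d' : ℤ) ∣ b + c := Int.gcd_dvd_right _ _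
  clear_value d d'
  have hcop : d.Coprime d' := by
    rw [← Nat.isCoprime_iff_coprime]
    refine isCoprime_of_forall_prime fun p hp h1 h2 => ?_
    have hpn : p ∣ n₀ := (Int.natCast_dvd_natCast.1 h1).trans hdn
    have hp2 : p ≠ 2 := by
      rintro rfl
      exact hodd.not_two_dvd_nat hpn
    obtain ⟨e1, e2⟩ := dvd_of_dvd_sub_of_dvd_add hp hp2 (h1.trans hdb) (h2.trans hdb')
    exact hG.gen p hp (hpn.mul_left 4) ((Int.natCast_dvd_natCast.2 hpn).trans hna) e1 e2
  have hprod : n₀ = d * d' := Nat.dvd_antisymm k2 (hcop.mul_dvd_of_dvd_of_dvd hdn hdn')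
  have hod : Odd d := hodd.of_dvd_nat hdn
  have hod' : Odd d' := hodd.of_dvd_nat hdn'
  have hdbl : ∀ x : ℤ, 2 ∣ x → (n₀ : ℤ) ∣ x → ((4 * n₀ : ℕ) : ℤ) ∣ 2 * x := by
    rintro x h2 ⟨k, rfl⟩
    have : ¬ (2 : ℤ) ∣ n₀ := not_two_dvd_of_dvd dvd_rfl hodd
    obtain ⟨l, rfl⟩ := (Int.prime_two.dvd_mul.1 h2).resolve_left this
    exact ⟨l, by push_cast; ring⟩
  have neg_c : pmSet (a : ZMod (4 * n₀)) b c = pmSet (a : ZMod (4 * n₀)) b (-c : ℤ) := by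
    rw [Int.cast_neg, pmSet_neg_right]
  by_cases hd1 : d = 1
  · rw [neg_c]
    refine inFirstList_of_odd_double hn₀ hG.neg_right k1 ?_
    rw [sub_neg_eq_add]
    refine hdbl _ (by omega) ?_
    rwa [hprod, hd1, one_mul]
  by_cases hd1' : d' = 1
  · refine inFirstList_of_odd_double hn₀ hG k1 (hdbl _ (by omega) ?_)
    rwa [hprod, hd1', mul_one]
  have hdpos : 0 < d := Nat.pos_of_dvd_of_pos hdn (by omega)
  have hdpos' : 0 < d' := Nat.pos_of_dvd_of_pos hdn' (by omega)
  rcases lt_trichotomy d d' with h | h | h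
  · subst hprod
    exact inFirstList_of_even (by omega) h hod hod' hcop hG k1 hb hc hdb hdb'
  · subst h
    exact absurd ((Nat.coprime_self d).1 hcop) hd1
  · rw [neg_c]
    rw [mul_comm] at hprod
    subst hprod
    exact inFirstList_of_even (by omega) h hod' hod hcop.symm hG.neg_right k1 hb (by omega)
      (by rwa [sub_neg_eq_add]) (by rwa [← sub_eq_add_neg])

/-- If the middle factor is 1, then d'' = n₀ and `c` is the element of order four throughout, which
gives a trivial set. Otherwise coprimality makes the three factors strictly increasing. -/
theorem inFirstList_of_sorted {n₀ d d' d'' : ℕ} (hn₀ : 2 ≤ n₀) (hprod : n₀ = d * d' * d'')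
    (hodd : Odd n₀) (hle : d ≤ d') (hle' : d' ≤ d'') (hc1 : d.Coprime d')
    (hc2 : d.Coprime d'') (hc3 : d'.Coprime d'') {a b c : ℤ}
    (hG : IsGenericTriple (4 * n₀) a b c) (ha2 : ¬ 2 ∣ a) (hab : 4 ∣ b - a) (hac : 4 ∣ c - a)
    (h1 : (d : ℤ) ∣ a) (h1' : (d : ℤ) ∣ b + c) (h2 : (d' : ℤ) ∣ b) (h2' : (d' : ℤ) ∣ a + c)
    (h3 : (d'' : ℤ) ∣ c) (h3' : (d'' : ℤ) ∣ a + b) :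
    InFirstList (4 * n₀) (pmSet (a : ZMod (4 * n₀)) b c) := by
  have hdpos : 0 < d := Nat.pos_of_dvd_of_pos (n := n₀) ⟨d' * d'', by rw [hprod]; ring⟩ (by omega)
  by_cases hd' : d' = 1
  · have hd : d = 1 := by omega
    have hn : n₀ = d'' := by rw [hprod, hd, hd']; ring
    rw [pmSet_swap_right, pmSet_swap_left, ← pmSet_neg_right, ← Int.cast_neg]
    refine inFirstList_of_odd_double hn₀ hG.swap_right.swap_left.neg_right ?_ ?_
    · push_cast; rw [hn]; exact mul_dvd_mul_left 4 h3
    · rw [sub_neg_eq_add]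
      obtain ⟨k, hk⟩ := h3'
      rw [← hn] at hk
      have : ¬ (2 : ℤ) ∣ n₀ := not_two_dvd_of_dvd dvd_rfl hodd
      have hk2 : (2 : ℤ) ∣ n₀ * k := by omega
      obtain ⟨l, rfl⟩ := (Int.prime_two.dvd_mul.1 hk2).resolve_left this
      exact ⟨l, by rw [hk]; push_cast; ring⟩
  have hlt : d < d' := by
    refine lt_of_le_of_ne hle fun h => hd' ?_
    subst h
    exact (Nat.coprime_self d).1 hc1
  have hlt' : d' < d'' := by
    refine lt_of_le_of_ne hle' fun h => hd' ?_
    subst h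
    exact (Nat.coprime_self d').1 hc3
  subst hprod
  exact inFirstList_of_odd hdpos (by omega) hlt hlt'
    (hodd.of_dvd_nat ⟨d' * d'', by ring⟩) (hodd.of_dvd_nat ⟨d * d'', by ring⟩)
    (hodd.of_dvd_nat ⟨d * d', by ring⟩) hc1 hc2 hc3 hG ha2 hab hac h1 h1' h2 h2' h3 h3'

/-- With all three congruent modulo 4, cancellation needs a difference that is 2 modulo 4, so the
sign is always -1. What varies with m is which generator has order four: this splits n₀ into three
factors, pairwise coprime by generation, which are then sorted by size. -/
theorem inFirstList_of_congruent_odd {n₀ : ℕ} (hn₀ : 2 ≤ n₀) (hodd : Odd n₀)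
    {a b c : ℤ} (hG : IsGenericTriple (4 * n₀) a b c) {D : Set ℕ}
    (hD : GeneratesOrder (4 * n₀) D) (hrole : ∀ m ∈ D, AnyQuarterRole m a b c)
    (ha : ¬ 2 ∣ a) (hab : 4 ∣ b - a) (hac : 4 ∣ c - a) :
    InFirstList (4 * n₀) (pmSet (a : ZMod (4 * n₀)) b c) := by
  have hex : ∀ x y : ℤ, ∃ d : ℕ, d ∣ n₀ ∧ (d : ℤ) ∣ x ∧ (d : ℤ) ∣ y ∧
      ∀ m : ℕ, m ∣ n₀ → (m : ℤ) ∣ x → (m : ℤ) ∣ y → m ∣ d := fun x y =>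
    ⟨Int.gcd (Int.gcd n₀ x) y, (gcd_dvd_left_nat _ _).trans (gcd_dvd_left_nat _ _),
      (Int.gcd_dvd_left _ _).trans (Int.gcd_dvd_right _ _), Int.gcd_dvd_right _ _,
      fun m h1 h2 h3 => natCast_dvd_gcd (natCast_dvd_gcd h1 h2) h3⟩
  obtain ⟨d₁, n1, x1, y1, u1⟩ := hex a (b + c)
  obtain ⟨d₂, n2, x2, y2, u2⟩ := hex b (a + c)
  obtain ⟨d₃, n3, x3, y3, u3⟩ := hex c (a + b)
  have k : n₀ ∣ d₁ * d₂ * d₃ := by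
    refine Nat.dvd_of_mul_dvd_mul_left (k := 4) (by norm_num) (hD.lcm _ fun m hm => ?_)
    rcases hrole m hm with h | h | h <;> obtain ⟨m₁, rfl, -⟩ := id h.four_dvd <;>
      have hm₁ : m₁ ∣ n₀ := Nat.dvd_of_mul_dvd_mul_left (by norm_num) (hD.dvd _ hm) <;>
      obtain ⟨-, e1, σ, rfl | rfl, e2, e3⟩ := h.of_odd (not_two_dvd_of_dvd hm₁ hodd) <;>
      refine mul_dvd_mul_left 4 ?_
    · omega
    · exact ((u1 m₁ hm₁ e1 (by simpa using e2)).mul_right _).mul_right _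
    · omega
    · exact ((u2 m₁ hm₁ e1 (by simpa using e2)).mul_left _).mul_right _
    · omega
    · exact (u3 m₁ hm₁ e1 (by simpa using e2)).mul_left _
  have gen : ∀ p : ℕ, p.Prime → (p : ℤ) ∣ n₀ → (p : ℤ) ∣ a → (p : ℤ) ∣ b → (p : ℤ) ∣ c → False :=
    fun p hp hpn => hG.gen p hp ((Int.natCast_dvd_natCast.1 hpn).mul_left 4)
  have c12 : d₁.Coprime d₂ := by
    rw [← Nat.isCoprime_iff_coprime]
    refine isCoprime_of_forall_prime fun p hp h1 h2 => ?_
    exact gen p hp (h1.trans (Int.natCast_dvd_natCast.2 n1)) (h1.trans x1) (h2.trans x2)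
      ((dvd_add_right (h2.trans x2)).1 (h1.trans y1))
  have c13 : d₁.Coprime d₃ := by
    rw [← Nat.isCoprime_iff_coprime]
    refine isCoprime_of_forall_prime fun p hp h1 h2 => ?_
    exact gen p hp (h1.trans (Int.natCast_dvd_natCast.2 n1)) (h1.trans x1)
      ((dvd_add_right (h1.trans x1)).1 (h2.trans y3)) (h2.trans x3)
  have c23 : d₂.Coprime d₃ := by
    rw [← Nat.isCoprime_iff_coprime]
    refine isCoprime_of_forall_prime fun p hp h1 h2 => ?_
    exact gen p hp (h1.trans (Int.natCast_dvd_natCast.2 n2))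
      ((dvd_add_left (h2.trans x3)).1 (h1.trans y2)) (h1.trans x2) (h2.trans x3)
  have hprod : n₀ = d₁ * d₂ * d₃ := Nat.dvd_antisymm k
    ((c13.mul_left c23).mul_dvd_of_dvd_of_dvd (c12.mul_dvd_of_dvd_of_dvd n1 n2) n3)
  have y1' : (d₁ : ℤ) ∣ c + b := by rwa [add_comm]
  have y2' : (d₂ : ℤ) ∣ c + a := by rwa [add_comm]
  have y3' : (d₃ : ℤ) ∣ b + a := by rwa [add_comm]
  have hb : ¬ 2 ∣ b := by omega
  have hc : ¬ 2 ∣ c := by omega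
  rcases le_total d₁ d₂ with h12 | h12 <;> rcases le_total d₁ d₃ with h13 | h13 <;>
    rcases le_total d₂ d₃ with h23 | h23
  · exact inFirstList_of_sorted hn₀ hprod hodd h12 h23 c12 c13 c23 hG ha hab hac x1 y1 x2 y2 x3 y3
  · rw [pmSet_swap_right]
    exact inFirstList_of_sorted hn₀ (by rw [hprod]; ring) hodd h13 h23 c13 c12 c23.symm
      hG.swap_right ha hac hab x1 y1' x3 y3 x2 y2
  · rw [pmSet_swap_right, pmSet_swap_left]
    exact inFirstList_of_sorted hn₀ (by rw [hprod]; ring) hodd h13 h12 c13.symm c23.symm c12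
      hG.swap_right.swap_left hc (by omega) (by omega) x3 y3 x1 y1' x2 y2'
  · rw [pmSet_swap_right, pmSet_swap_left]
    exact inFirstList_of_sorted hn₀ (by rw [hprod]; ring) hodd h13 h12 c13.symm c23.symm c12
      hG.swap_right.swap_left hc (by omega) (by omega) x3 y3 x1 y1' x2 y2'
  · rw [pmSet_swap_left]
    exact inFirstList_of_sorted hn₀ (by rw [hprod]; ring) hodd h12 h13 c12.symm c23 c13
      hG.swap_left hb (by omega) (by omega) x2 y2 x1 y1 x3 y3'
  · rw [pmSet_swap_left]
    exact inFirstList_of_sorted hn₀ (by rw [hprod]; ring) hodd h12 h13 c12.symm c23 c13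
      hG.swap_left hb (by omega) (by omega) x2 y2 x1 y1 x3 y3'
  · rw [pmSet_swap_left, pmSet_swap_right]
    exact inFirstList_of_sorted hn₀ (by rw [hprod]; ring) hodd h23 h13 c23 c12.symm c13.symm
      hG.swap_left.swap_right hb (by omega) (by omega) x2 y2' x3 y3' x1 y1
  · rw [pmSet_swap_left, pmSet_swap_right, pmSet_swap_left]
    exact inFirstList_of_sorted hn₀ (by rw [hprod]; ring) hodd h23 h12 c23.symm c13.symm c12.symm
      hG.swap_left.swap_right.swap_left hc (by omega) (by omega) x3 y3' x2 y2' x1 y1'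

theorem inFirstList_of_four_dvd {n₀ : ℕ} (hn₀ : 2 ≤ n₀) {a b c : ℤ}
    (hG : IsGenericTriple (4 * n₀) a b c) {D : Set ℕ} (hD : GeneratesOrder (4 * n₀) D)
    (hrole : ∀ m ∈ D, AnyQuarterRole m a b c) {m : ℕ} (hm : m ∈ D)
    (hfull : ∃ t, 4 * n₀ = m * t ∧ ¬ 2 ∣ t) (hma : QuarterRole m a b c) :
    InFirstList (4 * n₀) (pmSet (a : ZMod (4 * n₀)) b c) := by
  have neg_c : pmSet (a : ZMod (4 * n₀)) b c = pmSet (a : ZMod (4 * n₀)) b (-c : ℤ) := by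
    rw [Int.cast_neg, pmSet_neg_right]
  have neg_b : pmSet (a : ZMod (4 * n₀)) b c = pmSet (a : ZMod (4 * n₀)) (-b : ℤ) c := by
    rw [Int.cast_neg, pmSet_neg_middle]
  obtain ⟨t, ht, ht2⟩ := hfull
  obtain ⟨m₁, rfl, k, hk, hk2⟩ := hma.four_dvd
  have ht' : n₀ = m₁ * t := by linarith
  -- The order m carries the full power of 2 in n, so for even n₀ it is divisible by 8; then `a` is
  -- even and 4 divides b - σc.
  rcases Nat.even_or_odd n₀ with heven | hodd
  · have hm₁ : 2 ∣ m₁ := by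
      have := heven.two_dvd
      rw [ht'] at this
      exact (Nat.prime_two.dvd_mul.1 this).resolve_right ht2
    obtain ⟨l, rfl⟩ := hm₁
    have ha : 2 ∣ a := by rw [hk]; push_cast; exact (dvd_mul_right _ _).mul_right _
    have h8 : 8 ∣ 4 * n₀ := ⟨l * t, by rw [ht']; ring⟩
    obtain ⟨-, -, σ, hσ, ⟨w, hw⟩, -⟩ := hma
    push_cast at hw
    have hbc : 4 ∣ b - σ * c := ⟨l * w, by linarith⟩
    rcases hσ with rfl | rfl
    · exact inFirstList_of_eight_dvd rfl hn₀ h8 hG hD hrole ha (by simpa using hbc)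
    · rw [neg_c]
      exact inFirstList_of_eight_dvd rfl hn₀ h8 hG.neg_right hD
        (fun m hm => (hrole m hm).neg_right) ha (by simpa using hbc)
  · have hm₁ : ¬ (2 : ℤ) ∣ m₁ := not_two_dvd_of_dvd ⟨t, ht'⟩ hodd
    obtain ⟨ha, -, σ, hσ, -, hbc⟩ := hma.of_odd hm₁
    have hbc2 : b % 2 = c % 2 := by rcases hσ with rfl | rfl <;> omega
    by_cases hb : 2 ∣ b
    · by_cases hb4 : b % 4 = 2
      · exact inFirstList_of_even_pair hn₀ hodd hG hD hrole hb4
          (by rcases hσ with rfl | rfl <;> omega)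
      · rw [pmSet_swap_right]
        exact inFirstList_of_even_pair hn₀ hodd hG.swap_right hD
          (fun m hm => (hrole m hm).swap_right) (by rcases hσ with rfl | rfl <;> omega) (by omega)
    -- All three generators are odd, so changing the signs of `b` and `c` makes them congruent to
    -- `a` modulo 4.
    · have main : ∀ c : ℤ, IsGenericTriple (4 * n₀) a b c →
          (∀ m ∈ D, AnyQuarterRole m a b c) → 4 ∣ c - a →
          InFirstList (4 * n₀) (pmSet (a : ZMod (4 * n₀)) b c) := by
        intro c hG hrole hac
        by_cases hab : 4 ∣ b - a
        · exact inFirstList_of_congruent_odd hn₀ hodd hG hD hrole ha hab hac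
        · rw [← pmSet_neg_middle, ← Int.cast_neg]
          exact inFirstList_of_congruent_odd hn₀ hodd hG.neg_middle hD
            (fun m hm => (hrole m hm).neg_middle) ha (by omega) hac
      by_cases hac : 4 ∣ c - a
      · exact main c hG hrole hac
      · rw [neg_c]
        exact main (-c) hG.neg_right (fun m hm => (hrole m hm).neg_right) (by omega)

theorem inFirstList_of_orders {n : ℕ} (hn : 7 ≤ n) {a b c : ℤ} (hG : IsGenericTriple n a b c)
    {D : Set ℕ} (hD : GeneratesOrder n D) (hrole : ∀ m ∈ D, AnyQuarterRole m a b c) :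
    InFirstList n (pmSet (a : ZMod n) b c) := by
  have hn4 : 4 ∣ n := by
    obtain ⟨m, hm⟩ := hD.nonempty (by omega)
    refine Dvd.dvd.trans ?_ (hD.dvd m hm)
    rcases hrole m hm with h | h | h <;> obtain ⟨m₁, rfl, -⟩ := h.four_dvd <;>
      exact dvd_mul_right 4 m₁
  obtain ⟨n₀, rfl⟩ := hn4
  obtain ⟨m, hm, hfull⟩ := hD.exists_full (by omega) Nat.prime_two (by omega)
  have hn₀ : 2 ≤ n₀ := by omega
  rcases hrole m hm with h | h | h
  · exact inFirstList_of_four_dvd hn₀ hG hD hrole hm hfull h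
  · rw [pmSet_swap_left]
    exact inFirstList_of_four_dvd hn₀ hG.swap_left hD (fun m hm => (hrole m hm).swap_left) hm
      hfull h
  · rw [pmSet_swap_right, pmSet_swap_left]
    exact inFirstList_of_four_dvd hn₀ hG.swap_right.swap_left hD
      (fun m hm => (hrole m hm).swap_right.swap_left) hm hfull h

/-! ### Third roles lead to the second list -/

theorem ThirdRole.swap_right {m : ℕ} {a b c : ℤ} (h : ThirdRole m a b c) : ThirdRole m a c b := by
  obtain ⟨σ, τ, hσ, hτ, h1, h2, h3, h4, h5⟩ := h
  exact ⟨τ, σ, hτ, hσ, h2, h1, h4, h3, by rwa [dvd_sub_comm]⟩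

theorem ThirdRole.neg_right {m : ℕ} {a b c : ℤ} (h : ThirdRole m a b c) :
    ThirdRole m a b (-c) := by
  obtain ⟨σ, τ, hσ, hτ, h1, h2, h3, h4, h5⟩ := h
  exact ⟨σ, -τ, hσ, by rcases hτ with rfl | rfl <;> simp, h1, by rwa [neg_mul_neg], h3,
    by rwa [neg_mul_neg], by rwa [neg_mul_neg]⟩

theorem ThirdRole.neg_middle {m : ℕ} {a b c : ℤ} (h : ThirdRole m a b c) :
    ThirdRole m a (-b) c :=
  h.swap_right.neg_right.swap_right

/-- Multiplying the triple (a, σb, τc) by σ moves the normalised sign from `a` to `b`. -/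
theorem ThirdRole.swap_left {m : ℕ} {a b c : ℤ} (h : ThirdRole m a b c) : ThirdRole m b a c := by
  obtain ⟨σ, τ, hσ, hτ, h1, h2, h3, h4, h5⟩ := h
  have hσ2 : σ * σ = 1 := by rcases hσ with rfl | rfl <;> norm_num
  have e1 : a - σ * b = -σ * (b - σ * a) := by linear_combination (-a) * hσ2
  have e2 : σ * b - τ * c = σ * (b - σ * τ * c) := by linear_combination τ * c * hσ2
  have e3 : a - τ * c = σ * (σ * a - σ * τ * c) := by linear_combination (τ * c - a) * hσ2
  refine ⟨σ, σ * τ, hσ, ?_, ?_, ?_, fun h => h3 ?_, fun h => h5 ?_, fun h => h4 ?_⟩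
  · rcases hσ with rfl | rfl <;> rcases hτ with rfl | rfl <;> simp
  · have : 3 * (b - σ * a) = -σ * (3 * (a - σ * b)) := by
      linear_combination (-3 * b) * hσ2
    rw [this]; exact h1.mul_left _
  · have : 3 * (b - σ * τ * c) = σ * (3 * (a - τ * c) - 3 * (a - σ * b)) := by
      linear_combination (-3 * b) * hσ2
    rw [this]; exact (dvd_sub h2 h1).mul_left _
  · rw [e1]; exact h.mul_left _
  · rw [e2]; exact h.mul_left _
  · rw [e3]; exact h.mul_left _

theorem mod_three_cases (x : ℤ) : x % 3 = 0 ∨ x % 3 = 1 ∨ x % 3 = 2 := by omega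

theorem three_dvd_of_dvd_three_mul {m : ℕ} {x : ℤ} (h : (m : ℤ) ∣ 3 * x) (h' : ¬ (m : ℤ) ∣ x) :
    ∃ m₁ : ℕ, m = 3 * m₁ ∧ ∃ k, x = m₁ * k ∧ ¬ 3 ∣ k := by
  obtain ⟨k, hk⟩ := h
  have hk3 : ¬ 3 ∣ k := by
    rintro ⟨l, rfl⟩
    exact h' ⟨l, by linarith⟩
  have h3 : (3 : ℤ) ∣ m := (Int.prime_three.dvd_mul.1 ⟨x, hk.symm⟩).resolve_right hk3
  obtain ⟨m₁, rfl⟩ : 3 ∣ m := by exact_mod_cast h3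
  exact ⟨m₁, rfl, k, by push_cast at hk; linarith, hk3⟩

theorem dvd_of_nine_dvd {m₁ : ℕ} {x : ℤ} (h : ((3 * m₁ : ℕ) : ℤ) ∣ 3 * x) : (m₁ : ℤ) ∣ x := by
  push_cast at h
  exact Int.dvd_of_mul_dvd_mul_left (by norm_num) h

theorem ThirdRole.three_dvd {m : ℕ} {a b c : ℤ} (h : ThirdRole m a b c) : 3 ∣ m := by
  obtain ⟨σ, τ, -, -, h1, -, h3, -⟩ := h
  obtain ⟨m₁, rfl, -⟩ := three_dvd_of_dvd_three_mul h1 h3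
  exact dvd_mul_right _ _

/-- Write m = 3m₁. If 3 ∣ m₁, the signed generators agree modulo 3, which forces both signs to be
+1. If 3 ∤ m₁, they agree modulo m₁ but not modulo m, so they occupy all three classes modulo 3,
although none of them is divisible by 3. -/
theorem ThirdRole.eq_of_congruent {m : ℕ} {a b c : ℤ} (h : ThirdRole m a b c) (ha : ¬ 3 ∣ a)
    (hab : 3 ∣ a - b) (hac : 3 ∣ a - c) :
    (m : ℤ) ∣ 3 * (a - b) ∧ (m : ℤ) ∣ 3 * (a - c) ∧ ¬ (m : ℤ) ∣ a - b := by
  obtain ⟨σ, τ, hσ, hτ, h1, h2, h3, h4, h5⟩ := h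
  obtain ⟨m₁, rfl, k, hk, hk3⟩ := three_dvd_of_dvd_three_mul h1 h3
  have h2' := dvd_of_nine_dvd h2
  by_cases hm : (3 : ℤ) ∣ m₁
  · have hs : 3 ∣ a - σ * b := by rw [hk]; exact hm.mul_right _
    have ht : 3 ∣ a - τ * c := hm.trans h2'
    rcases hσ with rfl | rfl <;> rcases hτ with rfl | rfl
    · rw [one_mul] at *; exact ⟨h1, h2, h3⟩
    all_goals exfalso; omega
  · exfalso
    have aux : ∀ x : ℤ, (m₁ : ℤ) ∣ x → 3 ∣ x → ((3 * m₁ : ℕ) : ℤ) ∣ x := by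
      rintro x ⟨l, rfl⟩ hx
      obtain ⟨w, rfl⟩ := (Int.prime_three.dvd_mul.1 hx).resolve_left hm
      exact ⟨w, by push_cast; ring⟩
    have hs : (m₁ : ℤ) ∣ a - σ * b := ⟨k, hk⟩
    have hst : (m₁ : ℤ) ∣ σ * b - τ * c := by
      have := dvd_sub h2' hs; rwa [sub_sub_sub_cancel_left] at this
    have n1 : ¬ 3 ∣ a - σ * b := fun h => h3 (aux _ hs h)
    have n2 : ¬ 3 ∣ a - τ * c := fun h => h4 (aux _ h2' h)
    have n3 : ¬ 3 ∣ σ * b - τ * c := fun h => h5 (aux _ hst h)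
    clear h1 h2 h3 h4 h5 hk h2' hs hst
    rcases hσ with rfl | rfl <;> rcases hτ with rfl | rfl <;> rcases mod_three_cases a with ha' | ha' | ha' <;>
      rcases mod_three_cases b with hb' | hb' | hb' <;>
      rcases mod_three_cases c with hc' | hc' | hc' <;> omega

/-- If nine divides `m`, then `a`, `b`, `c` agree modulo three up to sign. -/
theorem ThirdRole.congruent_of_nine_dvd {m : ℕ} {a b c : ℤ} (h : ThirdRole m a b c) (h9 : 9 ∣ m) :
    ∃ σ τ : ℤ, (σ = 1 ∨ σ = -1) ∧ (τ = 1 ∨ τ = -1) ∧ 3 ∣ a - σ * b ∧ 3 ∣ a - τ * c := by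
  obtain ⟨σ, τ, hσ, hτ, h1, h2, -⟩ := h
  have h9' : (9 : ℤ) ∣ m := by exact_mod_cast h9
  refine ⟨σ, τ, hσ, hτ, ?_, ?_⟩
  · have := h9'.trans h1; omega
  · have := h9'.trans h2; omega

theorem nine_dvd_of_full {n m t : ℕ} (h9 : 9 ∣ n) (h : n = m * t) (ht : ¬ 3 ∣ t) : 9 ∣ m := by
  rw [h] at h9
  have : Nat.Coprime 9 t := by
    have : Nat.Coprime 3 t := (Nat.Prime.coprime_iff_not_dvd Nat.prime_three).2 ht
    exact this.pow_left 2
  exact this.dvd_of_dvd_mul_right h9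

theorem inSecondList_of_nine_dvd {n₀ : ℕ} (hn₀ : 3 ≤ n₀) {a b c : ℤ}
    (hG : IsGenericTriple (3 * n₀) a b c) {D : Set ℕ} (hD : GeneratesOrder (3 * n₀) D)
    (hrole : ∀ m ∈ D, ThirdRole m a b c) (hab : 3 ∣ a - b) (hac : 3 ∣ a - c) :
    InSecondList (3 * n₀) (pmSet (a : ZMod (3 * n₀)) b c) := by
  have ha : ¬ 3 ∣ a := fun ha => hG.gen 3 Nat.prime_three (dvd_mul_right 3 n₀) ha
    (by push_cast; omega) (by push_cast; omega)
  exact inSecondList_of_cosets hn₀ hG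
    (hD.dvd_int fun m hm => ((hrole m hm).eq_of_congruent ha hab hac).1)
    (hD.dvd_int fun m hm => ((hrole m hm).eq_of_congruent ha hab hac).2.1)

/-- Write m = 3m₁ with 3 ∤ m₁. The sign of `b` must be +1: since 3 ∣ a + b, the other sign would
give m ∣ a + b. The sign of `c` may vary with m, and m₁ divides d or d' accordingly. Generation and
oddness make d, d' coprime with product n₀. -/
theorem inSecondList_of_not_nine_dvd {n₀ : ℕ} (hn₀ : 3 ≤ n₀) (hodd : Odd n₀) (h3 : ¬ 3 ∣ n₀)
    {a b c : ℤ} (hG : IsGenericTriple (3 * n₀) a b c) {D : Set ℕ}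
    (hD : GeneratesOrder (3 * n₀) D) (hrole : ∀ m ∈ D, ThirdRole m a b c) (ha : ¬ 3 ∣ a)
    (hab : 3 ∣ b + a) (hc : 3 ∣ c) :
    InSecondList (3 * n₀) (pmSet (a : ZMod (3 * n₀)) b c) := by
  set d := Int.gcd n₀ (a - c) with hd
  set d' := Int.gcd n₀ (a + c) with hd'
  have key : ∀ m ∈ D, (m : ℤ) ∣ 3 * (a - b) ∧ m ∣ 3 * (d * d') := by
    intro m hm
    obtain ⟨σ, τ, hσ, hτ, h1, h2, h1', h2', h3'⟩ := hrole m hm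
    obtain ⟨m₁, rfl, k, hk, -⟩ := three_dvd_of_dvd_three_mul h1 h1'
    have hm₁ : m₁ ∣ n₀ := Nat.dvd_of_mul_dvd_mul_left (by norm_num) (hD.dvd _ hm)
    have hm3 : ¬ (3 : ℤ) ∣ m₁ := fun h => h3 (Dvd.dvd.trans (by exact_mod_cast h) hm₁)
    have hc' := dvd_of_nine_dvd h2
    constructor
    · rcases hσ with rfl | rfl
      · simpa using h1
      · exfalso
        apply h1'
        have h3k : (3 : ℤ) ∣ m₁ * k := by rw [← hk]; omega
        obtain ⟨l, rfl⟩ := (Int.prime_three.dvd_mul.1 h3k).resolve_left hm3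
        exact ⟨l, by rw [hk]; push_cast; ring⟩
    · refine mul_dvd_mul_left 3 ?_
      rcases hτ with rfl | rfl
      · exact (natCast_dvd_gcd hm₁ (by simpa using hc')).mul_right _
      · exact (natCast_dvd_gcd hm₁ (by simpa using hc')).mul_left _
  have k1 := hD.dvd_int fun m hm => (key m hm).1
  have k2 : n₀ ∣ d * d' :=
    Nat.dvd_of_mul_dvd_mul_left (by norm_num) (hD.lcm _ fun m hm => (key m hm).2)
  have hnab : (n₀ : ℤ) ∣ a - b := dvd_of_nine_dvd k1
  have hdn : d ∣ n₀ := gcd_dvd_left_nat _ _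
  have hdn' : d' ∣ n₀ := gcd_dvd_left_nat _ _
  have hdb : (d : ℤ) ∣ a - c := Int.gcd_dvd_right _ _
  have hdb' : (d' : ℤ) ∣ a + c := Int.gcd_dvd_right _ _
  clear_value d d'
  have hcop : d.Coprime d' := by
    rw [← Nat.isCoprime_iff_coprime]
    refine isCoprime_of_forall_prime fun p hp h1 h2 => ?_
    have hpn : p ∣ n₀ := (Int.natCast_dvd_natCast.1 h1).trans hdn
    have hp2 : p ≠ 2 := by
      rintro rfl
      exact hodd.not_two_dvd_nat hpn
    obtain ⟨e1, e2⟩ := dvd_of_dvd_sub_of_dvd_add hp hp2 (h1.trans hdb) (h2.trans hdb')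
    exact hG.gen p hp (hpn.mul_left 3) e1
      ((dvd_sub_right e1).1 ((Int.natCast_dvd_natCast.2 hpn).trans hnab)) e2
  have hprod : n₀ = d * d' := Nat.dvd_antisymm k2 (hcop.mul_dvd_of_dvd_of_dvd hdn hdn')
  have h3cop : ∀ {x : ℕ}, x ∣ n₀ → x.Coprime 3 := fun hx =>
    ((Nat.Prime.coprime_iff_not_dvd Nat.prime_three).2 fun h => h3 (h.trans hx)).symm
  have neg_c : pmSet (a : ZMod (3 * n₀)) b c = pmSet (a : ZMod (3 * n₀)) b (-c : ℤ) := by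
    rw [Int.cast_neg, pmSet_neg_right]
  have htriple : ∀ x : ℤ, (n₀ : ℤ) ∣ x → ((3 * n₀ : ℕ) : ℤ) ∣ 3 * x := fun x hx => by
    push_cast; exact mul_dvd_mul_left 3 hx
  by_cases hd1 : d = 1
  · rw [neg_c]
    refine inSecondList_of_cosets hn₀ hG.neg_right k1 (htriple _ ?_)
    rw [sub_neg_eq_add]
    rwa [hprod, hd1, one_mul]
  by_cases hd1' : d' = 1
  · refine inSecondList_of_cosets hn₀ hG k1 (htriple _ ?_)
    rwa [hprod, hd1', mul_one]
  have hdpos : 0 < d := Nat.pos_of_dvd_of_pos hdn (by omega)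
  have hdpos' : 0 < d' := Nat.pos_of_dvd_of_pos hdn' (by omega)
  have cd := h3cop hdn
  have cd' := h3cop hdn'
  rcases lt_trichotomy d d' with h | h | h
  · subst hprod
    exact inSecondList_of_coprime (by omega) h hcop cd cd' hG ha hab hc k1 hdb hdb'
  · subst h
    exact absurd ((Nat.coprime_self d).1 hcop) hd1
  · rw [neg_c]
    rw [mul_comm] at hprod
    subst hprod
    exact inSecondList_of_coprime (by omega) h hcop.symm cd' cd hG.neg_right ha hab
      (by rwa [dvd_neg]) k1 (by rwa [sub_neg_eq_add]) (by rwa [← sub_eq_add_neg])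

theorem inSecondList_of_not_nine_dvd' {n₀ : ℕ} (hn₀ : 3 ≤ n₀) (hodd : Odd n₀) (h3 : ¬ 3 ∣ n₀)
    {a b c : ℤ} (hG : IsGenericTriple (3 * n₀) a b c) {D : Set ℕ}
    (hD : GeneratesOrder (3 * n₀) D) (hrole : ∀ m ∈ D, ThirdRole m a b c) (hc : 3 ∣ c)
    (ha : ¬ 3 ∣ a) (hb : ¬ 3 ∣ b) : InSecondList (3 * n₀) (pmSet (a : ZMod (3 * n₀)) b c) := by
  by_cases hab : 3 ∣ b + a
  · exact inSecondList_of_not_nine_dvd hn₀ hodd h3 hG hD hrole ha hab hc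
  · rw [← pmSet_neg_middle, ← Int.cast_neg]
    exact inSecondList_of_not_nine_dvd hn₀ hodd h3 hG.neg_middle hD
      (fun m hm => (hrole m hm).neg_middle) ha
      (by rcases mod_three_cases a with ha' | ha' | ha' <;>
            rcases mod_three_cases b with hb' | hb' | hb' <;> omega) hc

theorem inSecondList_of_orders {n : ℕ} (hn : 7 ≤ n) (hodd : Odd n) {a b c : ℤ}
    (hG : IsGenericTriple n a b c) {D : Set ℕ} (hD : GeneratesOrder n D)
    (hrole : ∀ m ∈ D, ThirdRole m a b c) : InSecondList n (pmSet (a : ZMod n) b c) := by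
  obtain ⟨m, hm⟩ := hD.nonempty (by omega)
  obtain ⟨n₀, rfl⟩ : 3 ∣ n := (hrole m hm).three_dvd.trans (hD.dvd m hm)
  have hn₀ : 3 ≤ n₀ := by omega
  by_cases h9 : 9 ∣ 3 * n₀
  · obtain ⟨m, hm, t, ht, ht3⟩ := hD.exists_full (by omega) Nat.prime_three (dvd_mul_right 3 n₀)
    obtain ⟨σ, τ, hσ, hτ, hab, hac⟩ :=
      (hrole m hm).congruent_of_nine_dvd (nine_dvd_of_full h9 ht ht3)
    have main : ∀ b : ℤ, IsGenericTriple (3 * n₀) a b c → (∀ m ∈ D, ThirdRole m a b c) →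
        3 ∣ a - b → InSecondList (3 * n₀) (pmSet (a : ZMod (3 * n₀)) b c) := by
      intro b hG hrole hab
      rcases hτ with rfl | rfl
      · exact inSecondList_of_nine_dvd hn₀ hG hD hrole hab (by simpa using hac)
      · rw [← pmSet_neg_right, ← Int.cast_neg]
        exact inSecondList_of_nine_dvd hn₀ hG.neg_right hD (fun m hm => (hrole m hm).neg_right)
          hab (by simpa using hac)
    rcases hσ with rfl | rfl
    · exact main b hG hrole (by simpa using hab)
    · rw [← pmSet_neg_middle, ← Int.cast_neg]
      exact main (-b) hG.neg_middle (fun m hm => (hrole m hm).neg_middle) (by simpa using hab)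
  -- Now 3 ∤ m₁, and the signed generators agree modulo m₁ but not modulo 3m₁. They fill all classes
  -- modulo 3, so exactly one of `a`, `b`, `c` is divisible by 3.
  · have h3 : ¬ 3 ∣ n₀ := by omega
    have hodd' : Odd n₀ := hodd.of_dvd_nat (dvd_mul_left _ _)
    have hdist : ¬ 3 ∣ a ∨ ¬ 3 ∣ b ∨ ¬ 3 ∣ c := by
      by_contra! h
      exact hG.gen 3 Nat.prime_three (dvd_mul_right 3 n₀) h.1 h.2.1 h.2.2
    obtain ⟨σ, τ, hσ, hτ, h1, h2, h1', h2', h3'⟩ := hrole m hm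
    obtain ⟨m₁, rfl, k, hk, -⟩ := three_dvd_of_dvd_three_mul h1 h1'
    have hm3 : ¬ (3 : ℤ) ∣ m₁ := fun h => h3 (Dvd.dvd.trans (by exact_mod_cast h)
      (Nat.dvd_of_mul_dvd_mul_left (by norm_num) (hD.dvd _ hm)))
    have aux : ∀ x : ℤ, (m₁ : ℤ) ∣ x → 3 ∣ x → ((3 * m₁ : ℕ) : ℤ) ∣ x := by
      rintro x ⟨l, rfl⟩ hx
      obtain ⟨w, rfl⟩ := (Int.prime_three.dvd_mul.1 hx).resolve_left hm3
      exact ⟨w, by push_cast; ring⟩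
    have hs : (m₁ : ℤ) ∣ a - σ * b := ⟨k, hk⟩
    have ht := dvd_of_nine_dvd h2
    have hst : (m₁ : ℤ) ∣ σ * b - τ * c := by
      have := dvd_sub ht hs; rwa [sub_sub_sub_cancel_left] at this
    have n1 : ¬ 3 ∣ a - σ * b := fun h => h1' (aux _ hs h)
    have n2 : ¬ 3 ∣ a - τ * c := fun h => h2' (aux _ ht h)
    have n3 : ¬ 3 ∣ σ * b - τ * c := fun h => h3' (aux _ hst h)
    have cases3 : (3 ∣ c ∧ ¬ 3 ∣ a ∧ ¬ 3 ∣ b) ∨ (3 ∣ b ∧ ¬ 3 ∣ a ∧ ¬ 3 ∣ c) ∨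
        (3 ∣ a ∧ ¬ 3 ∣ c ∧ ¬ 3 ∣ b) := by
      clear h1 h2 h1' h2' h3' hk hs ht hst
      rcases hσ with rfl | rfl <;> rcases hτ with rfl | rfl <;> rcases mod_three_cases a with ha' | ha' | ha' <;>
        rcases mod_three_cases b with hb' | hb' | hb' <;>
        rcases mod_three_cases c with hc' | hc' | hc' <;> omega
    rcases cases3 with ⟨e1, e2, e3⟩ | ⟨e1, e2, e3⟩ | ⟨e1, e2, e3⟩
    · exact inSecondList_of_not_nine_dvd' hn₀ hodd' h3 hG hD hrole e1 e2 e3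
    · rw [pmSet_swap_right]
      exact inSecondList_of_not_nine_dvd' hn₀ hodd' h3 hG.swap_right hD
        (fun m hm => (hrole m hm).swap_right) e1 e2 e3
    · rw [pmSet_swap_left, pmSet_swap_right, pmSet_swap_left]
      exact inSecondList_of_not_nine_dvd' hn₀ hodd' h3 hG.swap_left.swap_right.swap_left hD
        (fun m hm => (hrole m hm).swap_left.swap_right.swap_left) e1 e2 e3

/-! ### Orders of surviving characters and the subgroup of order three -/

theorem DecagonRole.neg_right {m : ℕ} {a b c : ℤ} (h : DecagonRole m a b c) :
    DecagonRole m a b (-c) :=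
  ⟨h.1, h.2.1, h.2.2.1, by rw [mul_neg, dvd_neg]; exact h.2.2.2⟩

theorem DecagonRole.neg_middle {m : ℕ} {a b c : ℤ} (h : DecagonRole m a b c) :
    DecagonRole m a (-b) c :=
  ⟨h.1, h.2.1, by rw [mul_neg, dvd_neg]; exact h.2.2.1, h.2.2.2⟩

theorem DecagonRole.neg_left {m : ℕ} {a b c : ℤ} (h : DecagonRole m a b c) :
    DecagonRole m (-a) b c :=
  ⟨by rw [mul_neg, dvd_neg]; exact h.1, by rw [mul_neg, dvd_neg]; exact h.2.1, h.2.2⟩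

theorem DecagonRole.three_dvd {m : ℕ} {a b c : ℤ} (h : DecagonRole m a b c) : 3 ∣ m := by
  have h1 : (m : ℤ) ∣ 3 * (2 * a) := by rw [← mul_assoc]; exact h.1
  obtain ⟨m₁, rfl, -⟩ := three_dvd_of_dvd_three_mul h1 h.2.1
  exact dvd_mul_right _ _

/-- The orders of the characters whose vanishing forces a relation modulo three. -/
def TernaryRole (m : ℕ) (a b c : ℤ) : Prop :=
  ThirdRole m a b c ∨ DecagonRole m a b c ∨ DecagonRole m b a c ∨ DecagonRole m c a b

namespace TernaryRole
variable {m : ℕ} {a b c : ℤ}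

theorem neg_right (h : TernaryRole m a b c) : TernaryRole m a b (-c) := by
  rcases h with h | h | h | h
  · exact Or.inl h.neg_right
  · exact Or.inr (Or.inl h.neg_right)
  · exact Or.inr (Or.inr (Or.inl h.neg_right))
  · exact Or.inr (Or.inr (Or.inr h.neg_left))

theorem neg_middle (h : TernaryRole m a b c) : TernaryRole m a (-b) c := by
  rcases h with h | h | h | h
  · exact Or.inl h.neg_middle
  · exact Or.inr (Or.inl h.neg_middle)
  · exact Or.inr (Or.inr (Or.inl h.neg_left))
  · exact Or.inr (Or.inr (Or.inr h.neg_right))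

theorem three_dvd (h : TernaryRole m a b c) : 3 ∣ m := by
  rcases h with h | h | h | h <;> exact h.three_dvd

end TernaryRole

/-- Three divides none of the generators, which excludes decagon roles and makes all signs +1. The
order m₀, full at 3, divides 3(a - b). If m ∣ k, this yields m ∣ t(a - b); together with m ∣ 3(a -
b) and 3 ∤ t it gives m ∣ a - b, which the third role forbids. -/
theorem not_dvd_third_of_congruent {k : ℕ} {a b c : ℤ}
    (hG : IsGenericTriple (3 * k) a b c) {D : Set ℕ} (hrole : ∀ m ∈ D, TernaryRole m a b c)
    {m₀ t : ℕ} (hm₀ : m₀ ∈ D) (ht : 3 * k = m₀ * t) (ht3 : ¬ 3 ∣ t)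
    (hab : 3 ∣ a - b) (hac : 3 ∣ a - c) {m : ℕ} (hm : m ∈ D) : ¬ m ∣ k := by
  have ha : ¬ 3 ∣ a := fun ha => hG.gen 3 Nat.prime_three (dvd_mul_right 3 k) ha
    (by push_cast; omega) (by push_cast; omega)
  have third : ∀ m ∈ D, ThirdRole m a b c := fun m hm => by
    have h3 : (3 : ℤ) ∣ m := by exact_mod_cast (hrole m hm).three_dvd
    rcases hrole m hm with h | h | h | h
    · exact h
    all_goals
      exfalso
      have := h3.trans h.2.2.1
      have := h3.trans h.2.2.2
      omega
  obtain ⟨e0, -, -⟩ := (third m₀ hm₀).eq_of_congruent ha hab hac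
  obtain ⟨e1, -, e2⟩ := (third m hm).eq_of_congruent ha hab hac
  rintro ⟨s, rfl⟩
  apply e2
  have h1 : (m : ℤ) ∣ t * (a - b) := by
    obtain ⟨w, hw⟩ := e0
    refine ⟨s * w, ?_⟩
    have ht' : (3 * (m * s) : ℤ) = m₀ * t := by exact_mod_cast ht
    have : 3 * (t * (a - b)) = 3 * (m * (s * w)) := by
      linear_combination (t : ℤ) * hw - w * ht'
    linarith
  have hcop : IsCoprime (3 : ℤ) t := by
    have : Nat.Coprime 3 t := (Nat.Prime.coprime_iff_not_dvd Nat.prime_three).2 ht3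
    exact_mod_cast Nat.isCoprime_iff_coprime.2 this
  obtain ⟨u, v, huv⟩ := hcop
  have : a - b = u * (3 * (a - b)) + v * (t * (a - b)) := by linear_combination (-(a - b)) * huv
  rw [this]
  exact dvd_add (e1.mul_left _) (h1.mul_left _)

/-- Every vanishing character is nontrivial on the subgroup of order three. -/
theorem exists_third_of_orders {n : ℕ} (hn : 1 < n) {a b c : ℤ}
    (hG : IsGenericTriple n a b c) {D : Set ℕ} (hD : GeneratesOrder n D)
    (hrole : ∀ m ∈ D, TernaryRole m a b c) : ∃ k, n = 3 * k ∧ ∀ m ∈ D, ¬ m ∣ k := by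
  obtain ⟨m, hm⟩ := hD.nonempty hn
  obtain ⟨k, rfl⟩ : 3 ∣ n := (hrole m hm).three_dvd.trans (hD.dvd m hm)
  refine ⟨k, rfl, ?_⟩
  by_cases h9 : 9 ∣ 3 * k
  · obtain ⟨m₀, hm₀, t, ht, ht3⟩ := hD.exists_full (by omega) Nat.prime_three (dvd_mul_right 3 k)
    have h9m := nine_dvd_of_full h9 ht ht3
    have h9' : (9 : ℤ) ∣ m₀ := by exact_mod_cast h9m
    have third : ThirdRole m₀ a b c := by
      -- A decagon role modulo a multiple of 9 would make 3 divide all three generators.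
      have gen := hG.gen 3 Nat.prime_three (dvd_mul_right 3 k)
      rcases hrole m₀ hm₀ with h | h | h | h
      · exact h
      all_goals
        exfalso
        have h1 := h9'.trans h.1
        have h2 := h9'.trans h.2.2.1
        have h3 := h9'.trans h.2.2.2
        exact gen (by push_cast; omega) (by push_cast; omega) (by push_cast; omega)
    obtain ⟨σ, τ, hσ, hτ, hab, hac⟩ := third.congruent_of_nine_dvd h9m
    intro m hm
    have main : ∀ b : ℤ, IsGenericTriple (3 * k) a b c → (∀ m ∈ D, TernaryRole m a b c) →
        3 ∣ a - b → ¬ m ∣ k := by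
      intro b hG hrole hab
      rcases hτ with rfl | rfl
      · exact not_dvd_third_of_congruent hG hrole hm₀ ht ht3 hab (by simpa using hac) hm
      · exact not_dvd_third_of_congruent hG.neg_right (fun m hm => (hrole m hm).neg_right) hm₀ ht
          ht3 hab (by simpa using hac) hm
    rcases hσ with rfl | rfl
    · exact main b hG hrole (by simpa using hab)
    · exact main (-b) hG.neg_middle (fun m hm => (hrole m hm).neg_middle) (by simpa using hab)
  -- When 9 ∤ n, the divisibility 3 ∣ m alone prevents m from dividing k.
  · intro m hm hmk
    have := (hrole m hm).three_dvd.trans hmk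
    omega

/-! ### Labellings for the first list -/

theorem IsCentredLabelling.of_unitMul {n : ℕ} {S : Finset (ZMod n)} {q : (ZMod n)ˣ}
    {g : ZMod n → ℤ} (h : IsCentredLabelling n (unitMul q S) g) :
    IsCentredLabelling n S fun x => g ((q : ZMod n) * x) where
  injective x y hxy := q.mul_right_inj.1 (h.injective hxy)
  lower x := h.lower _
  upper x := h.upper _
  parity x := h.parity _
  sum_eq_zero v := by
    have h1 := h.sum_eq_zero ((q : ZMod n) * v)
    rw [unitMul, sum_image fun a _ b _ hab => q.mul_right_inj.1 hab] at h1
    simpa only [mul_add] using h1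

theorem card_unitMul {n : ℕ} (q : (ZMod n)ˣ) (S : Finset (ZMod n)) :
    (unitMul q S).card = S.card :=
  card_image_of_injective _ fun _ _ h => q.mul_right_inj.1 h

theorem val_add_natCast_cases {n : ℕ} [NeZero n] (v : ZMod n) {t : ℕ} (ht : t < n) :
    (v + (t : ZMod n)).val = v.val + t ∧ v.val + t < n ∨
    (v + (t : ZMod n)).val = v.val + t - n ∧ n ≤ v.val + t := by
  have h1 := ZMod.val_natCast_of_lt ht
  by_cases h : v.val + t < n
  · left
    rw [ZMod.val_add_of_lt (by rw [h1]; exact h), h1]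
    exact ⟨rfl, h⟩
  · right
    rw [ZMod.val_add_of_le (by rw [h1]; omega), h1]
    exact ⟨rfl, by omega⟩

/-- The connection set splits into pairs that differ by 2n₀: n₀ and -n₀, 2n₀ - x and -x, x and -(2n₀
- x). It suffices that the labelling changes sign under the half turn, so the positive odd numbers
go on one half and their negatives on the other. -/
theorem exists_labelling_of_half_turn {n₀ : ℕ} (hn₀ : 0 < n₀) {x : ZMod (4 * n₀)}
    (hcard : (pmSet x (n₀ : ZMod (4 * n₀)) (2 * n₀ - x)).card = 6) :
    ∃ g, IsCentredLabelling (4 * n₀) (pmSet x (n₀ : ZMod (4 * n₀)) (2 * n₀ - x)) g := by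
  have : NeZero (4 * n₀) := ⟨by omega⟩
  set g : ZMod (4 * n₀) → ℤ := fun v =>
    if v.val < 2 * n₀ then 2 * v.val + 1 else -(2 * (v.val - 2 * n₀) + 1) with hg
  have hlt : ∀ v : ZMod (4 * n₀), v.val < 4 * n₀ := fun v => ZMod.val_lt v
  have hanti : ∀ v, g (v + ((2 * n₀ : ℕ) : ZMod (4 * n₀))) = -g v := fun v => by
    have := hlt v
    simp only [hg]
    rcases val_add_natCast_cases v (t := 2 * n₀) (by omega) with ⟨h, h'⟩ | ⟨h, h'⟩ <;>
      rw [h] <;> split_ifs <;> push_cast <;> omega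
  have h4 : (4 * n₀ : ZMod (4 * n₀)) = 0 := by exact_mod_cast ZMod.natCast_self (4 * n₀)
  refine ⟨g, ⟨fun v w h => ?_, fun v => ?_, fun v => ?_, fun v => ?_, fun v => ?_⟩⟩
  · apply ZMod.val_injective
    simp only [hg] at h
    split_ifs at h <;> omega
  · have := hlt v; simp only [hg]; split_ifs <;> push_cast <;> omega
  · have := hlt v; simp only [hg]; split_ifs <;> push_cast <;> omega
  · have := hlt v; simp only [hg]; split_ifs <;> push_cast <;> omega
  · rw [sum_pmSet hcard]
    have e1 := hanti (v + -x)
    have e2 := hanti (v + -(2 * n₀ - x))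
    have e3 := hanti (v + -(n₀ : ZMod (4 * n₀)))
    have f1 : v + -x + ((2 * n₀ : ℕ) : ZMod (4 * n₀)) = v + (2 * n₀ - x) := by push_cast; ring
    have f2 : v + -(2 * n₀ - x) + ((2 * n₀ : ℕ) : ZMod (4 * n₀)) = v + x := by push_cast; ring
    have f3 : v + -(n₀ : ZMod (4 * n₀)) + ((2 * n₀ : ℕ) : ZMod (4 * n₀)) = v + n₀ := by
      push_cast; ring
    rw [f1] at e1
    rw [f2] at e2
    rw [f3] at e3
    rw [e1, e2, e3]; ring

theorem val_add_intCast {n : ℕ} [NeZero n] (v : ZMod n) (t : ℤ) :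
    ∃ k : ℤ, ((v + (t : ZMod n)).val : ℤ) = v.val + (t + n * k) := by
  have h : ((((v + (t : ZMod n)).val : ℤ)) : ZMod n) = ((v.val + t : ℤ) : ZMod n) := by
    push_cast
    simp only [ZMod.natCast_val, ZMod.cast_id', id]
  rw [eq_comm, ZMod.intCast_eq_intCast_iff_dvd_sub] at h
  obtain ⟨k, hk⟩ := h
  exact ⟨k, by linarith⟩

/-- `p` is odd and divisible by `d`, and `q`, `r` differ up to sign by `2` modulo `4` and by `0`
modulo `d`. -/
def QuarterCancels (d : ℕ) (p q r : ℤ) : Prop :=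
  ¬ 2 ∣ p ∧ (d : ℤ) ∣ p ∧ ∃ σ : ℤ, (σ = 1 ∨ σ = -1) ∧ (r - σ * q) % 4 = 2 ∧ (d : ℤ) ∣ r - σ * q

/-- The points v ± p differ by 2p, and v ± r differ from v ± σq by ±(r - σq); all these shifts are 2
modulo 4 and 0 modulo d, so the terms cancel in pairs. Representatives do not matter because 4 and d
divide n. -/
theorem QuarterCancels.sum_eq_zero {n d : ℕ} [NeZero n] (h4 : 4 ∣ n) (hd : d ∣ n) {p q r : ℤ}
    (h : QuarterCancels d p q r) {H : ℤ → ℤ}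
    (hH : ∀ x t : ℤ, t % 4 = 2 → (d : ℤ) ∣ t → H (x + t) = -H x) (v : ZMod n) :
    H (v + (p : ZMod n)).val + H (v + -(p : ZMod n)).val + H (v + (q : ZMod n)).val +
      H (v + -(q : ZMod n)).val + H (v + (r : ZMod n)).val + H (v + -(r : ZMod n)).val = 0 := by
  have anti : ∀ (v w : ZMod n) (t : ℤ), t % 4 = 2 → (d : ℤ) ∣ t → w = v + (t : ZMod n) →
      H w.val = -H v.val := by
    rintro v w t h1 h2 rfl
    obtain ⟨k, hk⟩ := val_add_intCast v t
    rw [hk]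
    have h4' : (4 : ℤ) ∣ n := by exact_mod_cast h4
    have hd' : (d : ℤ) ∣ n := by exact_mod_cast hd
    refine hH _ _ ?_ (dvd_add h2 (hd'.mul_right k))
    have := h4'.mul_right k
    omega
  obtain ⟨hp2, hpd, σ, hσ, h1, h2⟩ := h
  rw [anti (v + -(p : ZMod n)) (v + p) (2 * p) (by omega) (hpd.mul_left 2) (by push_cast; ring)]
  rcases hσ with rfl | rfl
  · rw [anti (v + (q : ZMod n)) (v + r) _ h1 h2 (by push_cast; ring),
      anti (v + -(r : ZMod n)) (v + -q) _ h1 h2 (by push_cast; ring)]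
    ring
  · rw [anti (v + -(q : ZMod n)) (v + r) _ h1 h2 (by push_cast; ring),
      anti (v + -(r : ZMod n)) (v + q) _ h1 h2 (by push_cast; ring)]
    ring

theorem sum_pmSet_eq_zero_of_quarterCancels {n d : ℕ} [NeZero n] (h4 : 4 ∣ n) (hd : d ∣ n)
    {x y z : ℤ} (hcard : (pmSet (x : ZMod n) y z).card = 6)
    (h : QuarterCancels d x y z ∨ QuarterCancels d y x z ∨ QuarterCancels d z x y) {H : ℤ → ℤ}
    (hH : ∀ x t : ℤ, t % 4 = 2 → (d : ℤ) ∣ t → H (x + t) = -H x) (v : ZMod n) :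
    ∑ s ∈ pmSet (x : ZMod n) y z, H (v + s).val = 0 := by
  rw [sum_pmSet hcard]
  rcases h with h | h | h
  · exact h.sum_eq_zero h4 hd hH v
  · have := h.sum_eq_zero h4 hd hH v; linarith
  · have := h.sum_eq_zero h4 hd hH v; linarith

theorem digit_bounds {y z d e : ℤ} (hy : 0 ≤ y) (hyd : y < d) (hz : 0 ≤ z) (hze : z < e) :
    0 ≤ y + d * z ∧ y + d * z < d * e := by
  constructor
  · have : 0 ≤ d * z := mul_nonneg (by linarith) hz
    linarith
  · have : d * (z + 1) ≤ d * e := mul_le_mul_of_nonneg_left (by linarith) (by linarith)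
    linarith

theorem digits_unique {y z y' z' d : ℤ} (hd : 0 < d) (h1 : y - y' < d) (h2 : y' - y < d)
    (h : y + d * z = y' + d * z') : y = y' ∧ z = z' := by
  have h3 : d ∣ y - y' := ⟨z' - z, by linear_combination h⟩
  have h4 : y - y' = 0 := Int.eq_zero_of_abs_lt_dvd h3 (by rw [abs_lt]; constructor <;> linarith)
  have h5 : y = y' := by linarith
  refine ⟨h5, ?_⟩
  rw [h5] at h
  exact mul_left_cancel₀ hd.ne' (add_left_cancel h)

theorem odd_natCast_not_two_dvd {d : ℕ} (h : Odd d) : ¬ (2 : ℤ) ∣ d :=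
  not_two_dvd_of_dvd dvd_rfl h

/-- The label is a sign depending on u modulo 4 times 1 + 2N, where N is the mixed-radix number with
digits u modulo d₁, d₂, d₃ and 2. The sign and the parity digit recover u modulo 4, so the Chinese
remainder theorem gives injectivity. -/
theorem exists_labelling_of_quarterCancels {n₀ d₁ d₂ d₃ : ℕ}
    (hn₀ : n₀ = d₁ * d₂ * d₃) (o1 : Odd d₁) (o2 : Odd d₂)
    (o3 : Odd d₃) (c12 : d₁.Coprime d₂) (c13 : d₁.Coprime d₃) (c23 : d₂.Coprime d₃) {x y z : ℤ}
    (hcard : (pmSet (x : ZMod (4 * n₀)) y z).card = 6)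
    (h : ∀ d, d = d₁ ∨ d = d₂ ∨ d = d₃ →
      QuarterCancels d x y z ∨ QuarterCancels d y x z ∨ QuarterCancels d z x y) :
    ∃ g, IsCentredLabelling (4 * n₀) (pmSet (x : ZMod (4 * n₀)) y z) g := by
  subst hn₀
  have p1 := o1.pos
  have p2 := o2.pos
  have p3 := o3.pos
  have q1 : (0 : ℤ) < d₁ := by exact_mod_cast p1
  have q2 : (0 : ℤ) < d₂ := by exact_mod_cast p2
  have q3 : (0 : ℤ) < d₃ := by exact_mod_cast p3
  have : NeZero (4 * (d₁ * d₂ * d₃)) := ⟨by positivity⟩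
  set sg : ℤ → ℤ := fun u => if u % 4 < 2 then 1 else -1 with hsg
  set N : ℤ → ℤ := fun u => u % d₁ + d₁ * (u % d₂ + d₂ * (u % d₃ + d₃ * (u % 2))) with hN
  set G : ℤ → ℤ := fun u => sg u * (1 + 2 * N u) with hG
  have hsg' : ∀ u, sg u = 1 ∧ u % 4 < 2 ∨ sg u = -1 ∧ ¬ u % 4 < 2 := fun u => by
    simp only [hsg]; split_ifs with h <;> simp [h]
  have hsgt : ∀ u t : ℤ, t % 4 = 2 → sg (u + t) = -sg u := fun u t ht => by
    rcases hsg' u with ⟨h1, h2⟩ | ⟨h1, h2⟩ <;> rcases hsg' (u + t) with ⟨h3, h4⟩ | ⟨h3, h4⟩ <;>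
      rw [h1, h3] <;> omega
  have hNb : ∀ u, 0 ≤ N u ∧ N u < d₁ * (d₂ * (d₃ * 2)) := fun u => by
    have b1 := digit_bounds (Int.emod_nonneg u q3.ne') (Int.emod_lt_of_pos u q3)
      (Int.emod_nonneg u (b := 2) (by norm_num)) (Int.emod_lt_of_pos u (b := 2) (by norm_num))
    have b2 := digit_bounds (Int.emod_nonneg u q2.ne') (Int.emod_lt_of_pos u q2) b1.1 b1.2
    exact digit_bounds (Int.emod_nonneg u q1.ne') (Int.emod_lt_of_pos u q1) b2.1 b2.2
  have hcast : ((4 * (d₁ * d₂ * d₃) : ℕ) : ℤ) = 4 * (d₁ * d₂ * d₃) := by push_cast; ring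
  refine ⟨fun v => G v.val, ⟨fun v w hvw => ?_, fun v => ?_, fun v => ?_, fun v => ?_, fun v => ?_⟩⟩
  · simp only [hG] at hvw
    have n1 := hNb v.val
    have n2 := hNb w.val
    have hs : (sg v.val = sg w.val ∧ ((v.val : ℤ) % 4 < 2 ↔ (w.val : ℤ) % 4 < 2)) ∧
        N v.val = N w.val := by
      rcases hsg' v.val with ⟨h1, h2⟩ | ⟨h1, h2⟩ <;> rcases hsg' w.val with ⟨h3, h4⟩ | ⟨h3, h4⟩ <;>
        rw [h1, h3] at hvw ⊢ <;> refine ⟨⟨?_, ?_⟩, ?_⟩ <;> omega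
    obtain ⟨⟨-, hs1⟩, hs2⟩ := hs
    generalize ha : (v.val : ℤ) = A at *
    generalize hb : (w.val : ℤ) = B at *
    have dig : ∀ (d : ℤ), 0 < d → A % d - B % d < d ∧ B % d - A % d < d := fun d hd => by
      have := Int.emod_nonneg A hd.ne'
      have := Int.emod_nonneg B hd.ne'
      have := Int.emod_lt_of_pos A hd
      have := Int.emod_lt_of_pos B hd
      constructor <;> linarith
    obtain ⟨m1, r1⟩ := digits_unique q1 (dig _ q1).1 (dig _ q1).2 hs2
    obtain ⟨m2, r2⟩ := digits_unique q2 (dig _ q2).1 (dig _ q2).2 r1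
    obtain ⟨m3, r3⟩ := digits_unique q3 (dig _ q3).1 (dig _ q3).2 r2
    have m4 : (4 : ℤ) ∣ B - A := by omega
    have i1 : (d₁ : ℤ) ∣ B - A := Int.ModEq.dvd m1
    have i2 : (d₂ : ℤ) ∣ B - A := Int.ModEq.dvd m2
    have i3 : (d₃ : ℤ) ∣ B - A := Int.ModEq.dvd m3
    have c4 : Nat.Coprime 4 (d₁ * d₂ * d₃) := by
      have : Nat.Coprime 2 (d₁ * d₂ * d₃) := Nat.coprime_two_left.2 ((o1.mul o2).mul o3)
      exact this.pow_left 2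
    have key : ((4 * (d₁ * d₂ * d₃) : ℕ) : ℤ) ∣ B - A := by
      rw [hcast]
      have c4' : IsCoprime (4 : ℤ) (d₁ * d₂ * d₃) := by
        exact_mod_cast Nat.isCoprime_iff_coprime.2 c4
      have c3' : IsCoprime (d₁ * d₂ : ℤ) d₃ := by
        exact_mod_cast Nat.isCoprime_iff_coprime.2 (c13.mul_left c23)
      exact c4'.mul_dvd m4 (c3'.mul_dvd ((Nat.isCoprime_iff_coprime.2 c12).mul_dvd i1 i2) i3)
    rw [← ZMod.intCast_eq_intCast_iff_dvd_sub, ← ha, ← hb] at key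
    rwa [Int.cast_natCast, Int.cast_natCast, ZMod.natCast_zmod_val, ZMod.natCast_zmod_val] at key
  · have := hNb v.val
    simp only [hG]
    rw [hcast]
    rcases hsg' v.val with ⟨h1, -⟩ | ⟨h1, -⟩ <;> rw [h1] <;> linarith
  · have := hNb v.val
    simp only [hG]
    rw [hcast]
    rcases hsg' v.val with ⟨h1, -⟩ | ⟨h1, -⟩ <;> rw [h1] <;> linarith
  · simp only [hG]
    rw [hcast]
    rcases hsg' v.val with ⟨h1, -⟩ | ⟨h1, -⟩ <;> rw [h1] <;> omega
  · have hmod : ∀ (d : ℕ) (u t : ℤ), (d : ℤ) ∣ t → (u + t) % d = u % d := fun d u t ⟨k, hk⟩ => by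
      rw [hk, Int.add_mul_emod_self_left]
    have hmod2 : ∀ u t : ℤ, t % 4 = 2 → (u + t) % 2 = u % 2 := fun u t h => by omega
    have hn4 : 4 ∣ 4 * (d₁ * d₂ * d₃) := dvd_mul_right _ _
    -- No single step preserves all the digits, so the label is split into three summands, one per
    -- dᵢ, each with its own cancellation. The constant 1 and the parity digit are unchanged by
    -- steps that are 2 modulo 4 and join the first summand.
    have s1 := sum_pmSet_eq_zero_of_quarterCancels hn4 (d := d₁) ⟨4 * d₂ * d₃, by ring⟩ hcard
      (h _ (Or.inl rfl))
      (H := fun u => sg u * (1 + 2 * (u % d₁) + 2 * d₁ * d₂ * d₃ * (u % 2)))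
      (fun u t h1 h2 => by simp only [hsgt u t h1, hmod d₁ u t h2, hmod2 u t h1]; ring) v
    have s2 := sum_pmSet_eq_zero_of_quarterCancels hn4 (d := d₂) ⟨4 * d₁ * d₃, by ring⟩ hcard
      (h _ (Or.inr (Or.inl rfl)))
      (H := fun u => sg u * (2 * d₁ * (u % d₂)))
      (fun u t h1 h2 => by simp only [hsgt u t h1, hmod d₂ u t h2]; ring) v
    have s3 := sum_pmSet_eq_zero_of_quarterCancels hn4 (d := d₃) ⟨4 * d₁ * d₂, by ring⟩ hcard
      (h _ (Or.inr (Or.inr rfl)))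
      (H := fun u => sg u * (2 * d₁ * d₂ * (u % d₃)))
      (fun u t h1 h2 => by simp only [hsgt u t h1, hmod d₃ u t h2]; ring) v
    have := congrArg₂ (· + ·) (congrArg₂ (· + ·) s1 s2) s3
    simp only [← sum_add_distrib, add_zero] at this
    rw [← this]
    refine sum_congr rfl fun s _ => ?_
    simp only [hG, hN]
    ring

theorem exists_labelling_of_inFirstList {n : ℕ} {S : Finset (ZMod n)} (hS : S.card = 6)
    (h : InFirstList n S) : ∃ g, IsCentredLabelling n S g := by
  obtain ⟨n₀, hn₀, rfl, h⟩ := h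
  have transfer : ∀ (q : (ZMod (4 * n₀))ˣ) (x y z : ZMod (4 * n₀)),
      unitMul q S = pmSet x y z → ((pmSet x y z).card = 6 → ∃ g, IsCentredLabelling _ (pmSet x y z) g) →
      ∃ g, IsCentredLabelling (4 * n₀) S g := fun q x y z hq hg => by
    rw [← hq, card_unitMul] at hg
    obtain ⟨g, hg⟩ := hg hS
    exact ⟨_, hg.of_unitMul⟩
  rcases h with ⟨q, hq⟩ | ⟨q, hq⟩ | ⟨d, d', rfl, od, od', hc, hd, hdd, -, c', ⟨-, -, e4, ed, ed'⟩, q, hq⟩ |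
    ⟨d, d', d'', rfl, od, od', od'', c1, c2, c3, -, -, -, -, b', c', ⟨⟨⟨-, -, b4, bd', bd''⟩, -⟩, -⟩,
      ⟨-, -, e4, ed, ed', ed''⟩, q, hq⟩
  · exact transfer q _ _ _ hq fun hcard => exists_labelling_of_half_turn (by omega) hcard
  · exact transfer q _ _ _ hq fun hcard => exists_labelling_of_half_turn (by omega) hcard
  · refine transfer q _ _ _ hq fun hcard => ?_
    have e4 := Int.modEq_zero_iff_dvd.1 e4
    have ed := (dvd_sub_comm).1 (Int.modEq_iff_dvd.1 ed)
    have ed' := (dvd_sub_comm).1 (Int.modEq_iff_dvd.1 ed')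
    have hodd := odd_natCast_not_two_dvd (od.mul od')
    -- The third factor is taken to be 1; n₀ = dd' is the odd element for every factor, and 2, c'
    -- cancel with sign +1 modulo d and -1 modulo d'.
    have key := exists_labelling_of_quarterCancels (mul_one (d * d')).symm od od' odd_one hc (Nat.coprime_one_right d)
      (Nat.coprime_one_right d') (x := 2) (y := (d * d' : ℕ)) (z := c')
    simp only [Int.cast_natCast, Int.cast_ofNat] at key
    refine key hcard ?_
    rintro e (rfl | rfl | rfl)
    · exact Or.inr (Or.inl ⟨hodd, by push_cast; exact dvd_mul_right _ _, 1, Or.inl rfl, by omega,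
        by simpa using ed⟩)
    · exact Or.inr (Or.inl ⟨hodd, by push_cast; exact dvd_mul_left _ _, -1, Or.inr rfl, by omega,
        by simpa using ed'⟩)
    · exact Or.inr (Or.inl ⟨hodd, by simp, 1, Or.inl rfl, by omega, by simp⟩)
  · refine transfer q _ _ _ hq fun hcard => ?_
    have b4 := Int.modEq_iff_dvd.1 b4
    have e4 := Int.modEq_iff_dvd.1 e4
    have hodd := odd_natCast_not_two_dvd od
    have ed := (dvd_sub_comm).1 (Int.modEq_iff_dvd.1 ed)
    have ed' := (dvd_sub_comm).1 (Int.modEq_iff_dvd.1 ed')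
    have ed'' := Int.modEq_zero_iff_dvd.1 ed''
    have bd' := Int.modEq_zero_iff_dvd.1 bd'
    have bd'' := (dvd_sub_comm).1 (Int.modEq_iff_dvd.1 bd'')
    have key := exists_labelling_of_quarterCancels rfl od od' od'' c1 c2 c3 (x := d) (y := b') (z := c')
    simp only [Int.cast_natCast] at key
    refine key hcard ?_
    rintro e (rfl | rfl | rfl)
    · exact Or.inl ⟨hodd, dvd_rfl, -1, Or.inr rfl, by omega, by simpa using ed⟩
    · exact Or.inr (Or.inl ⟨by omega, bd', -1, Or.inr rfl, by omega, by simpa using ed'⟩)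
    · exact Or.inr (Or.inr ⟨by omega, ed'', -1, Or.inr rfl, by omega, by simpa using bd''⟩)

/-! ### Labellings for the second list -/

/-- The entries of a `3 × d` array, for odd `d`, whose rows are permutations of the integers of
absolute value at most `d / 2` and whose columns sum to zero. -/
def kotzigEntry (d ε y : ℤ) : ℤ :=
  if ε = 0 then y - d / 2
  else if ε = 1 then if y % 2 = 0 then -(y / 2) else d / 2 - y / 2
  else if y % 2 = 0 then d / 2 - y / 2 else -1 - y / 2

theorem kotzigEntry_column_sum (d y : ℤ) :
    kotzigEntry d 0 y + kotzigEntry d 1 y + kotzigEntry d 2 y = 0 := by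
  simp only [kotzigEntry]
  split_ifs <;> omega

theorem kotzigEntry_bounds {d y : ℤ} (hd : d % 2 = 1) (hy : 0 ≤ y) (hyd : y < d) (ε : ℤ) :
    -(d / 2) ≤ kotzigEntry d ε y ∧ kotzigEntry d ε y ≤ d / 2 := by
  simp only [kotzigEntry]
  split_ifs <;> omega

theorem kotzigEntry_injective {d y y' ε : ℤ} (hd : d % 2 = 1) (hy : 0 ≤ y) (hyd : y < d)
    (hy' : 0 ≤ y') (hyd' : y' < d) (h : kotzigEntry d ε y = kotzigEntry d ε y') : y = y' := by
  simp only [kotzigEntry] at h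
  split_ifs at h <;> omega

theorem odd_natCast_emod_two {d : ℕ} (h : Odd d) : (d : ℤ) % 2 = 1 := by
  obtain ⟨k, rfl⟩ := h
  omega

/-- The neighbours of v form two cosets of the subgroup of order three, those of v + 1 and v - 1.
Writing v = n₀ e + y, the label 2(3K + e - 1) takes K from row e and column y of the array, so it
sums to zero over each coset. -/
theorem exists_labelling_of_third_turn {n₀ : ℕ} (hodd : Odd n₀)
    (hcard : (pmSet 1 ((n₀ : ZMod (3 * n₀)) - 1) ((n₀ : ZMod (3 * n₀)) + 1)).card = 6) :
    ∃ g, IsCentredLabelling (3 * n₀) (pmSet 1 ((n₀ : ZMod (3 * n₀)) - 1) ((n₀ : ZMod (3 * n₀)) + 1)) g := by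
  have hn₀ := hodd.pos
  have hodd' := odd_natCast_emod_two hodd
  have : NeZero (3 * n₀) := ⟨by omega⟩
  set e : ZMod (3 * n₀) → ℤ := fun v =>
    if v.val < n₀ then 0 else if v.val < 2 * n₀ then 1 else 2 with he
  set K : ZMod (3 * n₀) → ℤ := fun v => kotzigEntry n₀ (e v) (v.val - n₀ * e v) with hK
  have hlt : ∀ v : ZMod (3 * n₀), v.val < 3 * n₀ := fun v => ZMod.val_lt v
  have he' : ∀ v, (e v = 0 ∧ v.val < n₀) ∨ (e v = 1 ∧ n₀ ≤ v.val ∧ v.val < 2 * n₀) ∨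
      (e v = 2 ∧ 2 * n₀ ≤ v.val) := fun v => by
    simp only [he]
    split_ifs <;> simp <;> omega
  have hy : ∀ v, 0 ≤ v.val - n₀ * e v ∧ v.val - n₀ * e v < n₀ := fun v => by
    have := hlt v
    rcases he' v with ⟨h, h'⟩ | ⟨h, h', h''⟩ | ⟨h, h'⟩ <;> rw [h] <;> omega
  have hb : ∀ v, -((n₀ : ℤ) / 2) ≤ K v ∧ K v ≤ (n₀ : ℤ) / 2 := fun v =>
    kotzigEntry_bounds hodd' (hy v).1 (hy v).2 _
  have hrow : ∀ u v w, v = u + (n₀ : ZMod (3 * n₀)) → w = v + (n₀ : ZMod (3 * n₀)) →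
      2 * (3 * K u + e u - 1) + 2 * (3 * K v + e v - 1) + 2 * (3 * K w + e w - 1) = 0 := by
    rintro u v w rfl rfl
    have h1 := val_add_natCast_cases u (t := n₀) (by omega)
    have h2 := val_add_natCast_cases (u + (n₀ : ZMod (3 * n₀))) (t := n₀) (by omega)
    have hu := hlt u
    generalize u + (n₀ : ZMod (3 * n₀)) = v at *
    generalize v + (n₀ : ZMod (3 * n₀)) = w at *
    have eu := he' u
    have ev := he' v
    have ew := he' w
    have key : ∀ y : ℤ, (e u = 0 ∧ e v = 1 ∧ e w = 2 ∨ e u = 1 ∧ e v = 2 ∧ e w = 0 ∨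
        e u = 2 ∧ e v = 0 ∧ e w = 1) → u.val - n₀ * e u = y → v.val - n₀ * e v = y →
        w.val - n₀ * e w = y →
      2 * (3 * K u + e u - 1) + 2 * (3 * K v + e v - 1) + 2 * (3 * K w + e w - 1) = 0 := by
      intro y h hu hv hw
      have := kotzigEntry_column_sum n₀ y
      simp only [hK, hu, hv, hw]
      rcases h with ⟨h1, h2, h3⟩ | ⟨h1, h2, h3⟩ | ⟨h1, h2, h3⟩ <;> rw [h1, h2, h3] <;> linarith
    refine key (u.val - n₀ * e u) ?_ rfl ?_ ?_
    · omega
    · rcases eu with ⟨a, a'⟩ | ⟨a, a', a''⟩ | ⟨a, a'⟩ <;> rcases ev with ⟨b, b'⟩ | ⟨b, b', b''⟩ | ⟨b, b'⟩ <;>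
        rw [a, b] <;> omega
    · rcases eu with ⟨a, a'⟩ | ⟨a, a', a''⟩ | ⟨a, a'⟩ <;> rcases ew with ⟨b, b'⟩ | ⟨b, b', b''⟩ | ⟨b, b'⟩ <;>
        rw [a, b] <;> omega
  have h3 : (3 * n₀ : ZMod (3 * n₀)) = 0 := by exact_mod_cast ZMod.natCast_self (3 * n₀)
  have he3 : ∀ v, 0 ≤ e v ∧ e v ≤ 2 := fun v => by have := he' v; omega
  refine ⟨fun v => 2 * (3 * K v + e v - 1), ⟨fun v w h => ?_, fun v => ?_, fun v => ?_, fun v => ?_,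
    fun v => ?_⟩⟩
  · have h1 := he3 v
    have h2 := he3 w
    have h4 : e v = e w := by omega
    have h5 : K v = K w := by omega
    simp only [hK, h4] at h5
    have hv := hy v
    rw [h4] at hv
    have := kotzigEntry_injective hodd' hv.1 hv.2 (hy w).1 (hy w).2 h5
    apply ZMod.val_injective
    omega
  · have := hb v; have := he3 v; push_cast; omega
  · have := hb v; have := he3 v; push_cast; omega
  · push_cast; omega
  · rw [sum_pmSet hcard]
    have r1 := hrow (v + -((n₀ : ZMod (3 * n₀)) - 1)) (v + 1) (v + (n₀ + 1)) (by ring) (by ring)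
    have r2 := hrow (v + -((n₀ : ZMod (3 * n₀)) + 1)) (v + -1) (v + (n₀ - 1)) (by ring) (by ring)
    linarith

/-- Up to signs, `x`, `y`, `z` are congruent modulo `d` and pairwise incongruent modulo `3`. -/
def ThirdCancels (d : ℕ) (x y z : ℤ) : Prop :=
  ∃ σ τ : ℤ, (σ = 1 ∨ σ = -1) ∧ (τ = 1 ∨ τ = -1) ∧ (d : ℤ) ∣ σ * y - x ∧ (d : ℤ) ∣ τ * z - x ∧
    ¬ (3 : ℤ) ∣ σ * y - x ∧ ¬ (3 : ℤ) ∣ τ * z - x ∧ ¬ (3 : ℤ) ∣ σ * y - τ * z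

/-- The neighbours split into v + x, v + σy, v + τz and their reflections in v. Each triple agrees
modulo d and meets all classes modulo 3. -/
theorem ThirdCancels.sum_eq_zero {n d : ℕ} [NeZero n] (h3 : 3 ∣ n) (hd : d ∣ n) {x y z : ℤ}
    (hcard : (pmSet (x : ZMod n) y z).card = 6) (h : ThirdCancels d x y z) {H : ℤ → ℤ}
    (hH : ∀ x t u : ℤ, ¬ 3 ∣ t → ¬ 3 ∣ u → ¬ 3 ∣ t - u → (d : ℤ) ∣ t → (d : ℤ) ∣ u →
      H x + H (x + t) + H (x + u) = 0) (v : ZMod n) :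
    ∑ s ∈ pmSet (x : ZMod n) y z, H (v + s).val = 0 := by
  have tri : ∀ (v w w' : ZMod n) (t u : ℤ), ¬ (3 : ℤ) ∣ t → ¬ (3 : ℤ) ∣ u → ¬ (3 : ℤ) ∣ t - u →
      (d : ℤ) ∣ t → (d : ℤ) ∣ u → w = v + (t : ZMod n) → w' = v + (u : ZMod n) →
      H v.val + H w.val + H w'.val = 0 := by
    rintro v w w' t u h1 h2 h4 h5 h6 rfl rfl
    obtain ⟨k, hk⟩ := val_add_intCast v t
    obtain ⟨l, hl⟩ := val_add_intCast v u
    rw [hk, hl]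
    have h3' : (3 : ℤ) ∣ n := by exact_mod_cast h3
    have hd' : (d : ℤ) ∣ n := by exact_mod_cast hd
    have hk3 := h3'.mul_right k
    have hl3 := h3'.mul_right l
    have c1 : ¬ 3 ∣ t + n * k := by rwa [dvd_add_left hk3]
    have c2 : ¬ 3 ∣ u + n * l := by rwa [dvd_add_left hl3]
    have c3 : ¬ 3 ∣ t + n * k - (u + n * l) := by
      rwa [show t + n * k - (u + n * l) = t - u + (n * k - n * l) by ring,
        dvd_add_left (dvd_sub hk3 hl3)]
    exact hH v.val _ _ c1 c2 c3 (dvd_add h5 (hd'.mul_right k)) (dvd_add h6 (hd'.mul_right l))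
  obtain ⟨σ, τ, hσ, hτ, h1, h2, h4, h5, h6⟩ := h
  have h6' : ¬ (3 : ℤ) ∣ σ * y - x - (τ * z - x) := by rwa [sub_sub_sub_cancel_right]
  have r1 := tri (v + (x : ZMod n)) (v + ((σ * y : ℤ) : ZMod n)) (v + ((τ * z : ℤ) : ZMod n)) _ _
    h4 h5 h6' h1 h2 (by push_cast; ring) (by push_cast; ring)
  have r2 := tri (v + -(x : ZMod n)) (v + -((σ * y : ℤ) : ZMod n)) (v + -((τ * z : ℤ) : ZMod n))
    (-(σ * y - x)) (-(τ * z - x)) (by rwa [dvd_neg]) (by rwa [dvd_neg])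
    (by rwa [← neg_sub', dvd_neg]) (h1.neg_right) (h2.neg_right) (by push_cast; ring)
    (by push_cast; ring)
  rw [sum_pmSet hcard]
  rcases hσ with rfl | rfl <;> rcases hτ with rfl | rfl <;>
    simp only [one_mul, neg_mul, Int.cast_neg, neg_neg] at r1 r2 <;> linarith

theorem sum_eq_zero_of_distinct_mod_three {F : ℤ → ℤ} (hF : F 0 + F 1 + F 2 = 0) {x t u : ℤ}
    (ht : ¬ 3 ∣ t) (hu : ¬ 3 ∣ u) (htu : ¬ 3 ∣ t - u) :
    F (x % 3) + F ((x + t) % 3) + F ((x + u) % 3) = 0 := by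
  rw [Int.dvd_iff_emod_eq_zero] at ht hu
  have ht' : t % 3 = 1 ∨ t % 3 = 2 := by omega
  have hx : x % 3 = 0 ∨ x % 3 = 1 ∨ x % 3 = 2 := by omega
  have hu' : u % 3 + t % 3 = 3 := by omega
  rw [Int.add_emod x t, Int.add_emod x u]
  rcases ht' with ht' | ht' <;>
  · have hu'' : u % 3 = 3 - t % 3 := by omega
    rw [hu'', ht']
    rcases hx with hx | hx | hx <;> rw [hx] <;> norm_num <;> linarith

/-- Row u modulo 3 of the arrays for d and d' supplies two balanced digits, combined as K with base
d. The label splits into a summand depending on u modulo 3 and d and one depending on u modulo 3 and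
d', each cancelling by the column sums of its own array. -/
theorem exists_labelling_of_thirdCancels {d d' : ℕ} (o : Odd d) (o' : Odd d')
    (hc : d.Coprime d') (h3 : d.Coprime 3) (h3' : d'.Coprime 3) {x y z : ℤ}
    (hcard : (pmSet (x : ZMod (3 * (d * d'))) y z).card = 6)
    (h : ThirdCancels d x y z) (h' : ThirdCancels d' x y z) :
    ∃ g, IsCentredLabelling (3 * (d * d')) (pmSet (x : ZMod (3 * (d * d'))) y z) g := by
  have q : (0 : ℤ) < d := by exact_mod_cast o.pos
  have q' : (0 : ℤ) < d' := by exact_mod_cast o'.pos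
  have m := odd_natCast_emod_two o
  have m' := odd_natCast_emod_two o'
  have : NeZero (3 * (d * d')) := ⟨by have := o.pos; have := o'.pos; positivity⟩
  set K : ℤ → ℤ := fun u =>
    kotzigEntry d (u % 3) (u % d) + d * kotzigEntry d' (u % 3) (u % d') with hK
  set G : ℤ → ℤ := fun u => 2 * (3 * K u + (u % 3 - 1)) with hG
  have hcast : ((3 * (d * d') : ℕ) : ℤ) = 3 * (d * d') := by push_cast; ring
  have b : ∀ u, -((d : ℤ) / 2) ≤ kotzigEntry d (u % 3) (u % d) ∧
      kotzigEntry d (u % 3) (u % d) ≤ (d : ℤ) / 2 := fun u =>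
    kotzigEntry_bounds m (Int.emod_nonneg u q.ne') (Int.emod_lt_of_pos u q) _
  have b' : ∀ u, -((d' : ℤ) / 2) ≤ kotzigEntry d' (u % 3) (u % d') ∧
      kotzigEntry d' (u % 3) (u % d') ≤ (d' : ℤ) / 2 := fun u =>
    kotzigEntry_bounds m' (Int.emod_nonneg u q'.ne') (Int.emod_lt_of_pos u q') _
  have half : ∀ e : ℤ, e % 2 = 1 → 2 * (e / 2) = e - 1 := fun e he => by omega
  have hb : ∀ u, 2 * K u ≤ d * d' - 1 ∧ -(d * d' - 1) ≤ 2 * K u := fun u => by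
    have h1 := b u
    have h2 := b' u
    have h4 := half _ m
    have h5 := half _ m'
    have h6 : (d : ℤ) * (2 * kotzigEntry d' (u % 3) (u % d')) ≤ d * (d' - 1) :=
      mul_le_mul_of_nonneg_left (by linarith) q.le
    have h7 : (d : ℤ) * (-(d' - 1)) ≤ d * (2 * kotzigEntry d' (u % 3) (u % d')) :=
      mul_le_mul_of_nonneg_left (by linarith) q.le
    simp only [hK]
    constructor <;> linarith
  have hodd : (2 : ℤ) ∣ 3 * (d * d') + 1 := by
    have := odd_natCast_emod_two (o.mul o')
    push_cast at this
    omega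
  refine ⟨fun v => G v.val, ⟨fun v w hvw => ?_, fun v => ?_, fun v => ?_, fun v => ?_, fun v => ?_⟩⟩
  · simp only [hG] at hvw
    generalize hA : (v.val : ℤ) = A at *
    generalize hB : (w.val : ℤ) = B at *
    have e1 : A % 3 = B % 3 := by omega
    have e2 : K A = K B := by omega
    simp only [hK, e1] at e2
    have bA := b A
    have bB := b B
    rw [e1] at bA
    have h4 := half _ m
    obtain ⟨r1, r2⟩ := digits_unique q (by linarith) (by linarith) e2
    have i1 : (d : ℤ) ∣ B - A := Int.ModEq.dvd (kotzigEntry_injective m (Int.emod_nonneg A q.ne')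
      (Int.emod_lt_of_pos A q) (Int.emod_nonneg B q.ne') (Int.emod_lt_of_pos B q) r1)
    have i2 : (d' : ℤ) ∣ B - A := Int.ModEq.dvd (kotzigEntry_injective m'
      (Int.emod_nonneg A q'.ne') (Int.emod_lt_of_pos A q') (Int.emod_nonneg B q'.ne')
      (Int.emod_lt_of_pos B q') r2)
    have i3 : (3 : ℤ) ∣ B - A := Int.ModEq.dvd e1
    have key : ((3 * (d * d') : ℕ) : ℤ) ∣ B - A := by
      rw [hcast]
      have c3 : IsCoprime (3 : ℤ) (d * d') := by
        exact_mod_cast Nat.isCoprime_iff_coprime.2 (h3.mul_left h3').symm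
      exact c3.mul_dvd i3 ((Nat.isCoprime_iff_coprime.2 hc).mul_dvd i1 i2)
    rw [← ZMod.intCast_eq_intCast_iff_dvd_sub, ← hA, ← hB] at key
    rwa [Int.cast_natCast, Int.cast_natCast, ZMod.natCast_zmod_val, ZMod.natCast_zmod_val] at key
  · have := hb v.val
    simp only [hG]
    rw [hcast]
    have : 0 ≤ (v.val : ℤ) % 3 := Int.emod_nonneg _ (by norm_num)
    linarith
  · have := hb v.val
    simp only [hG]
    rw [hcast]
    have : (v.val : ℤ) % 3 < 3 := Int.emod_lt_of_pos _ (by norm_num)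
    linarith
  · simp only [hG]
    rw [hcast, add_assoc]
    exact dvd_add (dvd_mul_right _ _) hodd
  · have hmod : ∀ (d : ℕ) (u t : ℤ), (d : ℤ) ∣ t → (u + t) % d = u % d := fun d u t ⟨k, hk⟩ => by
      rw [hk, Int.add_mul_emod_self_left]
    have hn3 : 3 ∣ 3 * (d * d') := dvd_mul_right _ _
    have s1 := h.sum_eq_zero hn3 ⟨3 * d', by ring⟩ hcard
      (H := fun u => 6 * kotzigEntry d (u % 3) (u % d) + 2 * (u % 3 - 1))
      (fun u s t h1 h2 h4 h5 h6 => by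
        simp only [hmod d u _ h5, hmod d u _ h6]
        have := kotzigEntry_column_sum d (u % d)
        exact sum_eq_zero_of_distinct_mod_three
          (F := fun e => 6 * kotzigEntry d e (u % d) + 2 * (e - 1)) (by linarith) h1 h2 h4) v
    have s2 := h'.sum_eq_zero hn3 ⟨3 * d, by ring⟩ hcard
      (H := fun u => 6 * d * kotzigEntry d' (u % 3) (u % d'))
      (fun u s t h1 h2 h4 h5 h6 => by
        simp only [hmod d' u _ h5, hmod d' u _ h6]
        have := kotzigEntry_column_sum d' (u % d')
        exact sum_eq_zero_of_distinct_mod_three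
          (F := fun e => 6 * d * kotzigEntry d' e (u % d'))
          (by linear_combination 6 * (d : ℤ) * this) h1 h2 h4) v
    have := congrArg₂ (· + ·) s1 s2
    simp only [← sum_add_distrib, add_zero] at this
    rw [← this]
    refine sum_congr rfl fun s _ => ?_
    simp only [hG, hK]
    ring

theorem exists_labelling_of_inSecondList {n : ℕ} (hodd : Odd n) {S : Finset (ZMod n)}
    (hS : S.card = 6) (h : InSecondList n S) : ∃ g, IsCentredLabelling n S g := by
  obtain ⟨n₀, hn₀, rfl, h⟩ := h
  have o₀ : Odd n₀ := (Nat.odd_mul.1 hodd).2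
  have transfer : ∀ (q : (ZMod (3 * n₀))ˣ) (x y z : ZMod (3 * n₀)),
      unitMul q S = pmSet x y z → ((pmSet x y z).card = 6 → ∃ g, IsCentredLabelling _ (pmSet x y z) g) →
      ∃ g, IsCentredLabelling (3 * n₀) S g := fun q x y z hq hg => by
    rw [← hq, card_unitMul] at hg
    obtain ⟨g, hg⟩ := hg hS
    exact ⟨_, hg.of_unitMul⟩
  rcases h with ⟨q, hq⟩ | ⟨d, d', rfl, hc, -, -, c3, c3', δ, hδ, e, c', -, -, e3, ed, ed', q, hq⟩
  · exact transfer q _ _ _ hq fun hcard => exists_labelling_of_third_turn o₀ hcard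
  · refine transfer q _ _ _ hq fun hcard => ?_
    have e := Int.modEq_iff_dvd.1 e
    have e3 := Int.modEq_zero_iff_dvd.1 e3
    have ed := (dvd_sub_comm).1 (Int.modEq_iff_dvd.1 ed)
    have ed' := (dvd_sub_comm).1 (Int.modEq_iff_dvd.1 ed')
    have key := exists_labelling_of_thirdCancels (Nat.odd_mul.1 o₀).1 (Nat.odd_mul.1 o₀).2 hc c3 c3'
      (x := 1) (y := (d * d' : ℕ) + δ) (z := c')
    simp only [Int.cast_natCast, Int.cast_one, Int.cast_add] at key
    -- The signed second generator is δ(n₀ + δ) = 1 + δ n₀, congruent to 1 modulo d and d' and to -1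
    -- modulo 3; only the sign of c' depends on the factor.
    have hσ : ∀ e : ℤ, e ∣ (d * d' : ℕ) → e ∣ δ * ((d * d' : ℕ) + δ) - 1 := fun e he => by
      have hδ2 : δ * δ = 1 := by rcases hδ with rfl | rfl <;> norm_num
      have : δ * ((d * d' : ℕ) + δ) - 1 = δ * (d * d' : ℕ) := by linear_combination hδ2
      rw [this]
      exact he.mul_left δ
    refine key hcard ⟨δ, 1, hδ, Or.inl rfl, hσ _ ?_, ?_, ?_⟩ ⟨δ, -1, hδ, Or.inr rfl, hσ _ ?_, ?_, ?_⟩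
    · push_cast; exact dvd_mul_right _ _
    · simpa using ed
    · rcases hδ with rfl | rfl <;> refine ⟨?_, ?_, ?_⟩ <;> omega
    · push_cast; exact dvd_mul_left _ _
    · have : (-1 : ℤ) * c' - 1 = -(c' - -1) := by ring
      rw [this]
      exact ed'.neg_right
    · rcases hδ with rfl | rfl <;> refine ⟨?_, ?_, ?_⟩ <;> omega

/-! ### Assembling the theorem -/

theorem neg_mem_pmSet {n : ℕ} {a b c s : ZMod n} (hs : s ∈ pmSet a b c) : -s ∈ pmSet a b c := by
  simp only [pmSet, mem_insert, mem_singleton] at hs ⊢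
  rcases hs with rfl | rfl | rfl | rfl | rfl | rfl <;> simp

theorem isGenericTriple_of_card_pmSet {n : ℕ} {a b c : ℤ}
    (hcard : (pmSet (a : ZMod n) b c).card = 6)
    (hgen : AddSubgroup.closure (pmSet (a : ZMod n) b c : Set (ZMod n)) = ⊤) :
    IsGenericTriple n a b c := by
  have hnd := nodup_of_card_pmSet hcard
  simp only [List.nodup_cons, List.mem_cons, List.not_mem_nil, or_false, not_or, not_false_eq_true,
    List.nodup_nil, and_true] at hnd
  obtain ⟨⟨h1, h2, h3, h4, h5⟩, -, ⟨h6, h7, h8⟩, -, h9⟩ := hnd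
  have sub : ∀ {x y : ℤ}, (x : ZMod n) ≠ y → ¬ (n : ℤ) ∣ x - y := fun {x y} h h' =>
    h ((ZMod.intCast_eq_intCast_iff_dvd_sub y x n).2 h').symm
  have add : ∀ {x y : ℤ}, (x : ZMod n) ≠ -y → ¬ (n : ℤ) ∣ x + y := fun {x y} h => by
    have := sub (x := x) (y := -y) (by rwa [Int.cast_neg])
    rwa [sub_neg_eq_add] at this
  refine ⟨fun p hp hpn ha hb hc => ?_, ?_, ?_, ?_, sub h2, add h3, sub h4, add h5, sub h7, add h8⟩
  -- A common prime factor would put S, and so all of ℤ/n, in the kernel of reduction modulo p.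
  · have : Fact p.Prime := ⟨hp⟩
    set f := ZMod.castHom hpn (ZMod p)
    have hle : AddSubgroup.closure (pmSet (a : ZMod n) b c : Set (ZMod n)) ≤
        f.toAddMonoidHom.ker := by
      rw [AddSubgroup.closure_le]
      intro s hs
      have za := (ZMod.intCast_zmod_eq_zero_iff_dvd a p).2 ha
      have zb := (ZMod.intCast_zmod_eq_zero_iff_dvd b p).2 hb
      have zc := (ZMod.intCast_zmod_eq_zero_iff_dvd c p).2 hc
      have : f s = 0 := by
        simp only [pmSet, coe_insert, coe_singleton, Set.mem_insert_iff,
          Set.mem_singleton_iff] at hs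
        rcases hs with rfl | rfl | rfl | rfl | rfl | rfl <;> simp [za, zb, zc]
      exact this
    rw [hgen] at hle
    have h1 : f 1 = 0 := hle (AddSubgroup.mem_top 1)
    rw [map_one] at h1
    exact one_ne_zero h1
  · rw [two_mul]; exact add h1
  · rw [two_mul]; exact add h6
  · rw [two_mul]; exact add h9

theorem zero_notMem_pmSet {n : ℕ} {a b c : ZMod n} (hcard : (pmSet a b c).card = 6) :
    (0 : ZMod n) ∉ pmSet a b c := by
  have hnd := nodup_of_card_pmSet hcard
  simp only [List.nodup_cons, List.mem_cons, List.not_mem_nil, or_false, not_or] at hnd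
  obtain ⟨⟨h1, -⟩, -, ⟨h2, -⟩, -, h3, -⟩ := hnd
  simp only [pmSet, mem_insert, mem_singleton]
  rintro (h | h | h | h | h | h)
  · exact h1 (by rw [← h, neg_zero])
  · exact h1 (by rw [← h, ← neg_eq_zero.1 h.symm])
  · exact h2 (by rw [← h, neg_zero])
  · exact h2 (by rw [← h, ← neg_eq_zero.1 h.symm])
  · exact h3 (by rw [← h, neg_zero])
  · exact h3 (by rw [← h, ← neg_eq_zero.1 h.symm])

theorem generatesOrder_kernelOrders {n : ℕ} [NeZero n] {a b c : ℤ}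
    (hcard : (pmSet (a : ZMod n) b c).card = 6) {g : ZMod n → ℤ}
    (hg : IsCentredLabelling n (pmSet (a : ZMod n) b c) g) :
    GeneratesOrder n (kernelOrders n a b c) where
  dvd _ hm := hm.1
  lcm _ hM := dvd_of_forall_kernelOrders_dvd hcard hg hM

theorem inFirstList_of_labelling {n : ℕ} [NeZero n] (hn : 7 ≤ n) (h3 : ¬ 3 ∣ n) {a b c : ℤ}
    (hcard : (pmSet (a : ZMod n) b c).card = 6) (hG : IsGenericTriple n a b c) {g : ZMod n → ℤ}
    (hg : IsCentredLabelling n (pmSet (a : ZMod n) b c) g) :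
    InFirstList n (pmSet (a : ZMod n) b c) := by
  refine inFirstList_of_orders hn hG (generatesOrder_kernelOrders hcard hg) fun m hm => ?_
  rcases roles_of_mem_kernelOrders (by omega) hm with h | h | ⟨-, h | h | h⟩
  · exact h
  · exact absurd (h.three_dvd.trans hm.1) h3
  all_goals exact absurd (h.three_dvd.trans hm.1) h3

/-- Quarter roles need 4 ∣ n. Even n contradicts `exists_kernelOrders_dvd_of_even` through
`exists_third_of_orders`, and for odd n the decagon roles disappear because they need an even order.
-/
theorem inSecondList_of_labelling {n : ℕ} [NeZero n] (hn : 7 ≤ n) (h4 : ¬ 4 ∣ n) {a b c : ℤ}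
    (hcard : (pmSet (a : ZMod n) b c).card = 6) (hG : IsGenericTriple n a b c) {g : ZMod n → ℤ}
    (hg : IsCentredLabelling n (pmSet (a : ZMod n) b c) g) :
    Odd n ∧ InSecondList n (pmSet (a : ZMod n) b c) := by
  have hD := generatesOrder_kernelOrders hcard hg
  have hrole : ∀ m ∈ kernelOrders n a b c, ThirdRole m a b c ∨
      Even m ∧ (DecagonRole m a b c ∨ DecagonRole m b a c ∨ DecagonRole m c a b) := fun m hm => by
    rcases roles_of_mem_kernelOrders (by omega) hm with h | h
    · obtain ⟨x, h⟩ : ∃ x, 4 * x = m := by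
        rcases h with h | h | h <;> obtain ⟨x, h, -⟩ := h.four_dvd <;> exact ⟨x, h.symm⟩
      exact absurd ((Dvd.intro x h).trans hm.1) h4
    · exact h
  have hodd : Odd n := by
    by_contra hodd
    rw [Nat.not_odd_iff_even] at hodd
    obtain ⟨k, rfl, hk⟩ := exists_third_of_orders (by omega) hG hD fun m hm => by
      rcases hrole m hm with h | ⟨-, h⟩
      · exact Or.inl h
      · exact Or.inr h
    obtain ⟨m, hm, hmk⟩ := exists_kernelOrders_dvd_of_even hcard hg
      ((Nat.even_mul.1 hodd).resolve_left (by decide))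
    exact hk m hm hmk
  refine ⟨hodd, inSecondList_of_orders hn hodd hG hD fun m hm => ?_⟩
  rcases hrole m hm with h | ⟨he, -⟩
  · exact h
  · exact absurd (he.trans_dvd hm.1) (Nat.not_even_iff_odd.2 hodd)
theorem mainTheorem1 (n : ℕ) [NeZero n] (hn : 7 ≤ n) (a b c : ZMod n)
    (hcard : (pmSet a b c).card = 6)
    (hgen : AddSubgroup.closure (pmSet a b c : Set (ZMod n)) = ⊤) :
    (¬ 3 ∣ n →
      (IsDistanceMagic (Circ n (pmSet a b c)) ↔ InFirstList n (pmSet a b c))) ∧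
    (¬ 4 ∣ n →
      (IsDistanceMagic (Circ n (pmSet a b c)) ↔ Odd n ∧ InSecondList n (pmSet a b c))) ∧
    (∀ m : ℕ, Odd m → n = 2 * m → ¬ IsDistanceMagic (Circ n (pmSet a b c))) := by

  obtain ⟨a, rfl⟩ := ZMod.intCast_surjective a
  obtain ⟨b, rfl⟩ := ZMod.intCast_surjective b
  obtain ⟨c, rfl⟩ := ZMod.intCast_surjective c
  have hG := isGenericTriple_of_card_pmSet hcard hgen
  have hiff := isDistanceMagic_circ_iff (fun s => neg_mem_pmSet (s := s))
    (zero_notMem_pmSet hcard) hcard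
  have second : ¬ 4 ∣ n → (IsDistanceMagic (Circ n (pmSet (a : ZMod n) b c)) ↔
      Odd n ∧ InSecondList n (pmSet (a : ZMod n) b c)) := fun h4 => by
    rw [hiff]
    constructor
    · rintro ⟨g, hg⟩
      exact inSecondList_of_labelling hn h4 hcard hG hg
    · rintro ⟨hodd, h⟩
      exact exists_labelling_of_inSecondList hodd hcard h
  refine ⟨fun h3 => ?_, second, fun m hm hnm hdm => ?_⟩
  · rw [hiff]
    constructor
    · rintro ⟨g, hg⟩
      exact inFirstList_of_labelling hn h3 hcard hG hg
    · exact exists_labelling_of_inFirstList hcard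
  · obtain ⟨t, rfl⟩ := hm
    have := ((second (by omega)).1 hdm).1
    rw [Nat.odd_iff] at this
    omega
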